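/- Definitions. A polyomino is a finite nonempty edge-connected set $P\subset\mathbb Z^2$ of unit squares; its edges are the sides of its squares that lie on its boundary. A polyomino tile is a polyomino some of whose edges are labelled with glues, each glue having an integer strength. A tile assembly system (polyTAM system) $\mathcal T=(T,\sigma,\tau)$ consists of a finite set $T$ of polyomino tiles, a temperature $\tau\ge 1$, and a finite nonempty $\tau$-stable seed $\sigma$ of non-overlapping integer translates of tiles of $T$ ($\tau$-stable: every partition into two nonempty groups separates bound glues of total strength at least $\tau$). A translate of a tile of $T$ may attach to an assembly if it overlaps no tile already there and its edges abut edges with equal glues of total strength at least $\tau$. The producible assemblies are the results of finite sequences of single attachments starting from $\sigma$, and the limits of infinite ones. A set $T$ of tiles, all of one shape $P$, is $c$-position limited if at most $c$ edges of $P$ carry a glue on some tile of $T$. A Turing machine $M=(Q,\Gamma,q_0,\text{blank},\delta)$ has finite $Q$, $\Gamma$, a partial transition function $\delta:Q\times\Gamma\rightharpoonup Q\times\Gamma\times\{L,R\}$ and a two-way infinite tape; it halts where $\delta$ is undefined. For $w\in\Gamma^*$ let $C_0,C_1,\dots$ be its (finite or infinite) sequence of configurations on input $w$ (initially $w$ is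 on the cells $0,\dots,|w|-1$, all other cells are blank, and the head is on cell $0$ in state $q_0$), and let $C_n(i)\in\Gamma\times(Q\cup\{\text{no head}\})$ be the content of cell $i$ in $C_n$. Theorem. There is a set $S$ of $4$ edges of the $1\times 4$ polyomino such that for every Turing machine $M$ there are - a finite ($4$-position limited) set $T$ of tiles of $1\times 4$ shape carrying glues only on edges in $S$, with glue strengths; - a partial function $\mathrm{read}$ from tiles to $\Gamma\times(Q\cup\{\text{no head}\})$; - $o,u,v\in\mathbb Z^2$ with $u,v$ linearly independent; and - finite sets $A_{\mathrm{left}}$, $A_{\mathrm{right}}$, $B_c$ ($c\in\Gamma\times(Q\cup\{\text{no head}\})$) of placed tiles, such that for every input $w\in\Gamma^*$ the set $$\sigma_w=A_{\mathrm{left}}\cup\bigcup_{i=0}^{|w|}\bigl(B_{C_0(i)}+i\,u\bigr)\cup\bigl(A_{\mathrm{right}}+(|w|+1)\,u\bigr)$$ is a valid seed, and the temperature-$1$ system $\mathcal T_w=(T,\sigma_w,1)$ simulates $M$ on $w$ in the following sense: 1. whenever a tile $t$ with $\mathrm{read}(t)$ defined occurs at position $p$ in a producible assembly of $\mathcal T_w$,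 there are $n\ge 0$ such that $C_n$ exists, and $i\in\mathbb Z$, with $p=o+n v+i u$ and $\mathrm{read}(t)=C_n(i)$; 2. for every $n$ such that $C_n$ exists, every producible assembly of $\mathcal T_w$ can grow by finitely many attachments to one in which, for each cell $i$ that carries the head or a non-blank symbol in $C_n$, there is a tile $t$ at $o+n v+i u$ with $\mathrm{read}(t)=C_n(i)$; 3. if $M$ halts on $w$, then every producible assembly of $\mathcal T_w$ is finite. In this sense there are $4$-position limited polyTAM systems that are computationally universal at temperature $1$. -/

import Mathlib

/-! ### Polyominoes and polyomino tiles -/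

namespace PolyTAM

/-- The four sides of a unit square. -/
inductive Side
  | north
  | east
  | south
  | west
  deriving DecidableEq

instance : Fintype Side where
  elems := {.north, .east, .south, .west}
  complete s := by cases s <;> decide

/-- The unit vector pointing out of a unit square through the given side. -/
def Side.vec : Side → ℤ × ℤ
  | .north => (0, 1)
  | .east => (1, 0)
  | .south => (0, -1)
  | .west => (-1, 0)

/-- The opposite side. -/
def Side.opp : Side → Side
  | .north => .south
  | .east => .west
  | .south => .north
  | .west => .east

/-- A side of a unit square of the integer grid: the square's centre, and the side. -/
abbrev Edge := (ℤ × ℤ) × Side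

/-- A polyomino: a finite nonempty set of unit squares (given by their centres in `ℤ²`) any two of
which are joined by a chain of edge-adjacent squares of the set. -/
def IsPolyomino (P : Finset (ℤ × ℤ)) : Prop :=
  P.Nonempty ∧ ∀ a ∈ P, ∀ b ∈ P,
    Relation.ReflTransGen (fun x y => y ∈ P ∧ ∃ s : Side, y = x + s.vec) a b

/-- The edges of a polyomino: the sides of its unit squares that lie on its boundary. -/
def edges (P : Finset (ℤ × ℤ)) : Finset Edge :=
  (P ×ˢ Finset.univ).filter fun e => e.1 + e.2.vec ∉ P

/-- A polyomino tile: a polyomino with a subset of its edges labelled by glues from `G`. -/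
structure PolyTile (G : Type) where
  shape : Finset (ℤ × ℤ)
  isPolyomino : IsPolyomino shape
  glue : Edge → Option G
  glue_edge : ∀ e, glue e ≠ none → e ∈ edges shape

/-- A translated copy of a tile: the tile and its integer translation vector. -/
abbrev Placement (G : Type) := PolyTile G × (ℤ × ℤ)

variable {G : Type}

/-- The unit squares covered by a placed tile. -/
def Placement.cells (p : Placement G) : Set (ℤ × ℤ) :=
  {z | z - p.2 ∈ p.1.shape}

/-- The glue that a placed tile carries on a given side in the plane, if any. -/
def Placement.glueAt (p : Placement G) (e : Edge) : Option G :=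
  p.1.glue (e.1 - p.2, e.2)

/-- Translation of a placed tile. -/
def Placement.translate (v : ℤ × ℤ) (p : Placement G) : Placement G :=
  (p.1, p.2 + v)

/-- Seen from the neighbouring square, the side in the plane that coincides with the edge `e`
of the placed tile `p`. -/
def Placement.facing (p : Placement G) (e : Edge) : Edge :=
  (e.1 + p.2 + e.2.vec, e.2.opp)

/-- No two distinct placed tiles of `A` overlap. -/
def NonOverlapping (A : Set (Placement G)) : Prop :=
  A.Pairwise fun p q => Disjoint p.cells q.cells

open scoped Classical in
/-- The total strength of the glues by which the placed tile `p` is bound to the tiles of `A`: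
the sum over the edges of `p` that carry a glue and abut an edge of a tile of `A` carrying the
same glue. -/
noncomputable def bindingStrength (strength : G → ℤ) (A : Set (Placement G))
    (p : Placement G) : ℤ :=
  ∑ e ∈ edges p.1.shape,
    match p.1.glue e with
    | none => 0
    | some g => if ∃ q ∈ A, q.glueAt (p.facing e) = some g then strength g else 0

open scoped Classical in
/-- `τ`-stability of a finite set of placed tiles: every partition into two nonempty groups
separates bound glues whose strengths sum to at least `τ`. -/
def IsStable (strength : G → ℤ) (τ : ℕ) (A : Finset (Placement G)) : Prop :=
  ∀ X ⊆ A, X.Nonempty → (A \ X).Nonempty →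
    (τ : ℤ) ≤ ∑ p ∈ X, bindingStrength strength (↑(A \ X)) p

/-! ### Tile assembly systems -/

/-- A tile assembly system with a finite tile set and a finite seed. (A stable set of tiles is
connected, since the temperature is positive.) -/
structure TileAssemblySystem (G : Type) where
  tiles : Set (PolyTile G)
  tiles_finite : tiles.Finite
  strength : G → ℤ
  temperature : ℕ
  temperature_pos : 0 < temperature
  seed : Finset (Placement G)
  seed_nonempty : seed.Nonempty
  seed_tiles : ∀ p ∈ seed, p.1 ∈ tiles
  seed_nonOverlapping : NonOverlapping (seed : Set (Placement G))
  seed_stable : IsStable strength temperature seed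

/-- The placed tile `p` can attach to the assembly `A`. -/
def TileAssemblySystem.CanAttach (𝒯 : TileAssemblySystem G) (A : Set (Placement G))
    (p : Placement G) : Prop :=
  p.1 ∈ 𝒯.tiles ∧ (∀ q ∈ A, Disjoint p.cells q.cells) ∧
    (𝒯.temperature : ℤ) ≤ bindingStrength 𝒯.strength A p

/-- `A` grows to `B` by the attachment of a single tile. -/
def TileAssemblySystem.Step (𝒯 : TileAssemblySystem G) (A B : Set (Placement G)) : Prop :=
  ∃ p, 𝒯.CanAttach A p ∧ B = insert p A

/-- `A` grows to `B` by finitely many (possibly zero) single tile attachments. -/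
def TileAssemblySystem.Grows (𝒯 : TileAssemblySystem G) : Set (Placement G) →
    Set (Placement G) → Prop :=
  Relation.ReflTransGen 𝒯.Step

/-- The producible assemblies: the results of finite assembly sequences starting from the seed,
and the limits of infinite ones. -/
def TileAssemblySystem.IsProducible (𝒯 : TileAssemblySystem G) (A : Set (Placement G)) : Prop :=
  𝒯.Grows (↑𝒯.seed) A ∨
    ∃ α : ℕ → Set (Placement G), α 0 = ↑𝒯.seed ∧ (∀ k, 𝒯.Step (α k) (α (k + 1))) ∧ A = ⋃ k, α k

/-! ### Limited glue positions -/

/-- The glue locations of a tile set: the edges on which some tile of the set carries a glue. -/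
def glueLocations (T : Set (PolyTile G)) : Set Edge :=
  {e | ∃ t ∈ T, t.glue e ≠ none}

/-- A tile set is `c`-position limited if all its tiles have the same shape and it has at most `c`
glue locations. -/
def IsPositionLimited (c : ℕ) (T : Set (PolyTile G)) : Prop :=
  (∃ P, ∀ t ∈ T, t.shape = P) ∧ (glueLocations T).encard ≤ c

/-- The `1 × 4` polyomino. -/
def bar : Finset (ℤ × ℤ) := {(0, 0), (0, 1), (0, 2), (0, 3)}

end PolyTAM

/-! ### Turing machines -/

namespace StdTM

/-- A deterministic one-tape Turing machine with state set `Q` and tape alphabet `Γ`, working on a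
two-way infinite tape. In each step it writes a symbol, moves the head by one cell to the left or to
the right and changes state; it halts where the transition function is undefined. -/
structure Machine (Q Γ : Type) where
  start : Q
  blank : Γ
  δ : Q → Γ → Option (Q × Γ × Turing.Dir)

/-- A configuration: state, head position and tape contents. -/
structure Cfg (Q Γ : Type) where
  state : Q
  head : ℤ
  tape : ℤ → Γ

variable {Q Γ : Type}

/-- The displacement of the head. -/
def shift : Turing.Dir → ℤ
  | .left => -1
  | .right => 1

/-- The content of a cell in a configuration: the symbol on it and, if the head is there,
the state. -/
def Cfg.cell (C : Cfg Q Γ) (i : ℤ) : Γ × Option Q :=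
  (C.tape i, if i = C.head then some C.state else none)

/-- The initial configuration on input `w`: the word is written on the cells `0, 1, …, |w| - 1`,
all other cells are blank, and the head is on cell `0` in the start state. -/
def Machine.init (M : Machine Q Γ) (w : List Γ) : Cfg Q Γ where
  state := M.start
  head := 0
  tape i := if 0 ≤ i then w.getD i.toNat M.blank else M.blank

/-- One step of computation; `none` if the machine has halted. -/
def Machine.next (M : Machine Q Γ) (C : Cfg Q Γ) : Option (Cfg Q Γ) :=
  (M.δ C.state (C.tape C.head)).map fun r =>
    { state := r.1, head := C.head + shift r.2.2, tape := Function.update C.tape C.head r.2.1 }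

/-- The configuration after `n` steps on input `w`; `none` if there are fewer than `n` steps. -/
def Machine.run (M : Machine Q Γ) (w : List Γ) : ℕ → Option (Cfg Q Γ)
  | 0 => some (M.init w)
  | n + 1 => (M.run w n).bind M.next

/-- `M` halts on input `w`. -/
def Machine.Halts (M : Machine Q Γ) (w : List Γ) : Prop :=
  ∃ n, M.run w n = none

end StdTM

/-! ### Simulation of Turing machines by tile assembly systems -/

namespace PolyTAM

variable {G Q Γ : Type}

/-- Where a space-time diagram is drawn in the plane: cell `i` of the configuration after `n` steps
is displayed at `origin + n • up + i • right`. -/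
structure Layout where
  origin : ℤ × ℤ
  right : ℤ × ℤ
  up : ℤ × ℤ
  independent : right.1 * up.2 - right.2 * up.1 ≠ 0

/-- The place of cell `i` at time `n`. -/
def Layout.pos (L : Layout) (n : ℕ) (i : ℤ) : ℤ × ℤ :=
  L.origin + (n : ℤ) • L.up + i • L.right

open scoped Classical in
/-- The seed row for input `w`: a fixed left end, one block for each of the cells `0, 1, …, |w|`
of the initial configuration, depending only on the content of that cell and translated to the
column of the cell, and a fixed right end. -/
noncomputable def inputSeed (L : Layout) (leftEnd rightEnd : Finset (Placement G))
    (block : Γ × Option Q → Finset (Placement G)) (M : StdTM.Machine Q Γ) (w : List Γ) :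
    Finset (Placement G) :=
  leftEnd ∪
    ((Finset.range (w.length + 1)).biUnion fun i =>
      (block ((M.init w).cell i)).image (Placement.translate ((i : ℤ) • L.right))) ∪
    rightEnd.image (Placement.translate (((w.length : ℤ) + 1) • L.right))

/-- The assembly `A` displays `C` as the configuration at time `n`: for each cell of `C` that
carries the head or is not blank there is, at the place of that cell, a tile whose type is read as
the content of the cell. -/
def Displays (L : Layout) (read : PolyTile G → Option (Γ × Option Q)) (blank : Γ)
    (A : Set (Placement G)) (n : ℕ) (C : StdTM.Cfg Q Γ) : Prop :=
  ∀ i : ℤ, C.cell i ≠ (blank, none) → ∃ t, (t, L.pos n i) ∈ A ∧ read t = some (C.cell i)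

/-- The system `𝒯` simulates the machine `M` on input `w`, where `read` tells which tile types
represent which cell contents. -/
structure Simulates (𝒯 : TileAssemblySystem G) (L : Layout)
    (read : PolyTile G → Option (Γ × Option Q)) (M : StdTM.Machine Q Γ) (w : List Γ) : Prop where
  /-- In no assembly sequence is anything displayed that does not occur in the computation. -/
  sound : ∀ A, 𝒯.IsProducible A → ∀ t p c, (t, p) ∈ A → read t = some c →
    ∃ n i C, M.run w n = some C ∧ p = L.pos n i ∧ c = C.cell i
  /-- No assembly sequence can prevent a configuration of the computation from being displayed. -/
  complete : ∀ A, 𝒯.IsProducible A → ∀ n C, M.run w n = some C →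
    ∃ B, 𝒯.Grows A B ∧ Displays L read M.blank B n C
  /-- Growth stops if the computation does. -/
  finite_of_halts : M.Halts w → ∀ A, 𝒯.IsProducible A → A.Finite

end PolyTAM

/-! At temperature 1 with all strengths equal to 1, one matching glue suffices for an attachment, so
earlier tiles can influence later growth only by standing in the way. The tiles are designed so that
every finite producible assembly is an initial segment of one path of bars; the path obtains data
from its own earlier part by being blocked by it.

Geometry. The glues sit on the western side at heights 0 and 2 and on the eastern side at heights 0
and 3. A step to the right therefore changes the height of the bar by 0, 1, 3 or -2, a step to the
left by 0, 2, -1 or -3, and a bar entered on one side can be left by the other port of the same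
side. This is enough to climb, descend and turn back. The plane is divided into zones of width 13
and rows of height 25. A bit is written as the outline of the path in a zone. In the next row, which
is traversed in the opposite direction, a `fork` descends towards that outline and ends in a bar
with two exits: the bit `false` fills the place behind the lower exit, the bit `true` has an
overhang that fills the place behind the upper one, and the place behind the other exit is free
(`Piece.exists_not_apart_write_sense`, `Piece.apart_write_sense`). All such facts about the pieces
are finite checks.

Determinism. A glue determines the side on which it serves to enter a tile, and it is offered by a
predecessor only on the opposite side, so bonds are oriented (`Zigzag.bond_cases`). Forwards, a bar
admits only its successor, except at a fork, where the wrong successor is blocked by a lower row.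
Backwards, the place of the predecessor is occupied, and the first bar of the path has an entry glue
that no tile offers. This is `Zigzag.IsRoute.isTrack`; `IsTrack` then gives the assemblies of the
system.

Computation. A zigzag automaton sweeps to and fro over the rows. In each cell it reads a symbol in
the first half met and writes one in the second half, which the next sweep meets first.
`segApart_of_within` shows that rows do not collide, and `IsValid.isRoute` turns a valid tableau of
such an automaton into a route. One step of a Turing machine takes two sweeps: moves to the left are
carried out in the sweep to the left, moves to the right are only marked there and are completed in
the sweep to the right. Each row is longer than the one before by one cell, and a halting head
leaves the path without a successor. That this tableau is valid is `isValid_tableau`;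
`assembly_route_zero` identifies its row 0 with the prescribed seed, and `simulates` reads off the
result. -/

namespace PolyTAM

section Tracks

variable {G : Type}

/-! ### Bonds between placed tiles -/

/-- The placed tiles `p` and `q` abut along an edge on which both carry the same glue. -/
def Bond (p q : Placement G) : Prop :=
  ∃ e g, q.1.glue e = some g ∧ p.glueAt (q.facing e) = some g

theorem Side.vec_opp (s : Side) : s.opp.vec = -s.vec := by
  cases s <;> rfl

theorem Side.opp_opp (s : Side) : s.opp.opp = s := by
  cases s <;> rfl

theorem Side.opp_ne (s : Side) : s.opp ≠ s := by
  cases s <;> decide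

theorem Bond.symm {p q : Placement G} (h : Bond p q) : Bond q p := by
  obtain ⟨e, g, h1, h2⟩ := h
  refine ⟨((q.facing e).1 - p.2, (q.facing e).2), g, h2, ?_⟩
  have : q.glueAt (p.facing ((q.facing e).1 - p.2, (q.facing e).2)) = q.1.glue e := by
    unfold Placement.glueAt Placement.facing
    congr 1
    refine Prod.ext ?_ (Side.opp_opp _)
    simp [Side.vec_opp]
  rw [this, h1]

theorem bindingStrength_nonneg (A : Set (Placement G)) (p : Placement G) :
    0 ≤ bindingStrength (fun _ => 1) A p := by
  unfold bindingStrength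
  refine Finset.sum_nonneg fun e _ => ?_
  split
  · exact le_rfl
  · split <;> simp

/-- With unit strengths at temperature 1 there is no cooperation between glues: attachment is
governed by the binary relation `Bond`. -/
theorem one_le_bindingStrength_iff (A : Set (Placement G)) (q : Placement G) :
    1 ≤ bindingStrength (fun _ => 1) A q ↔ ∃ p ∈ A, Bond p q := by
  classical
  constructor
  · intro h
    by_contra hne
    push Not at hne
    have : bindingStrength (fun _ => 1) A q = 0 := by
      unfold bindingStrength
      refine Finset.sum_eq_zero fun e _ => ?_
      split
      · rfl
      · rename_i g hg
        rw [if_neg]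
        rintro ⟨p, hp, hpg⟩
        exact hne p hp ⟨e, g, hg, hpg⟩
    omega
  · rintro ⟨p, hp, e, g, hg, hpg⟩
    unfold bindingStrength
    have he : e ∈ edges q.1.shape := q.1.glue_edge e (by rw [hg]; simp)
    refine le_trans (le_of_eq ?_) (Finset.single_le_sum (f := fun e =>
      match q.1.glue e with
      | none => (0 : ℤ)
      | some g => if ∃ p ∈ A, p.glueAt (q.facing e) = some g then 1 else 0) ?_ he)
    · simp only [hg]
      rw [if_pos ⟨p, hp, hpg⟩]
    · intro e _
      split
      · exact le_rfl
      · split <;> simp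

/-- A finite set of placed tiles that can be listed so that consecutive ones are bonded is
stable. -/
theorem isStable_of_isChain {A : Finset (Placement G)} {l : List (Placement G)}
    (hl : ∀ x, x ∈ A ↔ x ∈ l) (hc : l.IsChain Bond) : IsStable (fun _ => 1) 1 A := by
  classical
  intro X hX hne hne'
  have key : ∃ a b, a ∈ X ∧ b ∈ A \ X ∧ Bond b a := by
    by_contra hcon
    push Not at hcon
    -- Without a bond across the cut, membership in `X` would be constant along the chain.
    have aux : ∀ l : List (Placement G), (∀ x ∈ l, x ∈ A) → l.IsChain Bond →
        ∀ x ∈ l, ∀ y ∈ l, (x ∈ X ↔ y ∈ X) := by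
      intro l hl hc
      induction l with
      | nil => simp
      | cons a l ih =>
        have h1 := ih (fun x hx => hl x (List.mem_cons_of_mem _ hx)) hc.tail
        cases l with
        | nil => intro x hx y hy; simp at hx hy; rw [hx, hy]
        | cons b l =>
          have hab : Bond a b := hc.rel
          have h2 : a ∈ X ↔ b ∈ X := by
            constructor
            · intro ha
              by_contra hb
              exact hcon a b ha (Finset.mem_sdiff.2 ⟨hl b (by simp), hb⟩) hab.symm
            · intro hb
              by_contra ha
              exact hcon b a hb (Finset.mem_sdiff.2 ⟨hl a (by simp), ha⟩) hab
          have h3 : ∀ x ∈ a :: b :: l, (x ∈ X ↔ b ∈ X) := by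
            intro x hx
            rcases List.mem_cons.1 hx with rfl | hx
            · exact h2
            · exact h1 x hx b (by simp)
          intro x hx y hy
          rw [h3 x hx, h3 y hy]
    obtain ⟨x, hx⟩ := hne
    obtain ⟨y, hy⟩ := hne'
    have := aux l (fun x hx => (hl x).2 hx) hc x ((hl x).1 (hX hx)) y
      ((hl y).1 (Finset.mem_sdiff.1 hy).1)
    exact (Finset.mem_sdiff.1 hy).2 (this.1 hx)
  obtain ⟨a, b, ha, hb, hab⟩ := key
  have h1 : (1 : ℤ) ≤ bindingStrength (fun _ => 1) (↑(A \ X) : Set (Placement G)) a :=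
    (one_le_bindingStrength_iff _ _).2 ⟨b, hb, hab⟩
  refine le_trans ?_ (Finset.single_le_sum (fun p _ => bindingStrength_nonneg _ p) ha)
  rw [Nat.cast_one]
  convert h1

/-! ### Systems that assemble a single path -/

/-- The lists `F 0`, `F 1`, … are initial segments of one path of placed tiles, along which the
system grows deterministically from its seed `F 0`. -/
structure IsTrack (𝒯 : TileAssemblySystem G) (F : ℕ → List (Placement G)) : Prop where
  strength : 𝒯.strength = fun _ => 1
  temperature : 𝒯.temperature = 1
  seed : ∀ x, x ∈ 𝒯.seed ↔ x ∈ F 0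
  ne_nil : F 0 ≠ []
  mono : ∀ n, F n <+: F (n + 1)
  tiles : ∀ n, ∀ x ∈ F n, x.1 ∈ 𝒯.tiles
  disjoint : ∀ n, (F n).Pairwise fun p q => Disjoint p.cells q.cells
  chain : ∀ n, (F n).IsChain Bond
  -- The bond may be to any tile of the segment, not only to its last one, so side branches and
  -- growth against the direction of the path are excluded too.
  next : ∀ n l, F 0 <+: l → l <+: F n → ∀ q, q.1 ∈ 𝒯.tiles →
    (∀ p ∈ l, Disjoint q.cells p.cells) → (∃ p ∈ l, Bond p q) → ∃ m, l ++ [q] <+: F m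

namespace IsTrack

variable {𝒯 : TileAssemblySystem G} {F : ℕ → List (Placement G)}

theorem prefix_of_le (h : IsTrack 𝒯 F) {m n : ℕ} (hmn : m ≤ n) : F m <+: F n := by
  induction hmn with
  | refl => exact List.prefix_rfl
  | step _ ih => exact ih.trans (h.mono _)

theorem canAttach_iff (h : IsTrack 𝒯 F) (A : Set (Placement G)) (q : Placement G) :
    𝒯.CanAttach A q ↔ q.1 ∈ 𝒯.tiles ∧ (∀ p ∈ A, Disjoint q.cells p.cells) ∧ ∃ p ∈ A, Bond p q := by
  unfold TileAssemblySystem.CanAttach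
  rw [h.strength, h.temperature, Nat.cast_one, one_le_bindingStrength_iff]

/-- Consecutive tiles are bonded and no two overlap, so the tiles can be attached in the order of
the path. -/
theorem grows (h : IsTrack 𝒯 F) {n : ℕ} {l l' : List (Placement G)} (hl : F 0 <+: l)
    (hll : l <+: l') (hn : l' <+: F n) : 𝒯.Grows {x | x ∈ l} {x | x ∈ l'} := by
  obtain ⟨t, rfl⟩ := hll
  induction t using List.reverseRecOn with
  | nil => rw [List.append_nil]; exact Relation.ReflTransGen.refl
  | append_singleton t q ih =>
    rw [← List.append_assoc] at hn ⊢
    have hn' : l ++ t <+: F n := (List.prefix_append _ _).trans hn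
    refine (ih hn').tail ⟨q, (h.canAttach_iff _ _).2 ⟨?_, ?_, ?_⟩, ?_⟩
    · exact h.tiles n q (hn.subset (by simp))
    · intro p hp
      have := (h.disjoint n).sublist hn.sublist
      rw [List.pairwise_append] at this
      exact (this.2.2 p hp q (by simp)).symm
    · have hc := (h.chain n).prefix hn
      have hne : l ++ t ≠ [] := by
        have := hl.ne_nil h.ne_nil
        simp [this]
      rw [List.isChain_append] at hc
      exact ⟨(l ++ t).getLast hne, List.getLast_mem hne,
        hc.2.2 _ (List.getLast?_eq_some_getLast hne) q (by simp)⟩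
    · ext x
      simp only [List.mem_append, List.mem_singleton, Set.mem_ofPred_eq, Set.mem_insert_iff]
      exact or_comm

theorem step_prefix (h : IsTrack 𝒯 F) {n : ℕ} {l : List (Placement G)} (hl : F 0 <+: l)
    (hn : l <+: F n) {B : Set (Placement G)} (hB : 𝒯.Step {x | x ∈ l} B) :
    ∃ q m, l ++ [q] <+: F m ∧ B = {x | x ∈ l ++ [q]} := by
  obtain ⟨q, hq, rfl⟩ := hB
  rw [h.canAttach_iff] at hq
  obtain ⟨m, hm⟩ := h.next n l hl hn q hq.1 hq.2.1 hq.2.2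
  refine ⟨q, m, hm, ?_⟩
  ext x
  simp [or_comm]

/-- By `step_prefix` each attachment lengthens the initial segment by one tile. A finite sequence
thus gives an initial segment, and the limit of an infinite one contains arbitrarily long ones. -/
theorem producible_cases (h : IsTrack 𝒯 F) {A : Set (Placement G)} (hA : 𝒯.IsProducible A) :
    (∃ n l, F 0 <+: l ∧ l <+: F n ∧ A = {x | x ∈ l}) ∨
      (∀ k, ∃ n l, l <+: F n ∧ k ≤ l.length ∧ {x | x ∈ l} ⊆ A) ∧ ∀ x ∈ A, ∃ n, x ∈ F n := by
  have h0 : (↑𝒯.seed : Set (Placement G)) = {x | x ∈ F 0} := by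
    ext x; exact h.seed x
  rcases hA with hA | ⟨α, hα0, hα, rfl⟩
  · left
    rw [h0] at hA
    induction hA with
    | refl => exact ⟨0, F 0, List.prefix_rfl, List.prefix_rfl, rfl⟩
    | tail _ hs ih =>
      obtain ⟨n, l, hl, hn, rfl⟩ := ih
      obtain ⟨q, m, hm, rfl⟩ := h.step_prefix hl hn hs
      exact ⟨m, _, hl.trans (List.prefix_append _ _), hm, rfl⟩
  · right
    have key : ∀ k, ∃ n l, F 0 <+: l ∧ l <+: F n ∧ k ≤ l.length ∧ α k = {x | x ∈ l} := by
      intro k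
      induction k with
      | zero => exact ⟨0, F 0, List.prefix_rfl, List.prefix_rfl, Nat.zero_le _, hα0.trans h0⟩
      | succ k ih =>
        obtain ⟨n, l, hl, hn, hk, hαk⟩ := ih
        have hs := hα k
        rw [hαk] at hs
        obtain ⟨q, m, hm, hq⟩ := h.step_prefix hl hn hs
        exact ⟨m, _, hl.trans (List.prefix_append _ _), hm, by simpa using hk, hq⟩
    constructor
    · intro k
      obtain ⟨n, l, -, hn, hk, hαk⟩ := key k
      exact ⟨n, l, hn, hk, hαk ▸ Set.subset_iUnion α k⟩
    · intro x hx
      obtain ⟨k, hk⟩ := Set.mem_iUnion.1 hx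
      obtain ⟨n, l, -, hn, -, hαk⟩ := key k
      rw [hαk] at hk
      exact ⟨n, hn.subset hk⟩

theorem mem_of_producible (h : IsTrack 𝒯 F) {A : Set (Placement G)} (hA : 𝒯.IsProducible A)
    {x : Placement G} (hx : x ∈ A) : ∃ n, x ∈ F n := by
  rcases h.producible_cases hA with ⟨n, l, -, hn, rfl⟩ | ⟨-, h2⟩
  · exact ⟨n, hn.subset hx⟩
  · exact h2 x hx

theorem exists_grows (h : IsTrack 𝒯 F) {A : Set (Placement G)} (hA : 𝒯.IsProducible A) (n : ℕ) :
    ∃ B, 𝒯.Grows A B ∧ ∀ x ∈ F n, x ∈ B := by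
  rcases h.producible_cases hA with ⟨m, l, hl, hm, rfl⟩ | ⟨h1, -⟩
  · refine ⟨{x | x ∈ F (max m n)}, h.grows hl (hm.trans (h.prefix_of_le (le_max_left _ _)))
      List.prefix_rfl, fun x hx => (h.prefix_of_le (le_max_right m n)).subset hx⟩
  -- A limit needs no further growth: two initial segments of one path are comparable, so one that
  -- is long enough contains `F n`.
  · refine ⟨A, Relation.ReflTransGen.refl, fun x hx => ?_⟩
    obtain ⟨m, l, hm, hk, hlA⟩ := h1 (F n).length
    have h2 : F n <+: l := List.prefix_of_prefix_length_le
      (h.prefix_of_le (le_max_right m n)) (hm.trans (h.prefix_of_le (le_max_left m n))) hk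
    exact hlA (h2.subset hx)

end IsTrack

end Tracks

end PolyTAM

namespace PolyTAM

section Pieces

open Turing (Dir)

/-! ### The glue positions, and the pieces from which paths are put together -/

/-- The four edges of the bar that may carry glues. -/
def ports : Finset Edge :=
  {((0, 0), .west), ((0, 2), .west), ((0, 0), .east), ((0, 3), .east)}

theorem ports_subset : ports ⊆ edges bar := by decide

theorem card_ports : ports.card = 4 := by decide

/-- The types of pieces, each fitting into a zone of width `13`. A piece `fork` leads down to a
written bit, where the path can only go on with the piece `sense` for that bit; a piece `pass` runs
straight through a zone; a piece `write` has a shape that depends on the bit to be written; a piece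
`turn` leads up to the next row. The direction is that in which the path arrives. -/
inductive Piece
  | fork (d : Dir)
  | sense (d : Dir) (b : Bool)
  | pass (d : Dir)
  | write (d : Dir) (b : Bool)
  | turn (d : Dir)

/-- A bar at `(x, y)` that is entered through its lower western port. -/
def wlo (x y : ℤ) : (ℤ × ℤ) × Edge := ((x, y), ((0, 0), .west))

/-- A bar at `(x, y)` that is entered through its upper western port. -/
def whi (x y : ℤ) : (ℤ × ℤ) × Edge := ((x, y), ((0, 2), .west))

/-- A bar at `(x, y)` that is entered through its lower eastern port. -/
def elo (x y : ℤ) : (ℤ × ℤ) × Edge := ((x, y), ((0, 0), .east))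

/-- A bar at `(x, y)` that is entered through its upper eastern port. -/
def ehi (x y : ℤ) : (ℤ × ℤ) × Edge := ((x, y), ((0, 3), .east))

namespace Piece

/-- The bars of a piece in the order of the path, each with the port through which it is entered. -/
def bars : Piece → List ((ℤ × ℤ) × Edge)
  | .fork .right =>
    [wlo 0 0, whi 1 (-2), ehi 0 (-5), whi 1 (-7), whi 2 (-9), ehi 1 (-12), whi 2 (-14),
      wlo 3 (-14), whi 4 (-16), whi 5 (-18)]
  | .fork .left =>
    [elo 12 0, ehi 11 (-3), ehi 10 (-6), ehi 9 (-9), ehi 8 (-12), ehi 7 (-15)]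
  | .sense .right false =>
    [wlo 6 (-15), wlo 7 (-12), wlo 8 (-9), wlo 9 (-6), wlo 10 (-3), wlo 11 0, wlo 12 0]
  | .sense .right true =>
    [whi 6 (-20), wlo 7 (-20), wlo 8 (-17), elo 7 (-15), ehi 6 (-16), elo 5 (-14), elo 4 (-12),
      elo 3 (-10), wlo 4 (-7), wlo 5 (-4), wlo 6 (-1), wlo 7 2, wlo 8 5, whi 9 6, whi 10 4,
      whi 11 2, whi 12 0]
  | .sense .left false =>
    [elo 6 (-13), elo 5 (-11), elo 4 (-9), elo 3 (-7), elo 2 (-5), wlo 3 (-2), elo 2 0, elo 1 0,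
      elo 0 0]
  | .sense .left true =>
    [ehi 6 (-18), ehi 5 (-19), elo 4 (-17), wlo 5 (-14), wlo 6 (-14), wlo 7 (-11), wlo 8 (-8),
      wlo 9 (-5), elo 8 (-3), elo 7 (-3), elo 6 (-1), elo 5 (-1), ehi 4 (-4), elo 3 (-4),
      elo 2 (-4), elo 1 (-2), elo 0 0]
  | .pass .right =>
    [wlo 0 0, wlo 1 0, wlo 2 0, wlo 3 0, wlo 4 0, wlo 5 0, wlo 6 0, wlo 7 0, wlo 8 0, wlo 9 0,
      wlo 10 0, wlo 11 0, wlo 12 0]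
  | .pass .left =>
    [elo 12 0, elo 11 0, elo 10 0, elo 9 0, elo 8 0, elo 7 0, elo 6 0, elo 5 0, elo 4 0, elo 3 0,
      elo 2 0, elo 1 0, elo 0 0]
  | .write .right false =>
    [wlo 0 0, wlo 1 3, wlo 2 6, whi 3 7, whi 4 8, whi 5 6, whi 6 4, whi 7 5, wlo 8 8, whi 9 6,
      whi 10 4, whi 11 2, whi 12 0]
  | .write .right true =>
    [wlo 0 0, wlo 1 3, elo 0 5, wlo 1 8, wlo 2 11, wlo 3 14, wlo 4 17, wlo 5 20, wlo 6 20,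
      whi 7 18, ehi 6 15, elo 5 15, ehi 4 12, ehi 3 9, ehi 2 6, whi 3 4, wlo 4 4, whi 5 2,
      whi 6 3, wlo 7 6, wlo 8 6, wlo 9 6, whi 10 4, whi 11 2, whi 12 0]
  | .write .left false =>
    [elo 12 0, ehi 11 (-1), elo 10 (-1), elo 9 (-1), elo 8 1, ehi 7 0, elo 6 2, ehi 5 (-1),
      elo 4 (-1), elo 3 (-1), elo 2 (-1), elo 1 1, ehi 0 0]
  | .write .left true =>
    [elo 12 0, elo 11 2, wlo 12 5, elo 11 7, wlo 12 10, elo 11 12, elo 10 12, elo 9 14, elo 8 16,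
      elo 7 18, elo 6 18, ehi 5 15, whi 6 13, whi 7 14, whi 8 12, whi 9 10, whi 10 8, ehi 9 5,
      ehi 8 4, ehi 7 1, ehi 6 0, ehi 5 (-1), elo 4 (-1), elo 3 (-1), elo 2 (-1), elo 1 1, ehi 0 0]
  | .turn .right =>
    [wlo 0 0, wlo 1 3, elo 0 5, wlo 1 8, elo 0 10, wlo 1 13, elo 0 15, wlo 1 18, elo 0 20,
      wlo 1 23, elo 0 25]
  | .turn .left =>
    [elo 12 0, elo 11 2, wlo 12 5, elo 11 7, wlo 12 10, elo 11 12, wlo 12 15, elo 11 17,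
      wlo 12 20, elo 11 22, wlo 12 25]

/-- The number of bars of a piece. -/
def len (g : Piece) : ℕ := g.bars.length

/-- The place of a bar of a piece. -/
def pos (g : Piece) (l : ℕ) : ℤ × ℤ := (g.bars.getD l (wlo 0 0)).1

/-- The port through which a bar of a piece is entered. -/
def entry (g : Piece) (l : ℕ) : Edge := (g.bars.getD l (wlo 0 0)).2

/-- The edge of a bar at `p` that coincides with the edge `e` of a bar at `q`. -/
def mate (p q : ℤ × ℤ) (e : Edge) : Edge := (e.1 + q + e.2.vec - p, e.2.opp)

/-- The displacement from the zone of a piece to that of the next piece of the path, where this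
does not begin with the zone of the given piece itself. -/
def shift : Piece → ℤ × ℤ
  | .turn .right => (-13, 25)
  | .turn .left => (13, 25)
  | .fork _ => (0, 0)
  | .sense .right _ | .pass .right | .write .right _ => (13, 0)
  | .sense .left _ | .pass .left | .write .left _ => (-13, 0)

/-- The opposite direction. -/
def flip : Dir → Dir
  | .right => .left
  | .left => .right

/-- The direction of the path when it has passed a piece. -/
def dirOut : Piece → Dir
  | .turn d => flip d
  | .fork d | .sense d _ | .pass d | .write d _ => d

/-- The place where the path enters a zone. -/
def start : Dir → ℤ × ℤ
  | .right => (0, 0)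
  | .left => (12, 0)

/-- The port through which the path enters a zone. -/
def startEntry : Dir → Edge
  | .right => ((0, 0), .west)
  | .left => ((0, 0), .east)

/-- The port through which the path leaves a piece that is not a fork. -/
def outPort (g : Piece) : Edge :=
  mate (g.pos (g.len - 1)) (start g.dirOut + g.shift) (startEntry g.dirOut)

/-- The port through which the path leaves a fork towards the piece for the bit `b`. -/
def forkExit (d : Dir) (b : Bool) : Edge :=
  mate ((fork d).pos ((fork d).len - 1)) ((sense d b).pos 0) ((sense d b).entry 0)

/-- The lowest height that a piece may use. -/
def low : Piece → ℤ
  | .fork _ | .sense _ _ => -21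
  | .write _ _ => -1
  | .pass _ | .turn _ => 0

/-- The greatest height that a piece may use. -/
def high : Piece → ℤ
  | .fork _ | .sense _ _ => 23
  | .write _ _ => 23
  | .pass _ => 3
  | .turn _ => 28

/-- Bars at `p` and `q` do not overlap. -/
def Apart (p q : ℤ × ℤ) : Prop := p.1 ≠ q.1 ∨ p.2 + 4 ≤ q.2 ∨ q.2 + 4 ≤ p.2

instance (p q : ℤ × ℤ) : Decidable (Apart p q) := by unfold Apart; infer_instance

theorem Apart.symm {p q : ℤ × ℤ} (h : Apart p q) : Apart q p := by
  unfold Apart at *; omega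

theorem apart_add_iff {p q v : ℤ × ℤ} : Apart (p + v) (q + v) ↔ Apart p q := by
  unfold Apart
  simp only [Prod.fst_add, Prod.snd_add]
  omega

/-! ### Finite checks on the pieces -/

theorem len_pos (g : Piece) : 0 < g.len := by
  rcases g with d | ⟨d, b⟩ | d | ⟨d, b⟩ | d <;> cases d <;> (try cases b) <;> decide

theorem entry_mem (g : Piece) : ∀ l < g.len, g.entry l ∈ ports := by
  rcases g with d | ⟨d, b⟩ | d | ⟨d, b⟩ | d <;> cases d <;> (try cases b) <;> decide +kernel

theorem mate_mem (g : Piece) : ∀ l < g.len - 1,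
    mate (g.pos l) (g.pos (l + 1)) (g.entry (l + 1)) ∈ ports ∧
      mate (g.pos l) (g.pos (l + 1)) (g.entry (l + 1)) ≠ g.entry l := by
  rcases g with d | ⟨d, b⟩ | d | ⟨d, b⟩ | d <;> cases d <;> (try cases b) <;> decide +kernel

theorem outPort_mem (g : Piece) : (∃ d, g = fork d) ∨
    g.outPort ∈ ports ∧ g.outPort ≠ g.entry (g.len - 1) := by
  rcases g with d | ⟨d, b⟩ | d | ⟨d, b⟩ | d
  · exact Or.inl ⟨d, rfl⟩
  all_goals right; cases d <;> (try cases b) <;> decide +kernel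

/-- The three ports involved are distinct, so the last bar of a fork can carry its entry glue and
both exit glues at once. -/
theorem forkExit_mem (d : Dir) (b : Bool) :
    forkExit d b ∈ ports ∧ forkExit d b ≠ (fork d).entry ((fork d).len - 1) ∧
      forkExit d b ≠ forkExit d !b := by
  cases d <;> cases b <;> decide +kernel

/-- Only a `sense` piece is exempt, since it begins in the middle of its zone, where its fork ends.
All other pieces can be joined without knowing which one comes next. -/
theorem pos_zero (g : Piece) : (∃ d b, g = sense d b) ∨
    ∃ d, (g = fork d ∨ g = pass d ∨ (∃ b, g = write d b) ∨ g = turn d) ∧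
      g.pos 0 = start d ∧ g.entry 0 = startEntry d := by
  rcases g with d | ⟨d, b⟩ | d | ⟨d, b⟩ | d
  · exact Or.inr ⟨d, by simp, by cases d <;> decide, by cases d <;> decide⟩
  · exact Or.inl ⟨d, b, rfl⟩
  · exact Or.inr ⟨d, by simp, by cases d <;> decide, by cases d <;> decide⟩
  · exact Or.inr ⟨d, by simp, by cases d <;> cases b <;> decide, by cases d <;> cases b <;> decide⟩
  · exact Or.inr ⟨d, by simp, by cases d <;> decide, by cases d <;> decide⟩

theorem pos_bounds (g : Piece) : ∀ l < g.len, 0 ≤ (g.pos l).1 ∧ (g.pos l).1 < 13 ∧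
    g.low ≤ (g.pos l).2 ∧ (g.pos l).2 + 3 ≤ g.high := by
  rcases g with d | ⟨d, b⟩ | d | ⟨d, b⟩ | d <;> cases d <;> (try cases b) <;> decide +kernel

theorem apart_self (g : Piece) : ∀ l < g.len, ∀ k < l, Apart (g.pos k) (g.pos l) := by
  rcases g with d | ⟨d, b⟩ | d | ⟨d, b⟩ | d <;> cases d <;> (try cases b) <;> decide +kernel

theorem apart_fork_sense (d : Dir) (b : Bool) : ∀ l < (fork d).len, ∀ k < (sense d b).len,
    Apart ((fork d).pos l) ((sense d b).pos k) := by
  cases d <;> cases b <;> decide +kernel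

/-- The next row is 25 higher and is traversed in the opposite direction, whence the translation and
`flip d`. The fork clears both outlines, as it must before the bit is known. -/
theorem apart_write_fork (d : Dir) (b : Bool) :
    ∀ l < (write d b).len, ∀ k < (fork (flip d)).len,
      Apart ((write d b).pos l) ((fork (flip d)).pos k + (0, 25)) := by
  cases d <;> cases b <;> decide +kernel

theorem apart_write_sense (d : Dir) (b : Bool) :
    ∀ l < (write d b).len, ∀ k < (sense (flip d) b).len,
      Apart ((write d b).pos l) ((sense (flip d) b).pos k + (0, 25)) := by
  cases d <;> cases b <;> decide +kernel

/-- A written bit blocks the entry to the piece for the other bit. -/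
theorem exists_not_apart_write_sense (d : Dir) (b : Bool) : ∃ l < (write d b).len,
    ¬ Apart ((write d b).pos l) ((sense (flip d) !b).pos 0 + (0, 25)) := by
  cases d <;> cases b <;> decide +kernel

end Piece

end Pieces

end PolyTAM

namespace PolyTAM

section Automata

open Turing (Dir)

/-! ### Zigzag automata -/

/-- What a zigzag automaton does in a cell of the current row: it reads the symbol below the cell
and, unless it halts, writes a symbol and goes on to the next cell; or it writes a symbol without
reading; or it turns around and begins a new row. -/
inductive Op (S Y : Type)
  | readWrite (f : Y → Option (Y × S))
  | write (y : Y) (s : S)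
  | turn (s : S)

/-- An automaton that sweeps alternately to the right and to the left, each time reading the row
that it wrote in the sweep before. Its symbols are encoded by words of a fixed length. States with
the same `link` can be entered from the same states; `first` cannot be entered at all. -/
structure Zigzag (S Y : Type) where
  dir : S → Dir
  op : S → Op S Y
  link : S → S
  first : S
  code : Y → List Bool
  size : ℕ
  size_pos : 0 < size
  length_code : ∀ y, (code y).length = size
  code_injective : Function.Injective code
  dir_link : ∀ s, dir (link s) = dir s
  link_first : ∀ s, link s = link first → s = first

/-- The segments of the path of a zigzag automaton. -/
inductive Seg (S Y : Type)
  | fork (s : S) (p : List Bool)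
  | sense (s : S) (p : List Bool) (b : Bool)
  | pass (s : S) (n : ℕ)
  | write (d : Dir) (y : Y) (s : S) (p : List Bool)
  | turn (s : S)

namespace Zigzag

variable {S Y : Type} (Z : Zigzag S Y)

/-- The code of a symbol in the order in which its bits are met. -/
def bits : Dir → Y → List Bool
  | .right, y => Z.code y
  | .left, y => (Z.code y).reverse

theorem length_bits (d : Dir) (y : Y) : (Z.bits d y).length = Z.size := by
  cases d <;> simp [bits, Z.length_code]

theorem bits_injective (d : Dir) : Function.Injective (Z.bits d) := by
  intro y y' h
  cases d
  · exact Z.code_injective (List.reverse_injective h)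
  · exact Z.code_injective h

/-- The symbol with the given code. -/
noncomputable def decode (d : Dir) : List Bool → Option Y := Function.partialInv (Z.bits d)

theorem decode_bits (d : Dir) (y : Y) : Z.decode d (Z.bits d y) = some y :=
  Function.partialInv_left (Z.bits_injective d) y

/-- The shape of a segment. -/
def piece : Seg S Y → Piece
  | .fork s _ => .fork (Z.dir s)
  | .sense s _ b => .sense (Z.dir s) b
  | .pass s _ => .pass (Z.dir s)
  | .write d _ _ p => .write d (p.headD false)
  | .turn s => .turn (Z.dir s)

/-- The label of the glue by which a segment is entered. -/
def label : Seg S Y → Seg S Y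
  | .pass s 0 => .pass (Z.link s) 0
  | σ => σ

theorem piece_label (σ : Seg S Y) : Z.piece (Z.label σ) = Z.piece σ := by
  rcases σ with _ | _ | ⟨s, _ | n⟩ | _ | _ <;> simp [label, piece, Z.dir_link]

theorem piece_eq_of_label_eq {σ τ : Seg S Y} (h : Z.label σ = Z.label τ) :
    Z.piece σ = Z.piece τ := by
  rw [← Z.piece_label σ, h, Z.piece_label]

/-- The segment with which the automaton begins its work in a cell. -/
def enter (s : S) : Seg S Y :=
  match Z.op s with
  | .readWrite _ => .fork s []
  | .write _ _ => .pass s 0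
  | .turn _ => .turn s

open scoped Classical in
/-- The segment that follows a given one, which is not a fork. -/
noncomputable def next : Seg S Y → Option (Seg S Y)
  | .fork _ _ => none
  | .sense s p b =>
    if p.length + 1 < Z.size then some (.fork s (p ++ [b]))
    else
      match Z.op s with
      | .readWrite f => ((Z.decode (Z.dir s) (p ++ [b])).bind f).map fun r =>
          .write (Z.dir s) r.1 r.2 (Z.bits (Z.dir s) r.1)
      | _ => none
  | .pass s n =>
    if n + 1 < Z.size then some (.pass s (n + 1))
    else
      match Z.op s with
      | .write y s' => some (.write (Z.dir s) y s' (Z.bits (Z.dir s) y))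
      | _ => none
  | .write d y s p =>
    if p.tail = [] then
      -- The guard makes `isStandard_next` and `label_next_ne` hold for every automaton; for a valid
      -- tableau it is always satisfied.
      if Z.dir s = d ∧ s ≠ Z.first then some (Z.enter s) else none
    else some (.write d y s p.tail)
  | .turn s =>
    match Z.op s with
    | .turn s' => if Z.dir s' = Piece.flip (Z.dir s) ∧ s' ≠ Z.first then some (Z.enter s') else none
    | _ => none

/-- A piece that is entered at the standard place of its zone from the given direction. -/
def _root_.PolyTAM.Piece.IsStandard (g : Piece) (d : Dir) : Prop :=
  g.pos 0 = Piece.start d ∧ g.entry 0 = Piece.startEntry d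

theorem isStandard_piece (σ : Seg S Y) : (∃ s p b, σ = .sense s p b) ∨
    (Z.piece σ).IsStandard (match σ with
      | .fork s _ | .sense s _ _ | .pass s _ | .turn s => Z.dir s
      | .write d _ _ _ => d) := by
  have key := Piece.pos_zero (Z.piece σ)
  rcases σ with ⟨s, p⟩ | ⟨s, p, b⟩ | ⟨s, n⟩ | ⟨d, y, s, p⟩ | s
  case sense => exact Or.inl ⟨s, p, b, rfl⟩
  all_goals
    right
    rcases key with ⟨d', b', h⟩ | ⟨d', h, h1, h2⟩
    · simp [piece] at h
    · simp only [piece, Piece.fork.injEq, Piece.pass.injEq, Piece.write.injEq, Piece.turn.injEq,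
        reduceCtorEq, or_false, false_or, exists_false, exists_and_left] at h
      first
        | (subst h; exact ⟨h1, h2⟩)
        | (obtain ⟨rfl, -⟩ := h; exact ⟨h1, h2⟩)

theorem isStandard_enter (s : S) : (Z.piece (Z.enter s)).IsStandard (Z.dir s) := by
  unfold enter
  cases h : Z.op s
  · exact (Z.isStandard_piece (.fork s [])).resolve_left (by simp)
  · exact (Z.isStandard_piece (.pass s 0)).resolve_left (by simp)
  · exact (Z.isStandard_piece (.turn s)).resolve_left (by simp)

/-- The exit port of a segment can be fixed without knowing its successor, because successors
produced by `next` are never `sense` segments and so begin at the standard place of their zone. -/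
theorem isStandard_next {σ τ : Seg S Y} (h : Z.next σ = some τ) :
    (Z.piece τ).IsStandard (Z.piece σ).dirOut := by
  rcases σ with ⟨s, p⟩ | ⟨s, p, b⟩ | ⟨s, n⟩ | ⟨d, y, s, p⟩ | s
  · simp [next] at h
  · simp only [next] at h
    split_ifs at h
    · obtain rfl := Option.some.inj h
      exact (Z.isStandard_piece (.fork s _)).resolve_left (by simp)
    · split at h
      · obtain ⟨r, -, rfl⟩ := Option.map_eq_some_iff.1 h
        exact (Z.isStandard_piece (.write _ _ _ _)).resolve_left (by simp)
      · simp at h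
  · simp only [next] at h
    split_ifs at h
    · obtain rfl := Option.some.inj h
      exact (Z.isStandard_piece (.pass s _)).resolve_left (by simp)
    · split at h
      · obtain rfl := Option.some.inj h
        exact (Z.isStandard_piece (.write _ _ _ _)).resolve_left (by simp)
      · simp at h
  · simp only [next] at h
    split_ifs at h with h1 h2
    · obtain rfl := Option.some.inj h
      rw [show (Z.piece (.write d y s p)).dirOut = Z.dir s from h2.1.symm]
      exact Z.isStandard_enter s
    · obtain rfl := Option.some.inj h
      exact (Z.isStandard_piece (.write _ _ _ _)).resolve_left (by simp)
  · simp only [next] at h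
    split at h
    · split_ifs at h with h1
      obtain rfl := Option.some.inj h
      rw [show (Z.piece (.turn s)).dirOut = Z.dir _ from h1.1.symm]
      exact Z.isStandard_enter _
    · simp at h

/-- Nothing leads into the first segment: `next` never enters `Z.first`, and by `link_first` no
other state shares its link. This prevents growth backwards from the start of the path. -/
theorem label_next_ne {σ τ : Seg S Y} (h : Z.next σ = some τ) :
    Z.label τ ≠ Z.label (.pass Z.first 0) := by
  have henter : ∀ s, s ≠ Z.first → Z.label (Z.enter s) ≠ Z.label (.pass Z.first 0) := by
    intro s hs
    unfold enter
    cases h : Z.op s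
    · simp [label]
    · simp only [label, ne_eq, Seg.pass.injEq, and_true]
      exact fun h => hs (Z.link_first s h)
    · simp [label]
  rcases σ with ⟨s, p⟩ | ⟨s, p, b⟩ | ⟨s, n⟩ | ⟨d, y, s, p⟩ | s
  · simp [next] at h
  · simp only [next] at h
    split_ifs at h
    · obtain rfl := Option.some.inj h
      simp [label]
    · split at h
      · obtain ⟨r, -, rfl⟩ := Option.map_eq_some_iff.1 h
        simp [label]
      · simp at h
  · simp only [next] at h
    split_ifs at h
    · obtain rfl := Option.some.inj h
      simp [label]
    · split at h
      · obtain rfl := Option.some.inj h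
        simp [label]
      · simp at h
  · simp only [next] at h
    split_ifs at h with h1 h2
    · obtain rfl := Option.some.inj h
      exact henter s h2.2
    · obtain rfl := Option.some.inj h
      simp [label]
  · simp only [next] at h
    split at h
    · split_ifs at h with h1
      obtain rfl := Option.some.inj h
      exact henter _ h1.2
    · simp at h

/-! ### The tiles of a zigzag automaton -/

/-- The glue by which a tile is attached to its predecessor on the path. -/
def glueIn (σ : Seg S Y) (l : ℕ) : Seg S Y × ℕ :=
  if l = 0 then (Z.label σ, 0) else (σ, l)

/-- The glues by which the successors of a tile on the path are attached to it. -/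
noncomputable def glueOut (σ : Seg S Y) (l : ℕ) (e : Edge) : Option (Seg S Y × ℕ) :=
  if l + 1 < (Z.piece σ).len then
    if e = Piece.mate ((Z.piece σ).pos l) ((Z.piece σ).pos (l + 1)) ((Z.piece σ).entry (l + 1)) then
      some (σ, l + 1)
    else none
  else
    match σ with
    | .fork s p =>
      if e = Piece.forkExit (Z.dir s) false then some (.sense s p false, 0)
      else if e = Piece.forkExit (Z.dir s) true then some (.sense s p true, 0)
      else none
    | σ => if e = (Z.piece σ).outPort then (Z.next σ).map fun τ => (Z.label τ, 0) else none

theorem _root_.PolyTAM.isPolyomino_bar : IsPolyomino bar := by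
  refine ⟨⟨(0, 0), by decide⟩, ?_⟩
  have up : ∀ n : ℕ, n ≤ 3 → Relation.ReflTransGen
      (fun x y => y ∈ bar ∧ ∃ s : Side, y = x + s.vec) ((0, 0) : ℤ × ℤ) (0, (n : ℤ)) := by
    intro n
    induction n with
    | zero => intro _; exact .refl
    | succ n ih =>
      intro h
      refine (ih (by omega)).tail ⟨?_, .north, ?_⟩
      · have hn : n < 3 := by omega
        interval_cases n <;> decide
      · simp [Side.vec]
  have down : ∀ n : ℕ, n ≤ 3 → Relation.ReflTransGen
      (fun x y => y ∈ bar ∧ ∃ s : Side, y = x + s.vec) ((0, (n : ℤ)) : ℤ × ℤ) (0, 0) := by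
    intro n
    induction n with
    | zero => intro _; exact .refl
    | succ n ih =>
      intro h
      refine (ih (by omega)).head ⟨?_, .south, ?_⟩
      · have hn : n < 3 := by omega
        interval_cases n <;> decide
      · simp [Side.vec]
  have mem : ∀ a ∈ bar, ∃ n : ℕ, n ≤ 3 ∧ a = (0, (n : ℤ)) := by
    intro a ha
    simp only [bar, Finset.mem_insert, Finset.mem_singleton] at ha
    rcases ha with rfl | rfl | rfl | rfl
    exacts [⟨0, by simp⟩, ⟨1, by simp⟩, ⟨2, by simp⟩, ⟨3, by simp⟩]
  intro a ha b hb
  obtain ⟨m, hm, rfl⟩ := mem a ha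
  obtain ⟨n, hn, rfl⟩ := mem b hb
  exact (down m hm).trans (up n hn)

/-- The tile that stands at place `l` in segments `σ`. -/
noncomputable def tile (σ : Seg S Y) (l : ℕ) : PolyTile (Seg S Y × ℕ) where
  shape := bar
  isPolyomino := isPolyomino_bar
  glue e :=
    if e ∈ ports then
      if e = (Z.piece σ).entry l then some (Z.glueIn σ l) else Z.glueOut σ l e
    else none
  glue_edge e h := by
    by_cases he : e ∈ ports
    · exact ports_subset he
    · simp [he] at h

/-! ### Orientation of bonds -/

/-- The side on which a glue serves to attach a tile to its predecessor. -/
def inSide (g : Seg S Y × ℕ) : Side := ((Z.piece g.1).entry g.2).2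

theorem inSide_glueIn (σ : Seg S Y) (l : ℕ) :
    Z.inSide (Z.glueIn σ l) = ((Z.piece σ).entry l).2 := by
  unfold inSide glueIn
  split
  · subst l; simp [Z.piece_label]
  · rfl

theorem glueOut_cases {σ : Seg S Y} {l : ℕ} {e : Edge} {g : Seg S Y × ℕ}
    (h : Z.glueOut σ l e = some g) :
    (l + 1 < (Z.piece σ).len ∧ g = (σ, l + 1) ∧ e = Piece.mate ((Z.piece σ).pos l)
      ((Z.piece σ).pos (l + 1)) ((Z.piece σ).entry (l + 1))) ∨
    (¬ l + 1 < (Z.piece σ).len ∧ ∃ s p b, σ = .fork s p ∧ g = (.sense s p b, 0) ∧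
      e = Piece.forkExit (Z.dir s) b) ∨
    (¬ l + 1 < (Z.piece σ).len ∧ ∃ τ, Z.next σ = some τ ∧ g = (Z.label τ, 0) ∧
      e = (Z.piece σ).outPort) := by
  unfold glueOut at h
  split_ifs at h with h1 h2
  · exact Or.inl ⟨h1, (Option.some.inj h).symm, h2⟩
  · right
    split at h
    · left
      split_ifs at h with h2 h3
      · exact ⟨h1, _, _, false, rfl, (Option.some.inj h).symm, h2⟩
      · exact ⟨h1, _, _, true, rfl, (Option.some.inj h).symm, h3⟩
    · right
      split_ifs at h with h2
      obtain ⟨τ, h3, h4⟩ := Option.map_eq_some_iff.1 h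
      exact ⟨h1, τ, h3, h4.symm, h2⟩

/-- The side on which a glue is offered to a successor depends on the glue alone and is opposite to
the side of entry. Hence a glue on a given side shows whether it is incoming or outgoing. -/
theorem glueOut_side {σ : Seg S Y} {l : ℕ} {e : Edge} {g : Seg S Y × ℕ}
    (h : Z.glueOut σ l e = some g) : e.2 = (Z.inSide g).opp := by
  rcases Z.glueOut_cases h with ⟨-, rfl, rfl⟩ | ⟨-, s, p, b, rfl, rfl, rfl⟩ | ⟨-, τ, h1, rfl, rfl⟩
  · rfl
  · rfl
  · have := (Z.isStandard_next h1).2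
    simp only [inSide, Piece.outPort, Piece.mate, Z.piece_label, this]

/-- Without regard to other tiles, the tile `τ`, `m` at `w` can be attached as a successor to the
tile `σ`, `l` at `v`. -/
def Out (σ : Seg S Y) (l : ℕ) (v : ℤ × ℤ) (τ : Seg S Y) (m : ℕ) (w : ℤ × ℤ) : Prop :=
  Z.glueOut σ l (Piece.mate v w ((Z.piece τ).entry m)) = some (Z.glueIn τ m)

theorem tile_glue_cases {σ : Seg S Y} {l : ℕ} {e : Edge} {g : Seg S Y × ℕ}
    (h : (Z.tile σ l).glue e = some g) :
    (e = (Z.piece σ).entry l ∧ g = Z.glueIn σ l) ∨ Z.glueOut σ l e = some g := by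
  simp only [tile] at h
  split_ifs at h with h1 h2
  · exact Or.inl ⟨h2, (Option.some.inj h).symm⟩
  · exact Or.inr h

/-- The edges of a bond lie on opposite sides and carry the same glue. Two incoming glues would lie
on the same side, and so would two outgoing ones, so one of the tiles is the predecessor of the
other. The membership in `bar` records that, in the second case, the new tile covers the square in
front of the entry of the old one. -/
theorem bond_cases {σ τ : Seg S Y} {l m : ℕ} {v w : ℤ × ℤ}
    (h : Bond (Z.tile σ l, v) (Z.tile τ m, w)) :
    Z.Out σ l v τ m w ∨ Z.Out τ m w σ l v ∧ (Piece.mate w v ((Z.piece σ).entry l)).1 ∈ bar := by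
  obtain ⟨e, g, h1, h2⟩ := h
  have hbar : e.1 ∈ bar := by
    have := (Z.tile τ m).glue_edge e (by rw [h1]; simp)
    simp only [edges, Finset.mem_filter, Finset.mem_product] at this
    exact this.1.1
  have h2' : (Z.tile σ l).glue (Piece.mate v w e) = some g := h2
  rcases Z.tile_glue_cases h1 with ⟨rfl, rfl⟩ | h1
  · rcases Z.tile_glue_cases h2' with ⟨h3, h4⟩ | h3
    · exfalso
      have h5 := Z.inSide_glueIn σ l
      rw [← h4, Z.inSide_glueIn, ← h3] at h5
      exact Side.opp_ne _ h5.symm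
    · exact Or.inl h3
  · right
    rcases Z.tile_glue_cases h2' with ⟨h3, rfl⟩ | h3
    · have : Piece.mate w v ((Z.piece σ).entry l) = e := by
        rw [← h3]
        refine Prod.ext ?_ (Side.opp_opp _)
        simp [Piece.mate, Side.vec_opp]
      unfold Out
      rw [this]
      exact ⟨h1, hbar⟩
    · exfalso
      have h4 := Z.glueOut_side h1
      have h5 := Z.glueOut_side h3
      rw [← h4] at h5
      exact Side.opp_ne _ h5

theorem mate_injective {v w w' : ℤ × ℤ} {e : Edge} (h : Piece.mate v w e = Piece.mate v w' e) :
    w = w' := by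
  have := congrArg Prod.fst h
  simpa [Piece.mate] using this

theorem mate_add (v w u : ℤ × ℤ) (e : Edge) :
    Piece.mate (v + u) (w + u) e = Piece.mate v w e := by
  refine Prod.ext ?_ rfl
  simp only [Piece.mate]
  abel

theorem eq_add_of_mate_eq {v w w' u : ℤ × ℤ} {e : Edge}
    (h : Piece.mate (v + u) w e = Piece.mate v w' e) : w = w' + u := by
  rw [← mate_add v w' u] at h
  exact mate_injective h

theorem label_eq_sense {σ : Seg S Y} {s : S} {p : List Bool} {b : Bool}
    (h : Z.label σ = .sense s p b) : σ = .sense s p b := by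
  rcases σ with _ | _ | ⟨s, _ | n⟩ | _ | _ <;> simp_all [label]

/-! ### The possible successors of a tile -/

/-- The tile for `l` at `v` is bonded to the tile for `m` at `w`, its successor. -/
def Link (σ : Seg S Y) (l : ℕ) (v : ℤ × ℤ) (τ : Seg S Y) (m : ℕ) (w : ℤ × ℤ) : Prop :=
  (Z.piece τ).entry m ∈ ports ∧
    (Z.tile σ l).glue (Piece.mate v w ((Z.piece τ).entry m)) = some (Z.glueIn τ m)

variable {Z}

theorem Link.bond {σ τ : Seg S Y} {l m : ℕ} {v w : ℤ × ℤ} (h : Z.Link σ l v τ m w) :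
    Bond (Z.tile σ l, v) (Z.tile τ m, w) := by
  refine ⟨(Z.piece τ).entry m, Z.glueIn τ m, ?_, h.2⟩
  simp [tile, h.1]

theorem Link.mate_mem_bar {σ τ : Seg S Y} {l m : ℕ} {v w : ℤ × ℤ} (h : Z.Link σ l v τ m w) :
    (Piece.mate v w ((Z.piece τ).entry m)).1 ∈ bar := by
  have := (Z.tile σ l).glue_edge _ (by rw [h.2]; simp)
  simp only [edges, Finset.mem_filter, Finset.mem_product] at this
  exact this.1.1

variable (Z)

/-- A tile carries `glueOut` only on ports, and on its entry port the incoming glue takes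
precedence; the last two hypotheses rule out both losses. -/
theorem link_of_glueOut {σ τ : Seg S Y} {l m : ℕ} {v w : ℤ × ℤ} (hm : m < (Z.piece τ).len)
    (h : Z.Out σ l v τ m w) (h1 : Piece.mate v w ((Z.piece τ).entry m) ∈ ports)
    (h2 : Piece.mate v w ((Z.piece τ).entry m) ≠ (Z.piece σ).entry l) : Z.Link σ l v τ m w := by
  refine ⟨Piece.entry_mem _ _ hm, ?_⟩
  simp only [tile, if_pos h1, if_neg h2]
  exact h

theorem link_succ {σ : Seg S Y} {l : ℕ} (hl : l + 1 < (Z.piece σ).len) (u : ℤ × ℤ) :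
    Z.Link σ l ((Z.piece σ).pos l + u) σ (l + 1) ((Z.piece σ).pos (l + 1) + u) := by
  have h := Piece.mate_mem (Z.piece σ) l (by omega)
  refine Z.link_of_glueOut hl ?_ ?_ ?_ <;> try rw [mate_add]
  · unfold Out
    rw [mate_add]
    simp [glueOut, hl, glueIn]
  · exact h.1
  · exact h.2

/-- Inside a segment the glue names both the segment and the number of the bar, and the port then
fixes the position. -/
theorem eq_of_out_succ {σ τ : Seg S Y} {l m : ℕ} {u w : ℤ × ℤ} (hl : l + 1 < (Z.piece σ).len)
    (h : Z.Out σ l ((Z.piece σ).pos l + u) τ m w) :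
    τ = σ ∧ m = l + 1 ∧ w = (Z.piece σ).pos (l + 1) + u := by
  rcases Z.glueOut_cases h with ⟨-, h1, h2⟩ | ⟨h1, -⟩ | ⟨h1, -⟩
  · unfold glueIn at h1
    split_ifs at h1
    · simp at h1
    · obtain ⟨rfl, rfl⟩ := Prod.mk.inj h1
      exact ⟨rfl, rfl, eq_add_of_mate_eq h2⟩
  · exact absurd hl h1
  · exact absurd hl h1

/-- Only the label of the successor enters the glue. A seed block can thus be followed by a block
for any content, although its last tile does not depend on that content. -/
theorem link_next {σ τ τ' : Seg S Y} (h : Z.next σ = some τ) (hτ : Z.label τ' = Z.label τ)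
    (u : ℤ × ℤ) : Z.Link σ ((Z.piece σ).len - 1) ((Z.piece σ).pos ((Z.piece σ).len - 1) + u)
      τ' 0 ((Z.piece τ').pos 0 + (u + (Z.piece σ).shift)) := by
  obtain ⟨hp, he⟩ := Z.isStandard_next h
  rw [← Z.piece_eq_of_label_eq hτ] at hp he
  have hlen := Piece.len_pos (Z.piece σ)
  have hfork : ∀ s p, σ ≠ .fork s p := by
    rintro s p rfl
    simp [next] at h
  have hmate : Piece.mate ((Z.piece σ).pos ((Z.piece σ).len - 1) + u)
      ((Z.piece τ').pos 0 + (u + (Z.piece σ).shift)) ((Z.piece τ').entry 0) =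
      (Z.piece σ).outPort := by
    rw [add_comm u, ← add_assoc, mate_add, hp, he]
    rfl
  have hport : (Z.piece σ).outPort ∈ ports ∧
      (Z.piece σ).outPort ≠ (Z.piece σ).entry ((Z.piece σ).len - 1) := by
    refine (Piece.outPort_mem (Z.piece σ)).resolve_left ?_
    rintro ⟨d, hd⟩
    cases σ <;> simp [piece] at hd
    exact hfork _ _ rfl
  refine Z.link_of_glueOut (Piece.len_pos _) ?_ ?_ ?_
  · unfold Out
    rw [hmate]
    have : ¬ (Z.piece σ).len - 1 + 1 < (Z.piece σ).len := by omega
    cases σ with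
    | fork s p => exact absurd rfl (hfork s p)
    | _ => simp [glueOut, this, h, glueIn, hτ]
  · rw [hmate]; exact hport.1
  · rw [hmate]; exact hport.2

/-- The position is determined completely, the segment only up to its label: labels determine the
piece, hence the geometry. -/
theorem eq_of_out_next {σ τ τ' : Seg S Y} {m : ℕ} {u w : ℤ × ℤ} (h : Z.next σ = some τ)
    (ho : Z.Out σ ((Z.piece σ).len - 1) ((Z.piece σ).pos ((Z.piece σ).len - 1) + u) τ' m w) :
    Z.label τ' = Z.label τ ∧ m = 0 ∧ w = (Z.piece τ').pos 0 + (u + (Z.piece σ).shift) := by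
  have hlen := Piece.len_pos (Z.piece σ)
  rcases Z.glueOut_cases ho with ⟨h1, -⟩ | ⟨-, s, p, b, rfl, -⟩ | ⟨-, τ₁, h1, h2, h3⟩
  · omega
  · simp [next] at h
  · rw [h] at h1
    obtain rfl := Option.some.inj h1
    have hm : m = 0 := by
      by_contra hm
      simp [glueIn, hm] at h2
    subst hm
    have h4 : Z.label τ' = Z.label τ := by simpa [glueIn] using h2
    refine ⟨h4, rfl, ?_⟩
    obtain ⟨hp, he⟩ := Z.isStandard_next h
    rw [← Z.piece_eq_of_label_eq h4] at hp he
    rw [hp]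
    rw [he, Piece.outPort] at h3
    rw [eq_add_of_mate_eq h3]
    abel

theorem link_sense (s : S) (p : List Bool) (b : Bool) (u : ℤ × ℤ) :
    Z.Link (.fork s p) ((Piece.fork (Z.dir s)).len - 1)
      ((Piece.fork (Z.dir s)).pos ((Piece.fork (Z.dir s)).len - 1) + u)
      (.sense s p b) 0 ((Piece.sense (Z.dir s) b).pos 0 + u) := by
  have hlen := Piece.len_pos (Piece.fork (Z.dir s))
  have h := Piece.forkExit_mem (Z.dir s) b
  have hmate : Piece.mate ((Piece.fork (Z.dir s)).pos ((Piece.fork (Z.dir s)).len - 1) + u)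
      ((Piece.sense (Z.dir s) b).pos 0 + u) ((Z.piece (Seg.sense (Y := Y) s p b)).entry 0) =
      Piece.forkExit (Z.dir s) b := by
    rw [mate_add]; rfl
  refine Z.link_of_glueOut (Piece.len_pos _) ?_ ?_ ?_
  · unfold Out
    rw [hmate]
    have : ¬ (Piece.fork (Z.dir s)).len - 1 + 1 < (Piece.fork (Z.dir s)).len := by omega
    cases b
    · simp [glueOut, piece, this, glueIn, label]
    · have := h.2.2
      simp only [Bool.not_true] at this
      simp [glueOut, piece, *, glueIn, label]
  · rw [hmate]; exact h.1
  · rw [hmate]; exact h.2.1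

theorem eq_of_out_fork {s : S} {p : List Bool} {τ : Seg S Y} {m : ℕ} {u w : ℤ × ℤ}
    (ho : Z.Out (.fork s p) ((Piece.fork (Z.dir s)).len - 1)
      ((Piece.fork (Z.dir s)).pos ((Piece.fork (Z.dir s)).len - 1) + u) τ m w) :
    m = 0 ∧ ∃ b, τ = .sense s p b ∧ w = (Piece.sense (Z.dir s) b).pos 0 + u := by
  have hlen := Piece.len_pos (Piece.fork (Z.dir s))
  rcases Z.glueOut_cases ho with ⟨h1, -⟩ | ⟨-, s', p', b, h1, h2, h3⟩ | ⟨-, τ₁, h1, h2, h3⟩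
  · simp only [piece] at h1
    omega
  · obtain ⟨rfl, rfl⟩ := Seg.fork.inj h1
    have hm : m = 0 := by
      by_contra hm
      simp [glueIn, hm] at h2
    subst hm
    have h4 : Z.label τ = .sense s p b := by simpa [glueIn] using h2
    obtain rfl := Z.label_eq_sense h4
    refine ⟨rfl, b, rfl, ?_⟩
    exact eq_add_of_mate_eq h3
  · simp [next] at h1

/-- Nothing can be attached in place of the predecessor of the first tile of the path. -/
theorem not_out_first {σ : Seg S Y} {l : ℕ} {v w : ℤ × ℤ} :
    ¬ Z.Out σ l v (.pass Z.first 0) 0 w := by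
  intro h
  rcases Z.glueOut_cases h with ⟨-, h1, -⟩ | ⟨-, s', p', b, h1, h2, h3⟩ | ⟨-, τ, h1, h2, h3⟩
  · simp [glueIn] at h1
  · simp [glueIn, label] at h2
  · simp only [glueIn, if_true] at h2
    exact Z.label_next_ne h1 (Prod.ext_iff.1 h2).1.symm

theorem not_out_of_next_eq_none {σ τ : Seg S Y} {l m : ℕ} {v w : ℤ × ℤ}
    (hl : ¬ l + 1 < (Z.piece σ).len) (h : Z.next σ = none) (hσ : ∀ s p, σ ≠ .fork s p) :
    ¬ Z.Out σ l v τ m w := by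
  intro ho
  rcases Z.glueOut_cases ho with ⟨h1, -⟩ | ⟨-, s', p', b, rfl, -⟩ | ⟨-, τ, h1, -⟩
  · exact hl h1
  · exact hσ _ _ rfl
  · rw [h] at h1; cases h1

theorem disjoint_cells_iff {σ τ : Seg S Y} {l m : ℕ} {v w : ℤ × ℤ} :
    Disjoint (Placement.cells (Z.tile σ l, v)) (Placement.cells (Z.tile τ m, w)) ↔
      Piece.Apart v w := by
  have mem : ∀ (σ : Seg S Y) (l : ℕ) (v z : ℤ × ℤ), z ∈ Placement.cells (Z.tile σ l, v) ↔
      z.1 = v.1 ∧ v.2 ≤ z.2 ∧ z.2 ≤ v.2 + 3 := by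
    intro σ l v z
    simp only [Placement.cells, tile, Set.mem_ofPred_eq, bar, Finset.mem_insert,
      Finset.mem_singleton, Prod.ext_iff, Prod.fst_sub, Prod.snd_sub]
    omega
  rw [Set.disjoint_left]
  simp only [mem, Piece.Apart]
  constructor
  · intro h
    by_contra hcon
    rcases le_total v.2 w.2 with hle | hle
    · exact @h (v.1, w.2) (by simp; omega) (by simp; omega)
    · exact @h (v.1, v.2) (by simp) (by simp; omega)
  · intro h z
    omega

end Zigzag

end Automata

end PolyTAM

namespace PolyTAM

section Routes

open Turing (Dir)

/-! ### Routes: paths as lists of placed segments -/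

/-- A segment together with the row and the zone of the plane in which it is placed. -/
abbrev Spot (S Y : Type) := Seg S Y × ℕ × ℤ

/-- The corner of the zone of a placed segment. -/
def Spot.origin {S Y : Type} (x : Spot S Y) : ℤ × ℤ := (13 * x.2.2, 25 * (x.2.1 : ℤ))

namespace Zigzag

variable {S Y : Type} (Z : Zigzag S Y)

/-- The bars of a placed segment, numbered. -/
def barsOf (x : Spot S Y) : List (Spot S Y × ℕ) := (List.range (Z.piece x.1).len).map (x, ·)

/-- The place of a bar of a placed segment. -/
def place (a : Spot S Y × ℕ) : ℤ × ℤ := (Z.piece a.1.1).pos a.2 + a.1.origin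

/-- A bar of a placed segment as a placed tile. -/
noncomputable def placed (a : Spot S Y × ℕ) : Placement (Seg S Y × ℕ) :=
  (Z.tile a.1.1 a.2, Z.place a)

theorem mem_barsOf {x : Spot S Y} {a : Spot S Y × ℕ} :
    a ∈ Z.barsOf x ↔ a.1 = x ∧ a.2 < (Z.piece x.1).len := by
  obtain ⟨y, l⟩ := a
  simp only [barsOf, List.mem_map, List.mem_range, Prod.mk.injEq]
  constructor
  · rintro ⟨k, h, rfl, rfl⟩; exact ⟨rfl, h⟩
  · rintro ⟨rfl, h⟩; exact ⟨l, h, rfl, rfl⟩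

/-- The placed segment `x'` follows `x` on a path. At a fork, the bit that is read is found in the
row below, in a segment that satisfies `W`. Outside row `0`, the successor is determined by its
label. -/
def Follows (W : Spot S Y → Prop) (x x' : Spot S Y) : Prop :=
  (∃ s p b, x.1 = .fork s p ∧ x'.1 = .sense s p b ∧ x'.2 = x.2 ∧
    ∃ y, W y ∧ Z.piece y.1 = .write (Piece.flip (Z.dir s)) b ∧ y.2.1 + 1 = x.2.1 ∧
      y.2.2 = x.2.2) ∨
  ∃ τ, Z.next x.1 = some τ ∧ Z.label x'.1 = Z.label τ ∧
    (0 < x'.2.1 → x'.1 = τ ∧ ∀ τ', Z.label τ' = Z.label τ → τ' = τ) ∧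
    x'.origin = x.origin + (Z.piece x.1).shift

theorem Follows.row_le {W : Spot S Y → Prop} {x x' : Spot S Y} (h : Z.Follows W x x') :
    x.2.1 ≤ x'.2.1 := by
  rcases h with ⟨s, p, b, -, -, h, -⟩ | ⟨τ, -, -, -, h⟩
  · rw [h]
  · have h2 := congrArg Prod.snd h
    simp only [Spot.origin, Prod.snd_add] at h2
    have : 0 ≤ ((Z.piece x.1).shift).2 := by
      rcases Z.piece x.1 with d | ⟨d, b⟩ | d | ⟨d, b⟩ | d <;> cases d <;> simp [Piece.shift]
    omega

/-- No bar of the placed segment `x` overlaps one of `y`. -/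
def SegApart (x y : Spot S Y) : Prop :=
  ∀ l < (Z.piece x.1).len, ∀ k < (Z.piece y.1).len, Piece.Apart (Z.place (x, l)) (Z.place (y, k))

/-- The lists `X 0`, `X 1`, … are initial segments of the path of the automaton. -/
structure IsRoute (X : ℕ → List (Spot S Y)) : Prop where
  mono : ∀ n, X n <+: X (n + 1)
  head : ∃ x t, X 0 = x :: t ∧ x.1 = .pass Z.first 0
  chain : ∀ n, (X n).IsChain (Z.Follows fun y => ∃ m, y ∈ X m)
  apart : ∀ n, (X n).Pairwise Z.SegApart
  next_last : ∀ n, X (n + 1) = X n → ∀ x ∈ (X n).getLast?, Z.next x.1 = none ∧ ∀ s p, x.1 ≠ .fork s p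
  row_pos : ∀ n t, X n = X 0 ++ t → ∀ x ∈ t, 0 < x.2.1

namespace IsRoute

variable {Z} {X : ℕ → List (Spot S Y)}

/-- The bars of a route, in order. -/
def bars (Z : Zigzag S Y) (X : ℕ → List (Spot S Y)) (n : ℕ) : List (Spot S Y × ℕ) :=
  ((X n).map Z.barsOf).flatten

theorem mem_bars {n : ℕ} {a : Spot S Y × ℕ} :
    a ∈ bars Z X n ↔ a.1 ∈ X n ∧ a.2 < (Z.piece a.1.1).len := by
  simp only [bars, List.mem_flatten, List.mem_map, exists_exists_and_eq_and, mem_barsOf]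
  constructor
  · rintro ⟨x, hx, rfl, h⟩; exact ⟨hx, h⟩
  · rintro ⟨hx, h⟩; exact ⟨a.1, hx, rfl, h⟩

theorem prefix_of_le (h : Z.IsRoute X) {m n : ℕ} (hmn : m ≤ n) : X m <+: X n := by
  induction hmn with
  | refl => exact List.prefix_rfl
  | step _ ih => exact ih.trans (h.mono _)

theorem bars_prefix (h : Z.IsRoute X) {m n : ℕ} (hmn : m ≤ n) : bars Z X m <+: bars Z X n := by
  obtain ⟨t, ht⟩ := h.prefix_of_le hmn
  exact ⟨(t.map Z.barsOf).flatten, by simp [bars, ← ht]⟩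

/-- The bar `b` follows the bar `a`, and nothing else can be attached to `a` in its stead. -/
def BarFollows (Z : Zigzag S Y) (X : ℕ → List (Spot S Y)) (a b : Spot S Y × ℕ) : Prop :=
  Z.Link a.1.1 a.2 (Z.place a) b.1.1 b.2 (Z.place b) ∧ a.1.2.1 ≤ b.1.2.1 ∧
    ∀ τ m w, Z.Out a.1.1 a.2 (Z.place a) τ m w →
      (∃ n, ∃ c ∈ bars Z X n, c.1.2.1 < a.1.2.1 ∧ ¬ Piece.Apart w (Z.place c)) ∨
        w = Z.place b ∧ (0 < b.1.2.1 → τ = b.1.1 ∧ m = b.2)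

/-- At a fork two successors are conceivable, and the outline of the written bit excludes the wrong
one. After any other segment the position is forced, and above row 0 so is the tile, since there the
label determines the segment. -/
theorem barFollows_of_follows {x x' : Spot S Y} (hx : Z.Follows (fun y => ∃ m, y ∈ X m) x x') :
    BarFollows Z X (x, (Z.piece x.1).len - 1) (x', 0) := by
  have hrow := hx.row_le
  rcases hx with ⟨s, p, b, h1, h2, h3, y, ⟨n, hy⟩, hy1, hy2, hy3⟩ | ⟨τ, h1, h2, h3, h4⟩
  · obtain ⟨σ, r, z⟩ := x
    obtain ⟨σ', r', z'⟩ := x'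
    obtain ⟨rfl, rfl⟩ : r' = r ∧ z' = z := by simpa using h3
    dsimp only at h1 h2
    subst h1 h2
    refine ⟨Z.link_sense s p b _, hrow, fun τ m w ho => ?_⟩
    obtain ⟨rfl, c, rfl, hw⟩ := Z.eq_of_out_fork ho
    rcases eq_or_ne c b with rfl | hcb
    · exact Or.inr ⟨hw, fun _ => ⟨rfl, rfl⟩⟩
    -- The wrong exit: its first bar overlaps a bar of the segment that wrote `b` in the row below.
    · left
      obtain rfl : c = !b := by revert hcb; cases b <;> cases c <;> simp
      obtain ⟨l, hl, hl'⟩ := Piece.exists_not_apart_write_sense (Piece.flip (Z.dir s)) b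
      have hff : Piece.flip (Piece.flip (Z.dir s)) = Z.dir s := by cases Z.dir s <;> rfl
      rw [hff] at hl'
      refine ⟨n, (y, l), mem_bars.2 ⟨hy, by rw [hy1]; exact hl⟩, ?_, fun hap => hl' ?_⟩
      · dsimp only at hy2 ⊢
        omega
      · rw [hw] at hap
        have hyo : Spot.origin ((Seg.fork s p, r', z') : Spot S Y) = (0, 25) + y.origin := by
          simp only [Spot.origin, Prod.mk_add_mk, zero_add, Prod.mk.injEq]
          dsimp only at hy2 hy3
          constructor <;> omega
        rw [hyo, ← add_assoc, place] at hap
        dsimp only at hap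
        rw [hy1, Piece.apart_add_iff] at hap
        exact hap.symm
  · have hb : Z.place (x', 0) = (Z.piece x'.1).pos 0 + (x.origin + (Z.piece x.1).shift) := by
      simp only [place, h4]
    refine ⟨?_, hrow, fun τ' m w ho => Or.inr ?_⟩
    · rw [hb]
      exact Z.link_next h1 h2 _
    · obtain ⟨h5, rfl, hw⟩ := Z.eq_of_out_next h1 ho
      rw [hb, Z.piece_eq_of_label_eq (h2.trans h5.symm)]
      refine ⟨hw, fun hr => ?_⟩
      obtain ⟨h6, h7⟩ := h3 hr
      exact ⟨(h7 _ h5).trans h6.symm, rfl⟩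

theorem barFollows_succ {x : Spot S Y} {l : ℕ} (hl : l + 1 < (Z.piece x.1).len) :
    BarFollows Z X (x, l) (x, l + 1) := by
  refine ⟨Z.link_succ hl _, le_rfl, fun τ m w ho => Or.inr ?_⟩
  obtain ⟨h1, h2, h3⟩ := Z.eq_of_out_succ hl ho
  exact ⟨h3, fun _ => ⟨h1, h2⟩⟩

theorem barsOf_ne_nil (x : Spot S Y) : Z.barsOf x ≠ [] := by
  have := Piece.len_pos (Z.piece x.1)
  simp only [barsOf, ne_eq, List.map_eq_nil_iff, List.range_eq_nil]
  omega

theorem head?_barsOf (x : Spot S Y) : (Z.barsOf x).head? = some (x, 0) := by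
  have := Piece.len_pos (Z.piece x.1)
  obtain ⟨n, hn⟩ := Nat.exists_eq_succ_of_ne_zero this.ne'
  simp [barsOf, hn, List.range_succ_eq_map]

theorem getLast?_barsOf (x : Spot S Y) :
    (Z.barsOf x).getLast? = some (x, (Z.piece x.1).len - 1) := by
  have := Piece.len_pos (Z.piece x.1)
  obtain ⟨n, hn⟩ := Nat.exists_eq_succ_of_ne_zero this.ne'
  simp [barsOf, hn, List.range_succ]

theorem isChain_bars (h : Z.IsRoute X) (n : ℕ) : (bars Z X n).IsChain (BarFollows Z X) := by
  unfold bars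
  rw [List.isChain_flatten]
  · constructor
    · intro l hl
      obtain ⟨x, -, rfl⟩ := List.mem_map.1 hl
      rw [barsOf, List.isChain_map, List.isChain_range]
      intro m hm
      exact barFollows_succ (by omega)
    · rw [List.isChain_map]
      refine (h.chain n).imp fun x x' hx => ?_
      simp only [head?_barsOf, getLast?_barsOf, Option.mem_def, Option.some.injEq]
      rintro _ rfl _ rfl
      exact barFollows_of_follows hx
  · simp only [List.mem_map, not_exists, not_and]
    exact fun x _ => barsOf_ne_nil x

theorem pairwise_bars (h : Z.IsRoute X) (n : ℕ) :
    (bars Z X n).Pairwise fun a b => Piece.Apart (Z.place a) (Z.place b) := by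
  unfold bars
  rw [List.pairwise_flatten]
  constructor
  · intro l hl
    obtain ⟨x, -, rfl⟩ := List.mem_map.1 hl
    rw [barsOf, List.pairwise_map]
    refine List.pairwise_lt_range.imp_of_mem fun {i j} _ hj hij => ?_
    rw [List.mem_range] at hj
    exact Piece.apart_add_iff.2 (Piece.apart_self _ j hj i hij)
  · rw [List.pairwise_map]
    refine (h.apart n).imp fun {x y} hxy => ?_
    rintro ⟨_, l⟩ ha ⟨_, k⟩ hb
    obtain ⟨rfl, hl⟩ := Z.mem_barsOf.1 ha
    obtain ⟨rfl, hk⟩ := Z.mem_barsOf.1 hb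
    exact hxy l hl k hk

/-- Since the path never descends to an earlier row, whatever is to block a wrong turn is already in
place when the fork is reached; see `mem_of_row_lt`. -/
theorem pairwise_row (h : Z.IsRoute X) (n : ℕ) :
    (bars Z X n).Pairwise fun a b => a.1.2.1 ≤ b.1.2.1 := by
  have : Trans (fun a b : Spot S Y × ℕ => a.1.2.1 ≤ b.1.2.1)
    (fun a b : Spot S Y × ℕ => a.1.2.1 ≤ b.1.2.1) (fun a b => a.1.2.1 ≤ b.1.2.1) :=
    ⟨fun h1 h2 => le_trans h1 h2⟩
  rw [← List.isChain_iff_pairwise]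
  exact (h.isChain_bars n).imp fun _ _ hab => hab.2.1

/-- The initial segment of a route that ends with the bar `a` contains all bars of earlier rows. -/
theorem mem_of_row_lt (h : Z.IsRoute X) {n m : ℕ} {l : List (Spot S Y × ℕ)} {a c : Spot S Y × ℕ}
    (hl : l ++ [a] <+: bars Z X n) (hc : c ∈ bars Z X m) (hrow : c.1.2.1 < a.1.2.1) : c ∈ l := by
  obtain ⟨t, ht⟩ := hl.trans (h.bars_prefix (le_max_left n m))
  have hc' := (h.bars_prefix (le_max_right n m)).subset hc
  have hp := h.pairwise_row (max n m)
  rw [← ht] at hc' hp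
  rw [List.append_assoc, List.pairwise_append] at hp
  rw [List.append_assoc] at hc'
  rcases List.mem_append.1 hc' with hc' | hc'
  · exact hc'
  · exfalso
    have h2 := hp.2.1
    simp only [List.singleton_append, List.pairwise_cons] at h2 hc'
    rcases List.mem_cons.1 hc' with rfl | hc'
    · exact lt_irrefl _ hrow
    · exact absurd (h2.1 c hc') (not_le.2 hrow)

/-- A route that becomes stationary ends in a segment without successor, so an initial segment
either can be prolonged or ends at a bar that offers no continuation. -/
theorem exists_next (h : Z.IsRoute X) {n : ℕ} {l : List (Spot S Y × ℕ)} {a : Spot S Y × ℕ}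
    (hl : l ++ [a] <+: bars Z X n) : (∃ m b, l ++ [a] ++ [b] <+: bars Z X m) ∨
      ¬ a.2 + 1 < (Z.piece a.1.1).len ∧ Z.next a.1.1 = none ∧ ∀ s p, a.1.1 ≠ .fork s p := by
  obtain ⟨t, ht⟩ := hl
  cases t with
  | cons b t =>
    left
    refine ⟨n, b, t, ?_⟩
    rw [← ht]; simp
  | nil =>
    rw [List.append_nil] at ht
    by_cases hX : X (n + 1) = X n
    · right
      have hlast : (bars Z X n).getLast? = some a := by rw [← ht]; simp
      have hne : X n ≠ [] := by
        intro h0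
        simp [bars, h0] at ht
      obtain ⟨t', x, hx⟩ := List.eq_nil_or_concat (X n) |>.resolve_left hne
      rw [List.concat_eq_append] at hx
      have hlast' : (bars Z X n).getLast? = some (x, (Z.piece x.1).len - 1) := by
        simp only [bars, hx, List.map_append, List.flatten_append, List.map_cons, List.map_nil,
          List.flatten_cons, List.flatten_nil, List.append_nil]
        rw [List.getLast?_append, getLast?_barsOf]
        rfl
      rw [hlast] at hlast'
      obtain rfl := Option.some.inj hlast'
      have := h.next_last n hX x (by rw [hx]; simp)
      have hlen := Piece.len_pos (Z.piece x.1)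
      exact ⟨by dsimp only; omega, this⟩
    · left
      obtain ⟨t, htX⟩ := h.mono n
      cases t with
      | nil => exact absurd (by simpa using htX.symm) hX
      | cons x t =>
        refine ⟨n + 1, (x, 0), (Z.barsOf x).tail ++ (t.map Z.barsOf).flatten, ?_⟩
        have hx : Z.barsOf x = (x, 0) :: (Z.barsOf x).tail := by
          have := head?_barsOf (Z := Z) x
          exact List.eq_cons_of_mem_head? this
        rw [ht]
        simp only [bars, ← htX, List.map_append, List.flatten_append, List.map_cons,
          List.flatten_cons]
        conv_rhs => rw [hx]
        simp

/-- Bars beyond the seed lie above row 0, where successors are unique. The ambiguity of labels in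
row 0 is harmless because row 0 is the seed. -/
theorem row_pos_of_prefix (h : Z.IsRoute X) {n : ℕ} {l : List (Spot S Y × ℕ)} {b : Spot S Y × ℕ}
    (h0 : bars Z X 0 <+: l) (hl : l ++ [b] <+: bars Z X n) : 0 < b.1.2.1 := by
  obtain ⟨t, ht⟩ := h.prefix_of_le (Nat.zero_le n)
  obtain ⟨u, rfl⟩ := h0
  obtain ⟨v, hv⟩ := hl
  have : bars Z X n = bars Z X 0 ++ (t.map Z.barsOf).flatten := by simp [bars, ← ht]
  rw [this, List.append_assoc, List.append_assoc, List.append_cancel_left_eq] at hv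
  have hb : b ∈ (t.map Z.barsOf).flatten := by rw [← hv]; simp
  obtain ⟨_, hm, hb⟩ := List.mem_flatten.1 hb
  obtain ⟨x, hx, rfl⟩ := List.mem_map.1 hm
  rw [(Z.mem_barsOf.1 hb).1]
  exact h.row_pos n t ht.symm x hx

/-- A system whose seed is the first part of a route, and whose tiles are among those of the
automaton, grows along this route. -/
theorem isTrack (h : Z.IsRoute X) {𝒯 : TileAssemblySystem (Seg S Y × ℕ)}
    (hstr : 𝒯.strength = fun _ => 1) (htemp : 𝒯.temperature = 1)
    (hseed : ∀ x, x ∈ 𝒯.seed ↔ x ∈ (bars Z X 0).map Z.placed)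
    (htile : ∀ t ∈ 𝒯.tiles, ∃ σ l, t = Z.tile σ l)
    (hmem : ∀ n, ∀ a ∈ bars Z X n, Z.tile a.1.1 a.2 ∈ 𝒯.tiles) :
    IsTrack 𝒯 fun n => (bars Z X n).map Z.placed where
  strength := hstr
  temperature := htemp
  seed := hseed
  ne_nil := by
    obtain ⟨x, t, hx, -⟩ := h.head
    simp [bars, hx, barsOf_ne_nil]
  mono n := (h.bars_prefix (Nat.le_succ n)).map _
  tiles n x hx := by
    obtain ⟨a, ha, rfl⟩ := List.mem_map.1 hx
    exact hmem n a ha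
  disjoint n := by
    rw [List.pairwise_map]
    exact (h.pairwise_bars n).imp fun hab => Z.disjoint_cells_iff.2 hab
  chain n := by
    rw [List.isChain_map]
    exact (h.isChain_bars n).imp fun _ _ hab => hab.1.bond
  next := by
    intro n l h0 hl q hq hdis ⟨p, hp, hb⟩
    -- Pass from placed tiles back to numbered bars, which remember their segments and rows.
    obtain ⟨le, hle, rfl⟩ : ∃ le, le <+: bars Z X n ∧ l = le.map Z.placed := by
      refine ⟨(bars Z X n).take l.length, List.take_prefix _ _, ?_⟩
      rw [List.map_take]
      exact List.prefix_iff_eq_take.1 hl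
    have h0' : bars Z X 0 <+: le := by
      refine List.prefix_of_prefix_length_le (h.bars_prefix (Nat.zero_le n)) hle ?_
      simpa using h0.length_le
    obtain ⟨a, ha, rfl⟩ := List.mem_map.1 hp
    obtain ⟨τ, m, hqt⟩ := htile q.1 hq
    obtain ⟨qt, w⟩ := q
    dsimp only at hqt
    subst hqt
    have hdis' : ∀ c ∈ le, Piece.Apart w (Z.place c) := fun c hc =>
      Z.disjoint_cells_iff.1 (hdis _ (List.mem_map_of_mem hc))
    obtain ⟨l₁, l₂, rfl⟩ := List.append_of_mem ha
    rcases Z.bond_cases hb with ho | ⟨ho, hcell⟩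
    · cases l₂ with
      | nil =>
        rcases h.exists_next hle with ⟨k, b, hk⟩ | ⟨h1, h2, h3⟩
        · have hab : BarFollows Z X a b := by
            have := (h.isChain_bars k).prefix hk
            rw [List.append_assoc, List.isChain_append] at this
            exact this.2.1.rel
          rcases hab.2.2 τ m w ho with ⟨j, c, hc, hrow, hnot⟩ | ⟨h1, h2⟩
          -- The blocking bar lies in an earlier row, hence in the present assembly.
          · exact absurd (hdis' c (by simp [h.mem_of_row_lt hle hc hrow])) hnot
          · obtain ⟨rfl, rfl⟩ := h2 (h.row_pos_of_prefix h0' hk)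
            refine ⟨k, ?_⟩
            subst h1
            have := hk.map Z.placed
            rw [List.map_append] at this
            exact this
        · exact absurd ho (Z.not_out_of_next_eq_none h1 h2 h3)
      | cons b l₂ =>
        exfalso
        have hab : BarFollows Z X a b := by
          have := (h.isChain_bars n).prefix hle
          rw [List.isChain_append] at this
          exact this.2.1.rel
        rcases hab.2.2 τ m w ho with ⟨j, c, hc, hrow, hnot⟩ | ⟨h1, h2⟩
        · have hpre : l₁ ++ [a] <+: bars Z X n := by
            refine List.IsPrefix.trans ⟨b :: l₂, ?_⟩ hle
            simp
          exact absurd (hdis' c (by simp [h.mem_of_row_lt hpre hc hrow])) hnot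
        -- The successor of `a` is present already, and the new tile would stand in its place.
        · have := hdis' b (by simp)
          rw [h1, Piece.Apart] at this
          omega
    · exfalso
      -- The new tile would be a predecessor of `a`. Either `a` is the first bar, whose entry glue
      -- nobody offers, or the square in front of its entry belongs to the bar before it.
      rcases List.eq_nil_or_concat l₁ with rfl | ⟨l₀, a', rfl⟩
      · obtain ⟨x, t, hx, hx1⟩ := h.head
        have ha0 : a = (x, 0) := by
          have hh : (bars Z X 0).head? = some (x, 0) := by
            simp [bars, hx, head?_barsOf]
          obtain ⟨u, hu⟩ := h0'
          have hh' : (bars Z X 0 ++ u).head? = some (x, 0) := by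
            rw [List.head?_append, hh]; rfl
          rw [hu] at hh'
          simpa using hh'
        subst ha0
        dsimp only at ho
        rw [hx1] at ho
        exact Z.not_out_first ho
      · rw [List.concat_eq_append] at hle hdis'
        have hab : BarFollows Z X a' a := by
          have := (h.isChain_bars n).prefix hle
          rw [List.append_assoc, List.isChain_append] at this
          exact this.2.1.rel
        have h1 := hab.1.mate_mem_bar
        have h2 := (Z.disjoint_cells_iff (σ := τ) (l := m) (τ := a'.1.1) (m := a'.2)).2
          (hdis' a' (by simp))
        have h3 : ((Z.piece a.1.1).entry a.2).1 + Z.place a + ((Z.piece a.1.1).entry a.2).2.vec ∈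
            Placement.cells (Z.tile τ m, w) := hcell
        exact Set.disjoint_left.1 h2 h3 h1

end IsRoute

end Zigzag

end Routes

end PolyTAM

namespace PolyTAM

section Tableaux

open Turing (Dir)

/-! ### Tableaux: the rows written by a zigzag automaton -/

/-- The sign of a direction. -/
def sgn : Dir → ℤ
  | .right => 1
  | .left => -1

/-- The direction of the sweep in row `r`. -/
def rowDir (r : ℕ) : Dir := if r % 2 = 0 then .right else .left

theorem rowDir_succ (r : ℕ) : rowDir (r + 1) = Piece.flip (rowDir r) := by
  unfold rowDir
  rcases Nat.mod_two_eq_zero_or_one r with h | h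
  · rw [if_pos h, if_neg (show ¬ (r + 1) % 2 = 0 by omega)]; rfl
  · rw [if_neg (show ¬ r % 2 = 0 by omega), if_pos (show (r + 1) % 2 = 0 by omega)]; rfl

namespace Zigzag

variable {S Y : Type} (Z : Zigzag S Y)

/-- The zone in which the work on cell `i` begins. -/
def zone (d : Dir) (i : ℤ) : ℤ :=
  match d with
  | .right => 2 * Z.size * i
  | .left => 2 * Z.size * i + 2 * Z.size - 1

/-- The segments that read the symbol `y`. -/
def reads (s : S) (y : Y) (r : ℕ) (z : ℤ) : List (Spot S Y) :=
  ((List.range Z.size).map fun j : ℕ =>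
    [(.fork s ((Z.bits (Z.dir s) y).take j), r, z + sgn (Z.dir s) * j),
      (.sense s ((Z.bits (Z.dir s) y).take j) ((Z.bits (Z.dir s) y).getD j false), r,
        z + sgn (Z.dir s) * j)]).flatten

/-- The segments by which a cell is crossed without reading. -/
def passes (s : S) (r : ℕ) (z : ℤ) : List (Spot S Y) :=
  (List.range Z.size).map fun j : ℕ => (.pass s j, r, z + sgn (Z.dir s) * j)

/-- The segments that write the symbol `y`. -/
def writes (d : Dir) (y : Y) (s : S) (r : ℕ) (z : ℤ) : List (Spot S Y) :=
  (List.range Z.size).map fun j : ℕ => (.write d y s ((Z.bits d y).drop j), r, z + sgn d * j)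

/-- The segments by which the path crosses the second half of a cell. -/
def back (r : ℕ) (i : ℤ) (y : Y) (s : S) : List (Spot S Y) :=
  Z.writes (rowDir r) y s r (Z.zone (rowDir r) i + sgn (rowDir r) * Z.size)

/-- The contents of the rows written by an automaton, its states when it enters the cells, and
those rows that it completes. -/
structure Tableau (S Y : Type) where
  width : ℕ
  cont : ℕ → ℤ → Y
  st : ℕ → ℤ → S
  alive : ℕ → Prop

namespace Tableau

variable (T : Tableau S Y)

/-- The leftmost cell of a row. -/
def lo (r : ℕ) : ℤ := -1 - ((r : ℤ) + 1) / 2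

/-- The rightmost cell of a row. -/
def hi (r : ℕ) : ℤ := T.width + (r : ℤ) / 2

/-- The cell in which a row begins. -/
def ini (r : ℕ) : ℤ := if r % 2 = 0 then lo r else T.hi r

/-- The number of cells of a row. -/
def count (r : ℕ) : ℕ := T.width + 2 + r

/-- The cell beyond a row where the path turns. -/
def fin (r : ℕ) : ℤ := if r % 2 = 0 then T.hi r + 1 else lo r - 1

/-- What the automaton writes in a cell, and its next state. -/
def stepAt (r : ℕ) (i : ℤ) : Option (Y × S) :=
  match Z.op (T.st r i) with
  | .readWrite f => f (T.cont (r - 1) i)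
  | .write y s => some (y, s)
  | .turn _ => none

/-- The segments by which the path crosses the first half of a cell. -/
def front (r : ℕ) (i : ℤ) : List (Spot S Y) :=
  match Z.op (T.st r i) with
  | .readWrite _ => Z.reads (T.st r i) (T.cont (r - 1) i) r (Z.zone (rowDir r) i)
  | _ => Z.passes (T.st r i) r (Z.zone (rowDir r) i)

/-- The segments of the path in `k` cells of row `r` beginning with cell `i`, and the turn. -/
def rowFrom (r : ℕ) : ℕ → ℤ → List (Spot S Y)
  | 0, i => [(.turn (T.st r i), r, Z.zone (rowDir r) i)]
  | k + 1, i => T.front Z r i ++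
      match T.stepAt Z r i with
      | none => []
      | some (y, s) => Z.back r i y s ++ rowFrom r k (i + sgn (rowDir r))

/-- The segments of the path in row `r`. -/
def row (r : ℕ) : List (Spot S Y) := T.rowFrom Z r (T.count r) (T.ini r)

open scoped Classical in
/-- The segments of the path in the rows up to row `n`. -/
noncomputable def route : ℕ → List (Spot S Y)
  | 0 => T.row Z 0
  | n + 1 => if T.alive n then route n ++ T.row Z (n + 1) else route n

/-- The path enters row `r`. -/
def Built (r : ℕ) : Prop := ∀ n < r, T.alive n

/-- The tableau is the one that the automaton produces. -/
structure IsValid : Prop where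
  dir_st : ∀ r i, Z.dir (T.st r i) = rowDir r
  st_first : T.st 0 (-1) = Z.first
  st_ne_first : ∀ r i, 0 < r → T.st r i ≠ Z.first
  link_st : ∀ r i s, 0 < r → Z.link s = Z.link (T.st r i) → s = T.st r i
  alive_of_succ : ∀ r, T.alive (r + 1) → T.alive r
  op_old : ∀ r i, T.Built (r + 1) → lo r ≤ i → i ≤ T.hi r →
    ∃ f, Z.op (T.st (r + 1) i) = .readWrite f
  op_new : ∀ r i, T.Built (r + 1) → lo (r + 1) ≤ i → i ≤ T.hi (r + 1) → ¬ (lo r ≤ i ∧ i ≤ T.hi r) →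
    ∃ y s, Z.op (T.st (r + 1) i) = .write y s
  op_zero : ∀ i, lo 0 ≤ i → i ≤ T.hi 0 → ∃ y s, Z.op (T.st 0 i) = .write y s
  op_fin : ∀ r, T.alive r → Z.op (T.st r (T.fin r)) = .turn (T.st (r + 1) (T.ini (r + 1)))
  step : ∀ r i y s, T.Built r → lo r ≤ i → i ≤ T.hi r → T.stepAt Z r i = some (y, s) →
    y = T.cont r i ∧ Z.label (Z.enter s) = Z.label (Z.enter (T.st r (i + sgn (rowDir r)))) ∧
      (0 < r → s = T.st r (i + sgn (rowDir r))) ∧ s ≠ Z.first ∧ Z.dir s = rowDir r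
  alive_iff : ∀ r, T.Built r →
    (T.alive r ↔ ∀ i, lo r ≤ i → i ≤ T.hi r → T.stepAt Z r i ≠ none)

variable {T Z}

/-! ### The path within one row -/

theorem rowDir_cases (r : ℕ) :
    (r % 2 = 0 ∧ rowDir r = .right ∧ T.ini r = lo r ∧ T.fin r = T.hi r + 1 ∧
      sgn (rowDir r) = 1) ∨
    (r % 2 = 1 ∧ rowDir r = .left ∧ T.ini r = T.hi r ∧ T.fin r = lo r - 1 ∧
      sgn (rowDir r) = -1) := by
  unfold rowDir ini fin
  rcases Nat.mod_two_eq_zero_or_one r with h | h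
  · left; simp [h, sgn]
  · right; simp [h, sgn]

theorem ini_add_count (r : ℕ) : T.ini r + sgn (rowDir r) * T.count r = T.fin r := by
  rcases T.rowDir_cases r with ⟨h, -, h1, h2, h3⟩ | ⟨h, -, h1, h2, h3⟩ <;>
    rw [h1, h2, h3] <;> simp only [lo, hi, count] <;> push_cast <;> omega

theorem mem_row_range (r : ℕ) (j : ℕ) (hj : j < T.count r) :
    lo r ≤ T.ini r + sgn (rowDir r) * j ∧ T.ini r + sgn (rowDir r) * j ≤ T.hi r := by
  simp only [count] at hj
  rcases T.rowDir_cases r with ⟨h, -, h1, h2, h3⟩ | ⟨h, -, h1, h2, h3⟩ <;>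
    rw [h1, h3] <;> simp only [lo, hi] <;> constructor <;> omega

theorem exists_of_mem_row_range (r : ℕ) (i : ℤ) (h1 : lo r ≤ i) (h2 : i ≤ T.hi r) :
    ∃ j < T.count r, i = T.ini r + sgn (rowDir r) * (j : ℕ) := by
  simp only [count, lo, hi] at *
  rcases T.rowDir_cases r with ⟨h, -, h1, -, h3⟩ | ⟨h, -, h1, -, h3⟩
  · refine ⟨(i - T.ini r).toNat, ?_, ?_⟩ <;> rw [h1] <;> (try rw [h3]) <;>
      simp only [lo] <;> omega
  · refine ⟨(T.ini r - i).toNat, ?_, ?_⟩ <;> rw [h1] <;> (try rw [h3]) <;>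
      simp only [hi] <;> omega

theorem IsValid.op_ne_turn (hV : T.IsValid Z) {r : ℕ} (hr : T.Built r) {i : ℤ} (h1 : lo r ≤ i)
    (h2 : i ≤ T.hi r) (s : S) : Z.op (T.st r i) ≠ .turn s := by
  cases r with
  | zero =>
    obtain ⟨y, s', h⟩ := hV.op_zero i h1 h2
    rw [h]; simp
  | succ r =>
    by_cases h : lo r ≤ i ∧ i ≤ T.hi r
    · obtain ⟨f, h⟩ := hV.op_old r i hr h.1 h.2
      rw [h]; simp
    · obtain ⟨y, s', h⟩ := hV.op_new r i hr h1 h2 h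
      rw [h]; simp

theorem head?_map_range {α : Type} {n : ℕ} (hn : 0 < n) (f : ℕ → α) :
    ((List.range n).map f).head? = some (f 0) := by
  obtain ⟨m, rfl⟩ := Nat.exists_eq_succ_of_ne_zero hn.ne'
  simp [List.range_succ_eq_map]

theorem getLast?_map_range {α : Type} {n : ℕ} (hn : 0 < n) (f : ℕ → α) :
    ((List.range n).map f).getLast? = some (f (n - 1)) := by
  obtain ⟨m, rfl⟩ := Nat.exists_eq_succ_of_ne_zero hn.ne'
  simp [List.range_succ]

theorem head?_reads (s : S) (y : Y) (r : ℕ) (z : ℤ) :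
    (Z.reads s y r z).head? = some (.fork s [], r, z) := by
  obtain ⟨m, hm⟩ := Nat.exists_eq_succ_of_ne_zero Z.size_pos.ne'
  simp [reads, hm, List.range_succ_eq_map]

theorem getLast?_reads (s : S) (y : Y) (r : ℕ) (z : ℤ) :
    (Z.reads s y r z).getLast? = some (.sense s ((Z.bits (Z.dir s) y).take (Z.size - 1))
      ((Z.bits (Z.dir s) y).getD (Z.size - 1) false), r, z + sgn (Z.dir s) * (Z.size - 1 : ℕ)) := by
  obtain ⟨m, hm⟩ := Nat.exists_eq_succ_of_ne_zero Z.size_pos.ne'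
  simp [reads, hm, List.range_succ]

theorem head?_writes (d : Dir) (y : Y) (s : S) (r : ℕ) (z : ℤ) :
    (Z.writes d y s r z).head? = some (.write d y s (Z.bits d y), r, z) := by
  rw [writes, head?_map_range Z.size_pos]
  simp

theorem getLast?_writes (d : Dir) (y : Y) (s : S) (r : ℕ) (z : ℤ) :
    (Z.writes d y s r z).getLast? = some (.write d y s ((Z.bits d y).drop (Z.size - 1)), r,
      z + sgn d * (Z.size - 1 : ℕ)) := by
  rw [writes, getLast?_map_range Z.size_pos]

theorem IsValid.head?_front (hV : T.IsValid Z) {r : ℕ} (hr : T.Built r) {i : ℤ} (h1 : lo r ≤ i)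
    (h2 : i ≤ T.hi r) :
    (T.front Z r i).head? = some (Z.enter (T.st r i), r, Z.zone (rowDir r) i) := by
  have h3 := hV.op_ne_turn hr h1 h2
  unfold front enter
  cases h : Z.op (T.st r i) with
  | readWrite f => simp only [head?_reads]
  | write y s => simp only [passes, head?_map_range Z.size_pos]; simp
  | turn s => exact absurd h (h3 s)

theorem IsValid.head?_rowFrom (hV : T.IsValid Z) {r : ℕ} (hr : T.Built r) {i : ℤ} (k : ℕ)
    (h : ∀ j : ℕ, j < k → lo r ≤ i + sgn (rowDir r) * j ∧ i + sgn (rowDir r) * j ≤ T.hi r)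
    (h0 : k = 0 → ∃ s, Z.op (T.st r i) = .turn s) :
    (T.rowFrom Z r k i).head? = some (Z.enter (T.st r i), r, Z.zone (rowDir r) i) := by
  cases k with
  | zero =>
    obtain ⟨s, hs⟩ := h0 rfl
    simp [rowFrom, enter, hs]
  | succ k =>
    have := h 0 (by omega)
    simp only [Nat.cast_zero, mul_zero, add_zero] at this
    rw [rowFrom, List.head?_append, hV.head?_front hr this.1 this.2]
    rfl

theorem shift_eq {g : Piece} {d : Dir} (h : (∃ b, g = .sense d b) ∨ g = .pass d ∨
    ∃ b, g = .write d b) : g.shift = (13 * sgn d, 0) := by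
  rcases h with ⟨b, rfl⟩ | rfl | ⟨b, rfl⟩ <;> cases d <;> rfl

theorem take_append_getD {l : List Bool} {j : ℕ} (hj : j < l.length) :
    l.take j ++ [l.getD j false] = l.take (j + 1) := by
  rw [List.getD_eq_getElem _ _ hj, List.take_append_getElem hj]

/-- After the last bit of a cell the whole symbol is known and `decode` recovers it. Only here does
the transition of the automaton take effect; if it is undefined, the path ends. -/
theorem IsValid.getLast?_front (hV : T.IsValid Z) {r : ℕ} (hr : T.Built r) {i : ℤ}
    (h1 : lo r ≤ i) (h2 : i ≤ T.hi r) : ∃ σ,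
    (T.front Z r i).getLast? = some (σ, r, Z.zone (rowDir r) i +
      sgn (rowDir r) * (Z.size - 1 : ℕ)) ∧
    (∀ s p, σ ≠ .fork s p) ∧ (Z.piece σ).shift = (13 * sgn (rowDir r), 0) ∧
    Z.next σ = (T.stepAt Z r i).map fun q =>
      .write (rowDir r) q.1 q.2 (Z.bits (rowDir r) q.1) := by
  have h3 := hV.op_ne_turn hr h1 h2
  have hd := hV.dir_st r i
  have hK := Z.size_pos
  unfold front stepAt
  cases h : Z.op (T.st r i) with
  | readWrite f =>
    simp only [getLast?_reads, hd]
    refine ⟨_, rfl, by simp, shift_eq (Or.inl ⟨_, by simp [piece, hd]; rfl⟩), ?_⟩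
    have hlen := Z.length_bits (rowDir r) (T.cont (r - 1) i)
    rw [next, if_neg (by rw [List.length_take, hlen]; omega)]
    simp only [h, hd]
    rw [take_append_getD (by omega), List.take_of_length_le (by omega), Z.decode_bits]
    rfl
  | write y s =>
    simp only [passes, getLast?_map_range Z.size_pos, hd]
    refine ⟨_, rfl, by simp, shift_eq (Or.inr (Or.inl (by simp [piece, hd]))), ?_⟩
    rw [next, if_neg (by omega)]
    simp [h, hd]
  | turn s => exact absurd h (h3 s)

/-- Labels identify segments only when both are the first pass of a cell, with states of equal link.
-/
theorem label_inj {τ τ' : Seg S Y} (h : ∀ s, τ = .pass s 0 → ∀ s', Z.link s' = Z.link s → s' = s)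
    (h' : Z.label τ' = Z.label τ) : τ' = τ := by
  rcases τ with _ | _ | ⟨s, _ | n⟩ | _ | _ <;> rcases τ' with _ | _ | ⟨s', _ | n'⟩ | _ | _ <;>
    simp_all [label]

/-- A segment follows another one in the same row. -/
theorem follows_of_next {W : Spot S Y → Prop} {σ τ : Seg S Y} {r : ℕ} {z z' : ℤ} {d : Dir}
    (h : Z.next σ = some τ) (hτ : ∀ s, τ ≠ .pass s 0) (hs : (Z.piece σ).shift = (13 * sgn d, 0))
    (hz : z' = z + sgn d) : Z.Follows W (σ, r, z) (τ, r, z') := by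
  refine Or.inr ⟨τ, h, rfl, fun _ => ⟨rfl, fun τ' => label_inj fun s hs => absurd hs (hτ s)⟩, ?_⟩
  dsimp only
  rw [hs, hz]
  simp [Spot.origin, mul_add]

theorem isChain_writes {W : Spot S Y → Prop} (d : Dir) (y : Y) (s : S) (r : ℕ) (z : ℤ) :
    (Z.writes d y s r z).IsChain (Z.Follows W) := by
  rw [writes, List.isChain_map, List.isChain_range]
  intro j hj
  have hlen := Z.length_bits d y
  refine follows_of_next (d := d) ?_ (by simp) (shift_eq (Or.inr (Or.inr ⟨_, rfl⟩))) ?_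
  · rw [next, if_neg, List.tail_drop]
    rw [List.tail_drop, List.drop_eq_nil_iff]
    omega
  · push_cast; ring

theorem isChain_passes {W : Spot S Y → Prop} (s : S) (r : ℕ) (z : ℤ) :
    (Z.passes s r z).IsChain (Z.Follows W) := by
  rw [passes, List.isChain_map, List.isChain_range]
  intro j hj
  refine follows_of_next (d := Z.dir s) ?_ (by simp) (shift_eq (Or.inr (Or.inl rfl))) ?_
  · rw [next, if_pos (by omega)]
  · push_cast; ring

theorem isChain_reads {W : Spot S Y → Prop} (s : S) (y : Y) (r : ℕ) (z : ℤ)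
    (hW : ∀ j < Z.size, ∃ x, W x ∧ Z.piece x.1 = .write (Piece.flip (Z.dir s))
      ((Z.bits (Z.dir s) y).getD j false) ∧ x.2.1 + 1 = r ∧ x.2.2 = z + sgn (Z.dir s) * j) :
    (Z.reads s y r z).IsChain (Z.Follows W) := by
  rw [reads, List.isChain_flatten]
  · constructor
    · intro l hl
      obtain ⟨j, hj, rfl⟩ := List.mem_map.1 hl
      obtain ⟨x, h1, h2, h3, h4⟩ := hW j (List.mem_range.1 hj)
      rw [List.isChain_pair]
      exact Or.inl ⟨s, _, _, rfl, rfl, rfl, x, h1, h2, h3, h4⟩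
    · rw [List.isChain_map, List.isChain_range]
      intro j hj
      have hlen := Z.length_bits (Z.dir s) y
      simp only [List.getLast?_cons_cons, List.getLast?_singleton, List.head?_cons, Option.mem_def,
        Option.some.injEq]
      rintro _ rfl _ rfl
      refine follows_of_next (d := Z.dir s) ?_ (by simp) (shift_eq (Or.inl ⟨_, rfl⟩)) ?_
      · rw [next, if_pos, take_append_getD (by omega)]
        rw [List.length_take, hlen]
        omega
      · push_cast; ring
  · simp

/-- The written symbols of the row below are found where they are read. -/
def Wrote (T : Tableau S Y) (Z : Zigzag S Y) (W : Spot S Y → Prop) (r : ℕ) : Prop :=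
  ∀ i, lo r ≤ i → i ≤ T.hi r → ∀ j < Z.size, ∃ x, W x ∧
    Z.piece x.1 = .write (rowDir r) ((Z.bits (Piece.flip (rowDir r)) (T.cont r i)).getD j false) ∧
    x.2.1 = r ∧ x.2.2 = Z.zone (Piece.flip (rowDir r)) i + sgn (Piece.flip (rowDir r)) * j

theorem flip_flip (d : Dir) : Piece.flip (Piece.flip d) = d := by cases d <;> rfl

/-- A cell that is read also belongs to the row below, so `Wrote` supplies the blocking segment for
each of its forks; new cells are merely crossed. -/
theorem IsValid.isChain_front (hV : T.IsValid Z) {W : Spot S Y → Prop} {r : ℕ} (hr : T.Built r)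
    (hW : ∀ r', r = r' + 1 → T.Wrote Z W r') {i : ℤ} (h1 : lo r ≤ i) (h2 : i ≤ T.hi r) :
    (T.front Z r i).IsChain (Z.Follows W) := by
  unfold front
  cases h : Z.op (T.st r i) with
  | readWrite f =>
    cases r with
    | zero =>
      obtain ⟨y, s, h'⟩ := hV.op_zero i h1 h2
      rw [h] at h'; cases h'
    | succ r =>
      have hin : lo r ≤ i ∧ i ≤ T.hi r := by
        by_contra hn
        obtain ⟨y, s, h'⟩ := hV.op_new r i hr h1 h2 hn
        rw [h] at h'; cases h'
      refine isChain_reads _ _ _ _ fun j hj => ?_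
      obtain ⟨x, h3, h4, h5, h6⟩ := hW r rfl i hin.1 hin.2 j hj
      rw [← rowDir_succ] at h4 h6
      refine ⟨x, h3, ?_, by omega, ?_⟩
      · rw [hV.dir_st, rowDir_succ, flip_flip, ← rowDir_succ]
        exact h4
      · rw [hV.dir_st]; exact h6
  | write y s => exact isChain_passes _ _ _
  | turn s => exact isChain_passes _ _ _

/-- Besides the chains inside the halves of the cells there are two kinds of joints: from the first
half of a cell to its second half, and from there to the next cell or to the turn. The conditions on
`alive` ensure that with no cells left the path stands at `fin r`, where the state calls for a turn.
-/
theorem IsValid.isChain_rowFrom (hV : T.IsValid Z) {W : Spot S Y → Prop} {r : ℕ} (hr : T.Built r)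
    (hW : ∀ r', r = r' + 1 → T.Wrote Z W r') (k : ℕ) (i : ℤ)
    (h : ∀ j : ℕ, j < k → lo r ≤ i + sgn (rowDir r) * j ∧ i + sgn (rowDir r) * j ≤ T.hi r)
    (h0 : T.alive r → i + sgn (rowDir r) * k = T.fin r)
    (h1 : ¬ T.alive r → ∃ j : ℕ, j < k ∧ T.stepAt Z r (i + sgn (rowDir r) * j) = none) :
    (T.rowFrom Z r k i).IsChain (Z.Follows W) := by
  induction k generalizing i with
  | zero => exact List.isChain_singleton _
  | succ k ih =>
    have hi : lo r ≤ i ∧ i ≤ T.hi r := by simpa using h 0 (by omega)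
    obtain ⟨σ, hl1, hl2, hl3, hl4⟩ := hV.getLast?_front hr hi.1 hi.2
    have hfront := hV.isChain_front hr hW hi.1 hi.2
    rw [rowFrom]
    cases hstep : T.stepAt Z r i with
    | none => simpa using hfront
    | some q =>
      obtain ⟨y, s⟩ := q
      obtain ⟨hy, hlab, hs, hsf, hsd⟩ := hV.step r i y s hr hi.1 hi.2 hstep
      have hd := hV.dir_st r (i + sgn (rowDir r))
      have hrange : ∀ j : ℕ, j < k → lo r ≤ i + sgn (rowDir r) + sgn (rowDir r) * j ∧
          i + sgn (rowDir r) + sgn (rowDir r) * j ≤ T.hi r := by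
        intro j hj
        have := h (j + 1) (by omega)
        push_cast at this
        rw [mul_add, mul_one, add_comm (sgn (rowDir r) * (j : ℤ)), ← add_assoc] at this
        exact this
      have hend : ¬ T.alive r → ∃ j : ℕ, j < k ∧
          T.stepAt Z r (i + sgn (rowDir r) + sgn (rowDir r) * j) = none := by
        intro ha
        obtain ⟨j, hj, hj'⟩ := h1 ha
        cases j with
        | zero => rw [Nat.cast_zero, mul_zero, add_zero, hstep] at hj'; cases hj'
        | succ j =>
          refine ⟨j, by omega, ?_⟩
          push_cast at hj'
          rw [mul_add, mul_one, add_comm (sgn (rowDir r) * (j : ℤ)), ← add_assoc] at hj'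
          exact hj'
      have hfin : T.alive r → i + sgn (rowDir r) + sgn (rowDir r) * k = T.fin r := by
        intro ha
        rw [← h0 ha]; push_cast; ring
      have hhead := hV.head?_rowFrom hr k hrange (by
        rintro rfl
        by_cases ha : T.alive r
        · have := hfin ha
          simp only [Nat.cast_zero, mul_zero, add_zero] at this
          rw [this]
          exact ⟨_, hV.op_fin r ha⟩
        · obtain ⟨j, hj, -⟩ := hend ha
          omega)
      have htail := ih (i + sgn (rowDir r)) hrange hfin hend
      dsimp only
      refine List.IsChain.append hfront (List.IsChain.append (isChain_writes _ _ _ _ _) htail ?_) ?_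
      · rw [Zigzag.back, getLast?_writes, hhead]
        simp only [Option.mem_def, Option.some.injEq]
        rintro _ rfl _ rfl
        refine Or.inr ⟨Z.enter s, ?_, hlab.symm, fun h0r => ?_, ?_⟩
        · have hlen := Z.length_bits (rowDir r) y
          have hK := Z.size_pos
          rw [next, if_pos, if_pos ⟨hsd, hsf⟩]
          rw [List.tail_drop, List.drop_eq_nil_iff]
          omega
        -- Above row 0 the actual next state is the predicted one, and `link_st` makes its label
        -- unambiguous; in row 0 only the labels agree.
        · refine ⟨by rw [hs h0r], fun τ' => label_inj fun s₁ h₁ s₂ h₂ => ?_⟩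
          obtain rfl : s = s₁ := by
            unfold enter at h₁
            split at h₁ <;> simp_all
          rw [hs h0r] at h₂ ⊢
          exact hV.link_st r _ _ h0r h₂
        · dsimp only [piece]
          rw [shift_eq (d := rowDir r) (Or.inr (Or.inr ⟨_, rfl⟩))]
          have hK : ((Z.size - 1 : ℕ) : ℤ) = Z.size - 1 := by
            have := Z.size_pos
            push_cast [this]
            omega
          simp only [Spot.origin, zone, hK]
          cases rowDir r <;> simp only [sgn, Prod.mk_add_mk, Prod.mk.injEq] <;>
            constructor <;> ring
      · rw [hl1, List.head?_append, Zigzag.back, head?_writes]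
        simp only [Option.mem_def, Option.some.injEq, Option.some_or]
        rintro _ rfl _ rfl
        rw [hstep] at hl4
        refine follows_of_next (d := rowDir r) hl4 (by simp) hl3 ?_
        have hK : ((Z.size - 1 : ℕ) : ℤ) = Z.size - 1 := by
          have := Z.size_pos
          push_cast [this]
          omega
        rw [hK]; ring

/-- A row ends either with the turn or, at the first cell where the automaton is stuck, with a
segment that has no successor. -/
theorem IsValid.getLast?_rowFrom (hV : T.IsValid Z) {r : ℕ} (hr : T.Built r) (k : ℕ) (i : ℤ)
    (h : ∀ j : ℕ, j < k → lo r ≤ i + sgn (rowDir r) * j ∧ i + sgn (rowDir r) * j ≤ T.hi r) :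
    ((∀ j : ℕ, j < k → T.stepAt Z r (i + sgn (rowDir r) * j) ≠ none) →
      (T.rowFrom Z r k i).getLast? = some (.turn (T.st r (i + sgn (rowDir r) * k)), r,
        Z.zone (rowDir r) (i + sgn (rowDir r) * k))) ∧
    ((∃ j : ℕ, j < k ∧ T.stepAt Z r (i + sgn (rowDir r) * j) = none) →
      ∀ x ∈ (T.rowFrom Z r k i).getLast?, Z.next x.1 = none ∧ ∀ s p, x.1 ≠ .fork s p) := by
  induction k generalizing i with
  | zero => simp [rowFrom]
  | succ k ih =>
    have hi : lo r ≤ i ∧ i ≤ T.hi r := by simpa using h 0 (by omega)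
    obtain ⟨σ, hl1, hl2, hl3, hl4⟩ := hV.getLast?_front hr hi.1 hi.2
    have hcast : ∀ j : ℕ, i + sgn (rowDir r) * ((j + 1 : ℕ) : ℤ) =
        i + sgn (rowDir r) + sgn (rowDir r) * j := by
      intro j; push_cast; ring
    obtain ⟨ih1, ih2⟩ := ih (i + sgn (rowDir r)) (fun j hj => by
      rw [← hcast]; exact h (j + 1) (by omega))
    have hne : T.rowFrom Z r k (i + sgn (rowDir r)) ≠ [] := by
      cases k with
      | zero => simp [rowFrom]
      | succ k =>
        have h1 := h 1 (by omega)
        simp only [Nat.cast_one, mul_one] at h1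
        have := hV.head?_front hr h1.1 h1.2
        rw [rowFrom]
        intro h0
        rw [(List.append_eq_nil_iff.1 h0).1] at this
        cases this
    rw [rowFrom]
    cases hstep : T.stepAt Z r i with
    | none =>
      constructor
      · intro h1
        exact absurd (by simpa using hstep) (h1 0 (by omega))
      · intro _ x hx
        simp only [List.append_nil, hl1, Option.mem_def, Option.some.injEq] at hx
        subst hx
        exact ⟨by rw [hl4, hstep]; rfl, hl2⟩
    | some q =>
      have hlast : (T.front Z r i ++ (Z.back r i q.1 q.2 ++
          T.rowFrom Z r k (i + sgn (rowDir r)))).getLast? =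
          (T.rowFrom Z r k (i + sgn (rowDir r))).getLast? := by
        rw [List.getLast?_append, List.getLast?_append, List.getLast?_eq_some_getLast hne]
        rfl
      dsimp only
      rw [hlast]
      constructor
      · intro h1
        rw [hcast]
        exact ih1 fun j hj => by rw [← hcast]; exact h1 (j + 1) (by omega)
      · rintro ⟨j, hj, hj'⟩
        cases j with
        | zero => rw [Nat.cast_zero, mul_zero, add_zero, hstep] at hj'; cases hj'
        | succ j => exact ih2 ⟨j, by omega, by rw [← hcast]; exact hj'⟩

theorem IsValid.exists_none (hV : T.IsValid Z) {r : ℕ} (hr : T.Built r) (ha : ¬ T.alive r) :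
    ∃ j : ℕ, j < T.count r ∧ T.stepAt Z r (T.ini r + sgn (rowDir r) * j) = none := by
  rw [hV.alive_iff r hr] at ha
  push Not at ha
  obtain ⟨i, h1, h2, h3⟩ := ha
  obtain ⟨j, hj, rfl⟩ := exists_of_mem_row_range r i h1 h2
  exact ⟨j, hj, h3⟩

theorem IsValid.isChain_row (hV : T.IsValid Z) {W : Spot S Y → Prop} {r : ℕ} (hr : T.Built r)
    (hW : ∀ r', r = r' + 1 → T.Wrote Z W r') : (T.row Z r).IsChain (Z.Follows W) :=
  hV.isChain_rowFrom hr hW _ _ (mem_row_range r) (fun _ => ini_add_count r) (hV.exists_none hr)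

theorem IsValid.getLast?_row (hV : T.IsValid Z) {r : ℕ} (hr : T.Built r) (ha : T.alive r) :
    (T.row Z r).getLast? = some (.turn (T.st r (T.fin r)), r, Z.zone (rowDir r) (T.fin r)) := by
  rw [row, (hV.getLast?_rowFrom hr _ _ (mem_row_range r)).1, ini_add_count]
  intro j hj
  have := mem_row_range (T := T) r j hj
  exact (hV.alive_iff r hr).1 ha _ this.1 this.2

theorem IsValid.getLast?_row_of_not_alive (hV : T.IsValid Z) {r : ℕ} (hr : T.Built r)
    (ha : ¬ T.alive r) : ∀ x ∈ (T.row Z r).getLast?,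
      Z.next x.1 = none ∧ ∀ s p, x.1 ≠ .fork s p :=
  (hV.getLast?_rowFrom hr _ _ (mem_row_range r)).2 (hV.exists_none hr ha)

theorem IsValid.head?_row (hV : T.IsValid Z) {r : ℕ} (hr : T.Built r) :
    (T.row Z r).head? = some (Z.enter (T.st r (T.ini r)), r, Z.zone (rowDir r) (T.ini r)) :=
  hV.head?_rowFrom hr _ (mem_row_range r) fun h => by simp [count] at h

/-- The segments in a completed row. -/
theorem IsValid.mem_rowFrom (hV : T.IsValid Z) {r : ℕ} (hr : T.Built r) (k : ℕ) (i : ℤ)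
    (h : ∀ j : ℕ, j < k → lo r ≤ i + sgn (rowDir r) * j ∧ i + sgn (rowDir r) * j ≤ T.hi r)
    {x : Spot S Y} (hx : x ∈ T.rowFrom Z r k i) :
    (∃ j : ℕ, j < k ∧ (x ∈ T.front Z r (i + sgn (rowDir r) * j) ∨
      ∃ s, T.stepAt Z r (i + sgn (rowDir r) * j) = some (T.cont r (i + sgn (rowDir r) * j), s) ∧
        x ∈ Z.back r (i + sgn (rowDir r) * j) (T.cont r (i + sgn (rowDir r) * j)) s)) ∨
      x = (.turn (T.st r (i + sgn (rowDir r) * k)), r,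
        Z.zone (rowDir r) (i + sgn (rowDir r) * k)) := by
  induction k generalizing i with
  | zero => right; simpa [rowFrom] using hx
  | succ k ih =>
    have hi : lo r ≤ i ∧ i ≤ T.hi r := by simpa using h 0 (by omega)
    have hcast : ∀ j : ℕ, i + sgn (rowDir r) * ((j + 1 : ℕ) : ℤ) =
        i + sgn (rowDir r) + sgn (rowDir r) * j := by
      intro j; push_cast; ring
    rw [rowFrom, List.mem_append] at hx
    rcases hx with hx | hx
    · exact Or.inl ⟨0, by omega, Or.inl (by simpa using hx)⟩
    · cases hstep : T.stepAt Z r i with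
      | none => simp [hstep] at hx
      | some q =>
        obtain ⟨y, s⟩ := q
        simp only [hstep, List.mem_append] at hx
        obtain rfl := (hV.step r i y s hr hi.1 hi.2 hstep).1
        rcases hx with hx | hx
        · exact Or.inl ⟨0, by omega, Or.inr ⟨s, by simpa using hstep, by simpa using hx⟩⟩
        · rw [hcast]
          rcases ih (i + sgn (rowDir r)) (fun j hj => by
            rw [← hcast]; exact h (j + 1) (by omega)) hx with ⟨j, hj, h1⟩ | h1
          · refine Or.inl ⟨j + 1, by omega, ?_⟩
            rw [hcast]; exact h1
          · exact Or.inr h1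

theorem IsValid.mem_row (hV : T.IsValid Z) {r : ℕ} (hr : T.Built r) {x : Spot S Y}
    (hx : x ∈ T.row Z r) :
    (∃ i, lo r ≤ i ∧ i ≤ T.hi r ∧ (x ∈ T.front Z r i ∨
      ∃ s, T.stepAt Z r i = some (T.cont r i, s) ∧ x ∈ Z.back r i (T.cont r i) s)) ∨
      x = (.turn (T.st r (T.fin r)), r, Z.zone (rowDir r) (T.fin r)) := by
  rcases hV.mem_rowFrom hr _ _ (mem_row_range r) hx with ⟨j, hj, h⟩ | h
  · have := mem_row_range r j hj
    exact Or.inl ⟨_, this.1, this.2, h⟩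
  · rw [ini_add_count] at h
    exact Or.inr h

/-- The converse of `mem_row` needs a completed row: otherwise the path stops before it reaches the
later cells. -/
theorem IsValid.mem_row_of_alive (hV : T.IsValid Z) {r : ℕ} (hr : T.Built r) (ha : T.alive r)
    {x : Spot S Y} :
    x ∈ T.row Z r ↔ (∃ i, lo r ≤ i ∧ i ≤ T.hi r ∧ (x ∈ T.front Z r i ∨
      ∃ s, T.stepAt Z r i = some (T.cont r i, s) ∧ x ∈ Z.back r i (T.cont r i) s)) ∨
      x = (.turn (T.st r (T.fin r)), r, Z.zone (rowDir r) (T.fin r)) := by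
  refine ⟨hV.mem_row hr, ?_⟩
  have key : ∀ (k : ℕ) (i : ℤ),
      (∀ j : ℕ, j < k → lo r ≤ i + sgn (rowDir r) * j ∧ i + sgn (rowDir r) * j ≤ T.hi r) →
      (∀ j : ℕ, j < k → ∀ x, (x ∈ T.front Z r (i + sgn (rowDir r) * j) ∨
        ∃ s, T.stepAt Z r (i + sgn (rowDir r) * j) = some (T.cont r (i + sgn (rowDir r) * j), s) ∧
          x ∈ Z.back r (i + sgn (rowDir r) * j) (T.cont r (i + sgn (rowDir r) * j)) s) →
        x ∈ T.rowFrom Z r k i) ∧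
      (.turn (T.st r (i + sgn (rowDir r) * k)), r, Z.zone (rowDir r) (i + sgn (rowDir r) * k)) ∈
        T.rowFrom Z r k i := by
    intro k
    induction k with
    | zero => intro i _; simp [rowFrom]
    | succ k ih =>
      intro i h
      have hi : lo r ≤ i ∧ i ≤ T.hi r := by simpa using h 0 (by omega)
      have hcast : ∀ j : ℕ, i + sgn (rowDir r) * ((j + 1 : ℕ) : ℤ) =
          i + sgn (rowDir r) + sgn (rowDir r) * j := by
        intro j; push_cast; ring
      obtain ⟨ih1, ih2⟩ := ih (i + sgn (rowDir r)) fun j hj => by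
        rw [← hcast]; exact h (j + 1) (by omega)
      obtain ⟨q, hq⟩ := Option.ne_none_iff_exists'.1 ((hV.alive_iff r hr).1 ha i hi.1 hi.2)
      rw [rowFrom, hq]
      dsimp only
      refine ⟨fun j hj x hx => ?_, ?_⟩
      · cases j with
        | zero =>
          simp only [Nat.cast_zero, mul_zero, add_zero, hq] at hx
          rcases hx with hx | ⟨s, hs, hx⟩
          · simp [hx]
          · obtain rfl := Option.some.inj hs
            simp [hx]
        | succ j =>
          rw [hcast] at hx
          have := ih1 j (by omega) x hx
          simp [this]
      · rw [hcast]
        simp [ih2]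
  obtain ⟨h1, h2⟩ := key (T.count r) (T.ini r) (mem_row_range r)
  rintro (⟨i, hi1, hi2, hx⟩ | rfl)
  · obtain ⟨j, hj, rfl⟩ := exists_of_mem_row_range r i hi1 hi2
    exact h1 j hj x hx
  · rw [ini_add_count] at h2
    exact h2

end Tableau

end Zigzag

end Tableaux

end PolyTAM

/-! ### Rows do not overlap, and together they form a route -/

namespace PolyTAM

section TableauRoute

open Turing (Dir)

/-- A bound for the size of the parameters of a segment. -/
def Seg.Small {S Y : Type} (K : ℕ) : Seg S Y → Prop
  | .fork _ p => p.length ≤ K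
  | .sense _ p _ => p.length ≤ K
  | .pass _ n => n ≤ K
  | .write _ _ _ p => p.length ≤ K
  | .turn _ => True

namespace Zigzag

variable {S Y : Type} (Z : Zigzag S Y)

/-- The offset of the zone in which the `j`-th bit is read, from the left end of the cell. -/
def readOffset (d : Dir) (j : ℕ) : ℤ :=
  match d with
  | .right => j
  | .left => 2 * Z.size - 1 - j

/-- The offset of the zone in which the `j`-th bit is written, from the left end of the cell. -/
def writeOffset (d : Dir) (j : ℕ) : ℤ :=
  match d with
  | .right => Z.size + j
  | .left => Z.size - 1 - j

/-- The offset of the half of a cell in which a sweep reads. -/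
def half (d : Dir) : ℤ :=
  match d with
  | .right => 0
  | .left => Z.size

theorem zone_add_read (d : Dir) (i : ℤ) (j : ℕ) :
    Z.zone d i + sgn d * j = 2 * Z.size * i + Z.readOffset d j := by
  cases d <;> simp only [zone, sgn, readOffset] <;> ring

theorem zone_add_write (d : Dir) (i : ℤ) (j : ℕ) :
    Z.zone d i + sgn d * Z.size + sgn d * j = 2 * Z.size * i + Z.writeOffset d j := by
  cases d <;> simp only [zone, sgn, writeOffset] <;> ring

theorem half_bounds (d : Dir) : 0 ≤ Z.half d ∧ Z.half d + Z.size ≤ 2 * Z.size ∧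
    (Z.half d + Z.size ≤ Z.half (Piece.flip d) ∨ Z.half (Piece.flip d) + Z.size ≤ Z.half d) := by
  cases d <;> simp only [half, Piece.flip] <;> omega

theorem readOffset_bounds (d : Dir) {j : ℕ} (hj : j < Z.size) :
    Z.half d ≤ Z.readOffset d j ∧ Z.readOffset d j < Z.half d + Z.size := by
  cases d <;> simp only [half, readOffset] <;> omega

theorem writeOffset_bounds (d : Dir) {j : ℕ} (hj : j < Z.size) :
    Z.half (Piece.flip d) ≤ Z.writeOffset d j ∧
      Z.writeOffset d j < Z.half (Piece.flip d) + Z.size := by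
  cases d <;> simp only [half, writeOffset, Piece.flip] <;> omega

/-- The next sweep meets the written bits in reverse order, so the `k`-th one read stands above the
`(size - 1 - k)`-th one written. -/
theorem writeOffset_eq_iff (d : Dir) {j k : ℕ} :
    Z.writeOffset d j = Z.readOffset (Piece.flip d) k ↔ j + k + 1 = Z.size := by
  cases d <;> simp only [writeOffset, readOffset, Piece.flip] <;> omega

theorem getD_bits_flip (d : Dir) (y : Y) {j k : ℕ} (h : j + k + 1 = Z.size) :
    (Z.bits d y).getD j false = (Z.bits (Piece.flip d) y).getD k false := by
  have key : ∀ l : List Bool, ∀ j k, j + k + 1 = l.length →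
      l.getD j false = l.reverse.getD k false := by
    intro l j k h
    rw [List.getD_eq_getElem _ _ (by omega),
      List.getD_eq_getElem _ _ (by rw [List.length_reverse]; omega), List.getElem_reverse]
    congr 1
    omega
  have hlen := Z.length_code y
  cases d
  · simp only [bits, Piece.flip]
    rw [key _ k j (by omega)]
  · exact key _ j k (by simp only [bits] at *; omega)

/-- Uniqueness of division with remainder: a zone determines its cell and its offset. -/
theorem cell_unique {N i i' u u' : ℤ} (h0 : 0 ≤ u) (h1 : u < N) (h0' : 0 ≤ u') (h1' : u' < N)
    (h : N * i + u = N * i' + u') : i = i' ∧ u = u' := by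
  have hi : i = i' := by
    rcases lt_trichotomy i i' with hlt | heq | hlt
    · nlinarith
    · exact heq
    · nlinarith
  subst hi
  exact ⟨rfl, by linarith⟩

theorem segApart_of_ne {x y : Spot S Y} (h : x.2.2 ≠ y.2.2) : Z.SegApart x y := by
  intro l hl k hk
  left
  have h1 := Piece.pos_bounds _ l hl
  have h2 := Piece.pos_bounds _ k hk
  simp only [place, Spot.origin, Prod.fst_add]
  omega

theorem segApart_of_lt {x y : Spot S Y}
    (h : (Z.piece x.1).high + 25 * (x.2.1 : ℤ) < (Z.piece y.1).low + 25 * (y.2.1 : ℤ)) :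
    Z.SegApart x y := by
  intro l hl k hk
  right; left
  have h1 := Piece.pos_bounds _ l hl
  have h2 := Piece.pos_bounds _ k hk
  simp only [place, Spot.origin, Prod.snd_add]
  omega

theorem segApart_above {x y : Spot S Y} {g g' : Piece} (hz : x.2.2 = y.2.2)
    (hr : y.2.1 = x.2.1 + 1) (hg : Z.piece x.1 = g) (hg' : Z.piece y.1 = g')
    (h : ∀ l < g.len, ∀ k < g'.len, Piece.Apart (g.pos l) (g'.pos k + (0, 25))) :
    Z.SegApart x y := by
  subst hg hg'
  intro l hl k hk
  have : y.origin = (0, 25) + x.origin := by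
    simp only [Spot.origin, hr, hz, Prod.mk_add_mk, Prod.mk.injEq]
    push_cast
    constructor <;> ring
  simp only [place, this, ← add_assoc]
  rw [Piece.apart_add_iff]
  exact h l hl k hk

namespace Tableau

variable (T : Tableau S Y)

/-- A placed segment has the form of a segment of row `r` of the tableau. -/
def Within (r : ℕ) (x : Spot S Y) : Prop :=
  x.2.1 = r ∧ x.1.Small Z.size ∧
  ((∃ i, ∃ j : ℕ, lo r ≤ i ∧ i ≤ T.hi r ∧ j < Z.size ∧
      x.2.2 = 2 * Z.size * i + Z.readOffset (rowDir r) j ∧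
      (Z.piece x.1 = .fork (rowDir r) ∨ Z.piece x.1 = .pass (rowDir r) ∨
        Z.piece x.1 = .sense (rowDir r)
          ((Z.bits (rowDir r) (T.cont (r - 1) i)).getD j false))) ∨
    (∃ i, ∃ j : ℕ, ∃ s, lo r ≤ i ∧ i ≤ T.hi r ∧ j < Z.size ∧
      x.2.2 = 2 * Z.size * i + Z.writeOffset (rowDir r) j ∧
      x.1 = .write (rowDir r) (T.cont r i) s ((Z.bits (rowDir r) (T.cont r i)).drop j)) ∨
    Z.piece x.1 = .turn (rowDir r) ∧
      x.2.2 = 2 * Z.size * T.fin r + Z.readOffset (rowDir r) 0)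

variable {T Z}

theorem piece_write_drop (d : Dir) (y : Y) (s : S) (j : ℕ) :
    Z.piece (.write d y s ((Z.bits d y).drop j)) = .write d ((Z.bits d y).getD j false) := by
  simp [piece, List.headD_eq_head?_getD, List.getD_eq_getElem?_getD]

theorem mem_back {r : ℕ} {i : ℤ} {y : Y} {s : S} {x : Spot S Y} :
    x ∈ Z.back r i y s ↔ ∃ j : ℕ, j < Z.size ∧ x = (.write (rowDir r) y s
      ((Z.bits (rowDir r) y).drop j), r, 2 * Z.size * i + Z.writeOffset (rowDir r) j) := by
  simp only [Zigzag.back, writes, List.mem_map, List.mem_range, zone_add_write, eq_comm (a := x)]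

theorem IsValid.within (hV : T.IsValid Z) {r : ℕ} (hr : T.Built r) {x : Spot S Y}
    (hx : x ∈ T.row Z r) : T.Within Z r x := by
  rcases hV.mem_row hr hx with ⟨i, h1, h2, hx | ⟨s, -, hx⟩⟩ | rfl
  · have hd := hV.dir_st r i
    have hlen := Z.length_bits (rowDir r) (T.cont (r - 1) i)
    have hpass : x ∈ Z.passes (T.st r i) r (Z.zone (rowDir r) i) → T.Within Z r x := by
      intro hx
      obtain ⟨j, hj, rfl⟩ := List.mem_map.1 hx
      rw [List.mem_range] at hj
      refine ⟨rfl, hj.le, Or.inl ⟨i, j, h1, h2, hj, ?_, Or.inr (Or.inl ?_)⟩⟩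
      · rw [← zone_add_read, ← hd]
      · simp [piece, hd]
    unfold front at hx
    split at hx
    · simp only [reads, List.mem_flatten, List.mem_map, exists_exists_and_eq_and, List.mem_range,
        List.mem_cons, List.not_mem_nil, or_false, hd] at hx
      obtain ⟨j, hj, rfl | rfl⟩ := hx
      · refine ⟨rfl, ?_, Or.inl ⟨i, j, h1, h2, hj, ?_, Or.inl ?_⟩⟩
        · simp only [Seg.Small, List.length_take]; omega
        · rw [← zone_add_read]
        · simp [piece, hd]
      · refine ⟨rfl, ?_, Or.inl ⟨i, j, h1, h2, hj, ?_, Or.inr (Or.inr ?_)⟩⟩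
        · simp only [Seg.Small, List.length_take]; omega
        · rw [← zone_add_read]
        · simp [piece, hd]
    · exact hpass hx
  · obtain ⟨j, hj, rfl⟩ := mem_back.1 hx
    refine ⟨rfl, ?_, Or.inr (Or.inl ⟨i, j, s, h1, h2, hj, rfl, rfl⟩)⟩
    have hlen := Z.length_bits (rowDir r) (T.cont r i)
    simp only [Seg.Small, List.length_drop]; omega
  · refine ⟨rfl, trivial, Or.inr (Or.inr ⟨?_, ?_⟩)⟩
    · simp [piece, hV.dir_st]
    · rw [← zone_add_read]; simp

/-- The tower in which the path turns rises into the next row, so its column must be used by no cell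
of that row and not by the next turn. -/
theorem fin_not_mem (r : ℕ) : ¬ (lo (r + 1) ≤ T.fin r ∧ T.fin r ≤ T.hi (r + 1)) ∧
    T.fin r ≠ T.fin (r + 1) := by
  rcases T.rowDir_cases r with ⟨h, -, -, h1, -⟩ | ⟨h, -, -, h1, -⟩ <;>
    rcases T.rowDir_cases (r + 1) with ⟨h', -, -, h1', -⟩ | ⟨h', -, -, h1', -⟩ <;>
    (try omega) <;> rw [h1, h1'] <;> simp only [lo, hi] <;> push_cast <;> omega

/-- Only pieces in the same zone can collide. Two rows apart the heights suffice, since 28 < 50 -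
21. In adjacent rows the halves of the cells exclude reading over reading and writing over writing,
and a turn shares no zone with the row above it. Reading or passing segments lie over written bits,
and reading pieces fit into the outlines by the finite checks; the remaining pairs are separated by
height, as 23 < 25 - 1. -/
theorem segApart_of_within {r r' : ℕ} (hr : r < r') {x y : Spot S Y} (hx : T.Within Z r x)
    (hy : T.Within Z r' y) : Z.SegApart x y := by
  by_cases hz : x.2.2 = y.2.2
  swap
  · exact Z.segApart_of_ne hz
  obtain ⟨hxr, -, hx⟩ := hx
  obtain ⟨hyr, -, hy⟩ := hy
  by_cases hr2 : r + 2 ≤ r'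
  · refine Z.segApart_of_lt ?_
    have h1 : (Z.piece x.1).high ≤ 28 := by
      rcases Z.piece x.1 with d | ⟨d, b⟩ | d | ⟨d, b⟩ | d <;> simp [Piece.high]
    have h2 : -21 ≤ (Z.piece y.1).low := by
      rcases Z.piece y.1 with d | ⟨d, b⟩ | d | ⟨d, b⟩ | d <;> simp [Piece.low]
    omega
  obtain rfl : r' = r + 1 := by omega
  have hlt : ∀ {a b : ℤ}, (Z.piece x.1).high = a → (Z.piece y.1).low = b → a < b + 25 →
      Z.SegApart x y := by
    intro a b h1 h2 h3
    refine Z.segApart_of_lt ?_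
    rw [h1, h2, hxr, hyr]
    push_cast
    omega
  have hh := Z.half_bounds (rowDir r)
  have hh' := Z.half_bounds (rowDir (r + 1))
  rw [rowDir_succ] at hy hh'
  rw [flip_flip] at hh'
  rcases hx with ⟨i, j, hi1, hi2, hj, hxz, hxp⟩ | ⟨i, j, s, hi1, hi2, hj, hxz, hxp⟩ | ⟨hxp, hxz⟩
  · have hxo := Z.readOffset_bounds (rowDir r) hj
    have hhigh : (Z.piece x.1).high ≤ 23 := by
      rcases hxp with h | h | h <;> rw [h] <;> simp [Piece.high]
    rcases hy with ⟨i', j', hi1', hi2', hj', hyz, hyp⟩ | ⟨i', j', s', hi1', hi2', hj', hyz, hyp⟩ |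
      ⟨hyp, hyz⟩
    · exfalso
      have hyo := Z.readOffset_bounds (Piece.flip (rowDir r)) hj'
      have := cell_unique (by omega) (by omega) (by omega) (by omega) (hxz.symm.trans (hz.trans hyz))
      omega
    · have hlow : (Z.piece y.1).low = (Piece.write (rowDir r) false).low := by
        rw [hyp, piece_write_drop]; rfl
      refine hlt rfl hlow ?_
      simp only [Piece.low]
      omega
    · have hlow : (Z.piece y.1).low = (Piece.turn (rowDir r)).low := by rw [hyp]; rfl
      refine hlt rfl hlow ?_
      simp only [Piece.low]
      omega
  · have hxo := Z.writeOffset_bounds (rowDir r) hj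
    have hxp' : Z.piece x.1 = .write (rowDir r) ((Z.bits (rowDir r) (T.cont r i)).getD j false) := by
      rw [hxp, piece_write_drop]
    have hhigh : (Z.piece x.1).high = 23 := by rw [hxp']; rfl
    rcases hy with ⟨i', j', hi1', hi2', hj', hyz, hyp⟩ | ⟨i', j', s', hi1', hi2', hj', hyz, hyp⟩ |
      ⟨hyp, hyz⟩
    · have hyo := Z.readOffset_bounds (Piece.flip (rowDir r)) hj'
      obtain ⟨rfl, huu⟩ := cell_unique (by omega) (by omega) (by omega) (by omega)
        (hxz.symm.trans (hz.trans hyz))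
      have hjj := (Z.writeOffset_eq_iff _).1 huu
      rcases hyp with hyp | hyp | hyp
      · exact Z.segApart_above hz (by omega) hxp' hyp (Piece.apart_write_fork _ _)
      · refine hlt hhigh (congrArg Piece.low hyp) (by simp [Piece.low])
      -- The bit sensed is the bit written in this zone; `apart_write_sense` holds only for equal
      -- bits.
      · rw [Nat.add_sub_cancel, ← Z.getD_bits_flip _ _ hjj] at hyp
        exact Z.segApart_above hz (by omega) hxp' hyp (Piece.apart_write_sense _ _)
    · exfalso
      have hyo := Z.writeOffset_bounds (Piece.flip (rowDir r)) hj'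
      rw [flip_flip] at hyo
      have := cell_unique (by omega) (by omega) (by omega) (by omega) (hxz.symm.trans (hz.trans hyz))
      omega
    · refine hlt hhigh (congrArg Piece.low hyp) (by simp [Piece.low])
  · exfalso
    have hfin := T.fin_not_mem r
    have hxo := Z.readOffset_bounds (rowDir r) Z.size_pos
    rcases hy with ⟨i', j', hi1', hi2', hj', hyz, hyp⟩ | ⟨i', j', s', hi1', hi2', hj', hyz, hyp⟩ |
      ⟨hyp, hyz⟩
    · have hyo := Z.readOffset_bounds (Piece.flip (rowDir r)) hj'
      have := cell_unique (by omega) (by omega) (by omega) (by omega) (hxz.symm.trans (hz.trans hyz))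
      omega
    · have hyo := Z.writeOffset_bounds (Piece.flip (rowDir r)) hj'
      rw [flip_flip] at hyo
      have := cell_unique (by omega) (by omega) (by omega) (by omega) (hxz.symm.trans (hz.trans hyz))
      omega
    · have hyo := Z.readOffset_bounds (Piece.flip (rowDir r)) Z.size_pos
      have := cell_unique (by omega) (by omega) (by omega) (by omega) (hxz.symm.trans (hz.trans hyz))
      omega

/-- The order of the segments in a row. -/
def Prec (Z : Zigzag S Y) (d : Dir) (x y : Spot S Y) : Prop :=
  x.2.1 = y.2.1 ∧ (sgn d * x.2.2 < sgn d * y.2.2 ∨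
    x.2.2 = y.2.2 ∧ ∃ d b, Z.piece x.1 = .fork d ∧ Z.piece y.1 = .sense d b)

theorem Prec.trans {d : Dir} {x y z : Spot S Y} (h : Prec Z d x y) (h' : Prec Z d y z) :
    Prec Z d x z := by
  refine ⟨h.1.trans h'.1, ?_⟩
  rcases h.2 with h1 | ⟨h1, d₁, b₁, h2, h3⟩ <;> rcases h'.2 with h4 | ⟨h4, d₂, b₂, h5, h6⟩
  · exact Or.inl (h1.trans h4)
  · rw [← h4]; exact Or.inl h1
  · rw [h1]; exact Or.inl h4
  · rw [h3] at h5; cases h5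

theorem segApart_of_prec {d : Dir} {x y : Spot S Y} (h : Prec Z d x y) : Z.SegApart x y := by
  obtain ⟨hr, h | ⟨hz, d', b, h1, h2⟩⟩ := h
  · refine Z.segApart_of_ne fun h' => ?_
    rw [h'] at h
    exact lt_irrefl _ h
  · intro l hl k hk
    have : y.origin = x.origin := by simp only [Spot.origin, hr, hz]
    simp only [place, this]
    rw [Piece.apart_add_iff]
    rw [h1] at hl ⊢
    rw [h2] at hk ⊢
    exact Piece.apart_fork_sense d' b l hl k hk

/-- Along a row the zones advance strictly in the direction of the sweep, except from a fork to the
`sense` piece in the same zone. -/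
theorem prec_of_follows {W : Spot S Y → Prop} {r : ℕ} {x y : Spot S Y} (hx : T.Within Z r x)
    (hy : T.Within Z r y) (h : Z.Follows W x y) : Prec Z (rowDir r) x y := by
  obtain ⟨hxr, -, hx⟩ := hx
  refine ⟨hxr.trans hy.1.symm, ?_⟩
  rcases h with ⟨s, p, b, h1, h2, h3, -⟩ | ⟨τ, h1, -, -, h2⟩
  · exact Or.inr ⟨by rw [h3], Z.dir s, b, by rw [h1]; rfl, by rw [h2]; rfl⟩
  · left
    have hfst := congrArg Prod.fst h2
    have hsnd := congrArg Prod.snd h2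
    simp only [Spot.origin, Prod.fst_add, Prod.snd_add, hxr, hy.1] at hfst hsnd
    have hnf : ∀ d, Z.piece x.1 ≠ .fork d := by
      intro d hd
      obtain ⟨σ, xr⟩ := x
      cases σ <;> simp [piece] at hd
      simp [next] at h1
    have hshift : (Z.piece x.1).shift = (13 * sgn (rowDir r), 0) := by
      rcases hx with ⟨i, j, -, -, -, -, hp | hp | hp⟩ | ⟨i, j, s, -, -, -, -, hp⟩ | ⟨hp, -⟩
      · exact absurd hp (hnf _)
      · exact shift_eq (Or.inr (Or.inl hp))
      · exact shift_eq (Or.inl ⟨_, hp⟩)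
      · exact shift_eq (Or.inr (Or.inr ⟨_, by rw [hp, piece_write_drop]⟩))
      · exfalso
        rw [hp] at hsnd
        cases hrd : rowDir r <;> rw [hrd] at hsnd <;> simp [Piece.shift] at hsnd
    rw [hshift] at hfst
    dsimp only at hfst
    have : y.2.2 = x.2.2 + sgn (rowDir r) := by omega
    rw [this]
    cases rowDir r <;> simp [sgn]

/-- `Prec` is transitive, so it passes from consecutive segments to all pairs, and it implies that
the segments are apart. -/
theorem IsValid.pairwise_row (hV : T.IsValid Z) {r : ℕ} (hr : T.Built r) {W : Spot S Y → Prop}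
    (hc : (T.row Z r).IsChain (Z.Follows W)) : (T.row Z r).Pairwise Z.SegApart := by
  have : Trans (Prec Z (rowDir r)) (Prec Z (rowDir r)) (Prec Z (rowDir r)) :=
    ⟨fun h1 h2 => h1.trans h2⟩
  have h : (T.row Z r).IsChain (Prec Z (rowDir r)) :=
    hc.imp_of_mem_imp fun x y hx hy hxy => prec_of_follows (hV.within hr hx) (hV.within hr hy) hxy
  exact (List.isChain_iff_pairwise.1 h).imp segApart_of_prec

theorem IsValid.built_succ (hV : T.IsValid Z) {r : ℕ} (h : T.alive r) : T.Built (r + 1) := by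
  have : ∀ k n, n + k = r → T.alive n := by
    intro k
    induction k with
    | zero => rintro n rfl; exact h
    | succ k ih => intro n hn; exact hV.alive_of_succ n (ih (n + 1) (by omega))
  intro n hn
  exact this (r - n) n (by omega)

theorem Built.of_succ {r : ℕ} (h : T.Built (r + 1)) : T.Built r := fun n hn => h n (by omega)

theorem route_succ_of_alive {n : ℕ} (h : T.alive n) :
    T.route Z (n + 1) = T.route Z n ++ T.row Z (n + 1) := by
  rw [route, if_pos h]

theorem route_succ_of_not_alive {n : ℕ} (h : ¬ T.alive n) : T.route Z (n + 1) = T.route Z n := by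
  rw [route, if_neg h]

theorem mem_route_of_built {r : ℕ} (h : T.Built r) {x : Spot S Y} (hx : x ∈ T.row Z r) :
    x ∈ T.route Z r := by
  cases r with
  | zero => exact hx
  | succ r => rw [route_succ_of_alive (h r (by omega))]; simp [hx]

theorem IsValid.exists_mem_row (hV : T.IsValid Z) {n : ℕ} {x : Spot S Y} (hx : x ∈ T.route Z n) :
    ∃ r, r ≤ n ∧ T.Built r ∧ x ∈ T.row Z r := by
  induction n with
  | zero => exact ⟨0, le_rfl, fun n hn => by omega, hx⟩
  | succ n ih =>
    by_cases h : T.alive n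
    · rw [route_succ_of_alive h, List.mem_append] at hx
      rcases hx with hx | hx
      · obtain ⟨r, h1, h2⟩ := ih hx
        exact ⟨r, by omega, h2⟩
      · exact ⟨n + 1, le_rfl, hV.built_succ h, hx⟩
    · rw [route_succ_of_not_alive h] at hx
      obtain ⟨r, h1, h2⟩ := ih hx
      exact ⟨r, by omega, h2⟩

/-- In a completed row every cell has been written with the content given by the tableau. This is
what makes the forks of the next row take the right branch. -/
theorem IsValid.wrote (hV : T.IsValid Z) {r : ℕ} (ha : T.alive r) :
    T.Wrote Z (fun y => ∃ m, y ∈ T.route Z m) r := by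
  have hr := (hV.built_succ ha).of_succ
  intro i h1 h2 j hj
  obtain ⟨⟨y, s⟩, hq⟩ := Option.ne_none_iff_exists'.1 ((hV.alive_iff r hr).1 ha i h1 h2)
  obtain rfl := (hV.step r i y s hr h1 h2 hq).1
  have hjj : (Z.size - 1 - j) + j + 1 = Z.size := by omega
  refine ⟨(.write (rowDir r) (T.cont r i) s ((Z.bits (rowDir r) (T.cont r i)).drop
    (Z.size - 1 - j)), r, 2 * Z.size * i + Z.writeOffset (rowDir r) (Z.size - 1 - j)),
    ⟨r, mem_route_of_built hr ((hV.mem_row_of_alive hr ha).2 (Or.inl ⟨i, h1, h2, Or.inr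
      ⟨s, hq, mem_back.2 ⟨_, by omega, rfl⟩⟩⟩))⟩, ?_, rfl, ?_⟩
  · rw [piece_write_drop, Z.getD_bits_flip _ _ hjj]
  · rw [zone_add_read, ← (Z.writeOffset_eq_iff (rowDir r)).2 hjj]

theorem IsValid.isChain_row' (hV : T.IsValid Z) {r : ℕ} (hr : T.Built r) :
    (T.row Z r).IsChain (Z.Follows fun y => ∃ m, y ∈ T.route Z m) := by
  refine hV.isChain_row hr ?_
  rintro r' rfl
  exact hV.wrote (hr r' (by omega))

theorem IsValid.getLast?_route (hV : T.IsValid Z) {n : ℕ} (ha : T.alive n) :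
    (T.route Z n).getLast? = (T.row Z n).getLast? := by
  cases n with
  | zero => rfl
  | succ n =>
    rw [route_succ_of_alive (hV.alive_of_succ n ha), List.getLast?_append,
      hV.getLast?_row ((hV.built_succ ha).of_succ) ha]
    rfl

/-- The path of a zigzag automaton with a valid tableau. -/
theorem IsValid.isRoute (hV : T.IsValid Z) : Z.IsRoute (T.route Z) where
  mono n := by
    by_cases h : T.alive n
    · rw [route_succ_of_alive h]; exact List.prefix_append _ _
    · rw [route_succ_of_not_alive h]
  head := by
    have h0 : T.Built 0 := fun n hn => by omega
    have h := hV.head?_row h0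
    have hini : T.ini 0 = -1 := by simp [ini, lo]
    obtain ⟨y, s, hop⟩ := hV.op_zero (-1) (by simp [lo]) (by simp [hi])
    refine ⟨_, _, List.eq_cons_of_mem_head? h, ?_⟩
    dsimp only
    rw [hini]
    rw [hV.st_first] at hop ⊢
    simp [enter, hop]
  chain n := by
    induction n with
    | zero => exact hV.isChain_row' fun n hn => by omega
    | succ n ih =>
      by_cases h : T.alive n
      · rw [route_succ_of_alive h]
        have hb := hV.built_succ h
        refine ih.append (hV.isChain_row' hb) ?_
        rw [hV.getLast?_route h, hV.getLast?_row hb.of_succ h, hV.head?_row hb]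
        simp only [Option.mem_def, Option.some.injEq]
        rintro _ rfl _ rfl
        have hs := hV.st_ne_first (n + 1) (T.ini (n + 1)) (by omega)
        have hd := hV.dir_st (n + 1) (T.ini (n + 1))
        refine Or.inr ⟨Z.enter (T.st (n + 1) (T.ini (n + 1))), ?_, rfl, fun _ => ⟨rfl, ?_⟩, ?_⟩
        · simp only [next, hV.op_fin n h]
          exact if_pos ⟨by rw [hd, rowDir_succ, hV.dir_st], hs⟩
        · intro τ'
          refine label_inj fun s₁ h₁ s₂ h₂ => ?_
          obtain rfl : T.st (n + 1) (T.ini (n + 1)) = s₁ := by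
            unfold enter at h₁
            split at h₁ <;> simp_all
          exact hV.link_st _ _ _ (by omega) h₂
        · simp only [Spot.origin, piece, hV.dir_st]
          rcases T.rowDir_cases n with ⟨h', h1, -, h2, -⟩ | ⟨h', h1, -, h2, -⟩ <;>
            rcases T.rowDir_cases (n + 1) with ⟨h'', h3, h4, -, -⟩ | ⟨h'', h3, h4, -, -⟩ <;>
            (try omega) <;> rw [h1, h3, h2, h4]
          -- The tower of a turn stands in the zone just beyond the row. One zone back is the first
          -- zone of the next row, which begins in the cell where this row ended.
          · have : T.hi (n + 1) = T.hi n := by simp only [hi]; push_cast; omega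
            rw [this]
            simp only [zone, Piece.shift, Prod.mk_add_mk, Prod.mk.injEq]
            push_cast
            constructor <;> ring
          · have : lo (n + 1) = lo n := by simp only [lo]; push_cast; omega
            rw [this]
            simp only [zone, Piece.shift, Prod.mk_add_mk, Prod.mk.injEq]
            push_cast
            constructor <;> ring
      · rw [route_succ_of_not_alive h]; exact ih
  apart n := by
    induction n with
    | zero =>
      have h0 : T.Built 0 := fun n hn => by omega
      exact hV.pairwise_row h0 (hV.isChain_row' h0)
    | succ n ih =>
      by_cases h : T.alive n
      · rw [route_succ_of_alive h]
        have hb := hV.built_succ h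
        rw [List.pairwise_append]
        refine ⟨ih, hV.pairwise_row hb (hV.isChain_row' hb), fun x hx y hy => ?_⟩
        obtain ⟨r, hrn, hr, hx⟩ := hV.exists_mem_row hx
        exact segApart_of_within (by omega) (hV.within hr hx) (hV.within hb hy)
      · rw [route_succ_of_not_alive h]; exact ih
  next_last n hn := by
    have ha : ¬ T.alive n := by
      intro h
      rw [route_succ_of_alive h] at hn
      have := hV.head?_row (hV.built_succ h)
      rw [List.append_right_eq_self.1 hn] at this
      cases this
    clear hn
    induction n with
    | zero => exact hV.getLast?_row_of_not_alive (fun n hn => by omega) ha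
    | succ n ih =>
      by_cases h : T.alive n
      · have hb := hV.built_succ h
        rw [route_succ_of_alive h, List.getLast?_append]
        have h1 := hV.getLast?_row_of_not_alive hb ha
        have h2 := hV.head?_row hb
        cases hl : (T.row Z (n + 1)).getLast? with
        | none =>
          rw [List.getLast?_eq_none_iff.1 hl] at h2
          cases h2
        | some x =>
          rw [hl] at h1
          exact h1
      · rw [route_succ_of_not_alive h]; exact ih h
  row_pos n := by
    have key : ∃ t, T.route Z n = T.route Z 0 ++ t ∧ ∀ x ∈ t, 0 < x.2.1 := by
      induction n with
      | zero => exact ⟨[], by simp, by simp⟩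
      | succ n ih =>
        obtain ⟨t, h1, h2⟩ := ih
        by_cases h : T.alive n
        · rw [route_succ_of_alive h]
          refine ⟨t ++ T.row Z (n + 1), by rw [h1, List.append_assoc], fun x hx => ?_⟩
          rcases List.mem_append.1 hx with hx | hx
          · exact h2 x hx
          · rw [(hV.within (hV.built_succ h) hx).1]; omega
        · rw [route_succ_of_not_alive h]; exact ⟨t, h1, h2⟩
    obtain ⟨t, h1, h2⟩ := key
    intro t' ht'
    rw [h1, List.append_cancel_left_eq] at ht'
    rw [← ht']
    exact h2

end Tableau

end Zigzag

end TableauRoute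

end PolyTAM

namespace PolyTAM

section TuringMachines

open Turing (Dir)

/-! ### Turing machines as zigzag automata -/

variable {Q Γ : Type}

/-- The tape symbols of the zigzag automaton of a Turing machine: `none` marks the ends of a row,
and a state comes with `true` if the head has still to move to the right. -/
abbrev Sym (Q Γ : Type) := Option (Γ × Option (Q × Bool))

/-- The states of the zigzag automaton of a Turing machine. -/
inductive Ctl (Q Γ : Type)
  | first
  | seed (c : Γ × Option Q)
  | seedEnd
  | start (d : Dir)
  | scan (d : Dir) (κ : Option Q)
  | fin (d : Dir)
  | turn (d : Dir)

instance : Finite Dir :=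
  Finite.of_injective (fun d : Dir => match d with | .left => false | .right => true)
    (by rintro (_ | _) (_ | _) h <;> simp_all)

instance [Finite Q] [Finite Γ] : Finite (Ctl Q Γ) := by
  let f : Ctl Q Γ → Bool ⊕ (Γ × Option Q) ⊕ Dir ⊕ (Dir × Option Q) ⊕ Dir ⊕ Dir := fun s =>
    match s with
    | .first => .inl false
    | .seedEnd => .inl true
    | .seed c => .inr (.inl c)
    | .start d => .inr (.inr (.inl d))
    | .scan d κ => .inr (.inr (.inr (.inl (d, κ))))
    | .fin d => .inr (.inr (.inr (.inr (.inl d))))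
    | .turn d => .inr (.inr (.inr (.inr (.inr d))))
  refine Finite.of_injective f ?_
  rintro (_ | _ | _ | _ | ⟨_, _⟩ | _ | _) (_ | _ | _ | _ | ⟨_, _⟩ | _ | _) h <;> simp_all [f]

/-- The content of a cell as a symbol. -/
def sym (c : Γ × Option Q) : Γ × Option (Q × Bool) := (c.1, c.2.map (·, false))

namespace Ctl

/-- What is written above a symbol in a sweep to the left, and the next state. -/
def scanLeft (M : StdTM.Machine Q Γ) (κ : Option Q) : Sym Q Γ → Option (Sym Q Γ × Ctl Q Γ)
  | none => some (some (sym (M.blank, κ)), .fin .left)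
  | some (γ, none) => some (some (sym (γ, κ)), .scan .left none)
  | some (γ, some (q, _)) =>
    match M.δ q γ with
    | none => none
    | some (q', γ', .left) => some (some (γ', none), .scan .left (some q'))
    | some (q', γ', .right) => some (some (γ', some (q', true)), .scan .left none)

/-- What is written above a symbol in a sweep to the right, and the next state. -/
def scanRight (M : StdTM.Machine Q Γ) (κ : Option Q) : Sym Q Γ → Option (Sym Q Γ × Ctl Q Γ)
  | none => some (some (sym (M.blank, κ)), .fin .right)
  | some (γ, none) => some (some (sym (γ, κ)), .scan .right none)
  | some (γ, some (q, false)) => some (some (γ, some (q, false)), .scan .right none)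
  | some (γ, some (q, true)) => some (some (γ, none), .scan .right (some q))

/-- The action of the automaton in a given state. -/
def op (M : StdTM.Machine Q Γ) : Ctl Q Γ → Op (Ctl Q Γ) (Sym Q Γ)
  | .first => .write none (.seed (M.blank, none))
  | .seed c => .write (some (sym c)) (.seed (M.blank, none))
  | .seedEnd => .write none (.turn .right)
  | .start d => .readWrite fun _ => some (none, .scan d none)
  | .scan .left κ => .readWrite (scanLeft M κ)
  | .scan .right κ => .readWrite (scanRight M κ)
  | .fin d => .write none (.turn d)
  | .turn d => .turn (.start (Piece.flip d))

/-- The direction in which the automaton moves. -/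
def dir : Ctl Q Γ → Dir
  | .first | .seed _ | .seedEnd => .right
  | .start d | .scan d _ | .fin d | .turn d => d

/-- The state that represents all those entered from the same states. -/
def link (M : StdTM.Machine Q Γ) : Ctl Q Γ → Ctl Q Γ
  | .seed _ | .seedEnd => .seed (M.blank, none)
  | s => s

end Ctl

/-- The words of length `Nat.card Y` with a single `true`, as a code for `Y`. -/
noncomputable def unary {Y : Type} [Finite Y] (y : Y) : List Bool :=
  List.ofFn fun k : Fin (Nat.card Y) => decide (Finite.equivFin Y y = k)

theorem unary_injective {Y : Type} [Finite Y] : Function.Injective (unary (Y := Y)) := by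
  intro y y' h
  have := congrFun (List.ofFn_injective h) (Finite.equivFin Y y)
  simp only [decide_true, true_eq_decide_iff, EmbeddingLike.apply_eq_iff_eq] at this
  exact this.symm

/-- The zigzag automaton of a Turing machine. It takes one sweep to the left and one sweep to the
right for each step of the machine. -/
noncomputable def zigzag [Finite Q] [Finite Γ] (M : StdTM.Machine Q Γ) :
    Zigzag (Ctl Q Γ) (Sym Q Γ) where
  dir := Ctl.dir
  op := Ctl.op M
  link := Ctl.link M
  first := .first
  code := unary
  size := Nat.card (Sym Q Γ)
  size_pos := Nat.card_pos
  length_code y := by simp [unary]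
  code_injective := unary_injective
  dir_link s := by cases s <;> rfl
  link_first s h := by cases s <;> simp_all [Ctl.link]

/-! ### The tableau of a computation -/

variable (M : StdTM.Machine Q Γ)

/-- The state in which the head arrives at a cell by a move in the given direction. -/
def arriving (d : Dir) (C : StdTM.Cfg Q Γ) (i : ℤ) : Option Q :=
  match M.δ C.state (C.tape C.head) with
  | none => none
  | some (q, _, d') => if d' = d ∧ i = C.head + sgn d then some q else none

/-- The content of a cell after the first half of a step of the machine, in which only moves to the
left are carried out. -/
def halfStep (C : StdTM.Cfg Q Γ) (i : ℤ) : Γ × Option (Q × Bool) :=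
  match M.δ C.state (C.tape C.head) with
  | none => sym (C.cell i)
  | some (q, γ, .left) =>
    (Function.update C.tape C.head γ i, if i = C.head - 1 then some (q, false) else none)
  | some (q, γ, .right) =>
    (Function.update C.tape C.head γ i, if i = C.head then some (q, true) else none)

/-- The configuration at a given time, or the initial one if the machine has halted. -/
def cfg (w : List Γ) (n : ℕ) : StdTM.Cfg Q Γ := (M.run w n).getD (M.init w)

open Zigzag.Tableau (lo)

/-- The contents of the rows for the computation on input `w`. -/
def rowContent (w : List Γ) (r : ℕ) (i : ℤ) : Sym Q Γ :=
  if i ≤ lo r ∨ (w.length + 1 : ℕ) + (r : ℤ) / 2 ≤ i then none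
  else if r % 2 = 0 then some (sym ((cfg M w (r / 2)).cell i))
  else some (halfStep M (cfg M w (r / 2)) i)

/-- The states of the automaton in the first row. -/
def seedState (w : List Γ) (i : ℤ) : Ctl Q Γ :=
  if i = -1 then .first
  else if i = w.length + 1 then .seedEnd
  else if i = w.length + 2 then .turn .right
  else .seed ((M.init w).cell i)

/-- The states of the automaton in the row after row `r`. -/
def rowState (w : List Γ) (r : ℕ) (i : ℤ) : Ctl Q Γ :=
  if lo r ≤ i ∧ i ≤ (w.length + 1 : ℕ) + (r : ℤ) / 2 then
    if i = (if r % 2 = 0 then (w.length + 1 : ℕ) + (r : ℤ) / 2 else lo r) then .start (rowDir (r + 1))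
    else .scan (rowDir (r + 1)) (arriving M (rowDir (r + 1)) (cfg M w (r / 2)) i)
  else if lo (r + 1) ≤ i ∧ i ≤ (w.length + 1 : ℕ) + ((r + 1 : ℕ) : ℤ) / 2 then .fin (rowDir (r + 1))
  else .turn (rowDir (r + 1))

/-- The tableau of the computation on input `w`. -/
def tableau (w : List Γ) : Zigzag.Tableau (Ctl Q Γ) (Sym Q Γ) where
  width := w.length + 1
  cont := rowContent M w
  st
    | 0 => seedState M w
    | r + 1 => rowState M w r
  alive r := (M.run w ((r + 1) / 2)).isSome

variable {M}

/-! ### Runs, and the part of the tape they use -/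

theorem run_eq_cfg {w : List Γ} {n : ℕ} (h : (M.run w n).isSome) : M.run w n = some (cfg M w n) := by
  obtain ⟨C, hC⟩ := Option.isSome_iff_exists.1 h
  simp [cfg, hC]

theorem isSome_run_of_succ {w : List Γ} {n : ℕ} (h : (M.run w (n + 1)).isSome) :
    (M.run w n).isSome := by
  cases h' : M.run w n
  · simp [StdTM.Machine.run, h'] at h
  · rfl

theorem isSome_run_succ_iff {w : List Γ} {n : ℕ} (h : (M.run w n).isSome) :
    (M.run w (n + 1)).isSome ↔
      M.δ (cfg M w n).state ((cfg M w n).tape (cfg M w n).head) ≠ none := by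
  rw [StdTM.Machine.run, run_eq_cfg h]
  simp [StdTM.Machine.next, Option.isSome_iff_ne_none]

theorem cfg_succ {w : List Γ} {n : ℕ} (h : (M.run w n).isSome) {q : Q} {γ : Γ} {d : Dir}
    (hδ : M.δ (cfg M w n).state ((cfg M w n).tape (cfg M w n).head) = some (q, γ, d)) :
    cfg M w (n + 1) = ⟨q, (cfg M w n).head + sgn d,
      Function.update (cfg M w n).tape (cfg M w n).head γ⟩ := by
  have : M.run w (n + 1) = M.next (cfg M w n) := by
    rw [StdTM.Machine.run, run_eq_cfg h]; rfl
  rw [cfg, this, StdTM.Machine.next, hδ]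
  cases d <;> rfl

/-- The head moves by at most one cell in each step, and the rest of the tape is blank. -/
theorem cfg_bounds {w : List Γ} {n : ℕ} (h : (M.run w n).isSome) :
    -(n : ℤ) ≤ (cfg M w n).head ∧ (cfg M w n).head ≤ n ∧
      ∀ i : ℤ, (i ≤ -1 - n ∨ w.length + 1 + n ≤ i) → (cfg M w n).tape i = M.blank := by
  induction n with
  | zero =>
    refine ⟨by simp [cfg, StdTM.Machine.run, StdTM.Machine.init],
      by simp [cfg, StdTM.Machine.run, StdTM.Machine.init], fun i hi => ?_⟩
    simp only [cfg, StdTM.Machine.run, StdTM.Machine.init, Option.getD_some]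
    split_ifs with h0
    · exact List.getD_eq_default _ _ (by omega)
    · rfl
  | succ n ih =>
    have h' := isSome_run_of_succ h
    obtain ⟨h1, h2, h3⟩ := ih h'
    obtain ⟨⟨q, γ, d⟩, hδ⟩ := Option.ne_none_iff_exists'.1 ((isSome_run_succ_iff h').1 h)
    rw [cfg_succ h' hδ]
    push_cast
    refine ⟨?_, ?_, fun i hi => ?_⟩
    · cases d <;> simp only [sgn] <;> omega
    · cases d <;> simp only [sgn] <;> omega
    · rw [Function.update_of_ne (by omega)]
      exact h3 i (by omega)

/-! ### The two sweeps of a machine step, cell by cell -/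

section Sweeps

variable {C : StdTM.Cfg Q Γ} {i : ℤ}

theorem arriving_of_ne {d : Dir} (h : i ≠ C.head + sgn d) : arriving M d C i = none := by
  unfold arriving
  split
  · rfl
  · simp [h]

/-- The old end marker stands for a blank cell. It is replaced by the content of that cell, possibly
with an arriving head, and state `.fin` puts a new marker one cell further out. -/
theorem scanLeft_none (hi : i ≠ C.head) (ht : C.tape i = M.blank) :
    Ctl.scanLeft M (arriving M .left C i) none = some (some (halfStep M C i), .fin .left) := by
  simp only [Ctl.scanLeft, arriving, halfStep, StdTM.Cfg.cell, sym]
  rcases M.δ C.state (C.tape C.head) with _ | ⟨q, γ, _ | _⟩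
  · simp [hi, ht]
  · by_cases h : i = C.head - 1 <;> simp [h, hi, ht, sgn, ← sub_eq_add_neg]
    simpa [h] using ht.symm
  · simp [hi, ht]

theorem scanLeft_halted (hδ : M.δ C.state (C.tape C.head) = none) (κ : Option Q) :
    Ctl.scanLeft M κ (some (sym (C.cell C.head))) = none := by
  simp [Ctl.scanLeft, StdTM.Cfg.cell, sym, hδ]

theorem scanLeft_some (h : ¬ (i = C.head ∧ M.δ C.state (C.tape C.head) = none)) :
    Ctl.scanLeft M (arriving M .left C i) (some (sym (C.cell i))) =
      some (some (halfStep M C i), .scan .left (arriving M .left C (i - 1))) := by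
  simp only [arriving, halfStep, StdTM.Cfg.cell, sym]
  by_cases hi : i = C.head
  · subst hi
    rcases hδ : M.δ C.state (C.tape C.head) with _ | ⟨q, γ, _ | _⟩
    · simp [hδ] at h
    · simp [Ctl.scanLeft, hδ, sgn, ← sub_eq_add_neg, show C.head ≠ C.head - 1 by omega]
    · simp [Ctl.scanLeft, hδ]
  · rcases M.δ C.state (C.tape C.head) with _ | ⟨q, γ, _ | _⟩
    · simp [Ctl.scanLeft, hi, sym]
    · have h1 : i - 1 ≠ C.head - 1 := by omega
      by_cases h : i = C.head - 1 <;> simp [Ctl.scanLeft, h, hi, sym, sgn, ← sub_eq_add_neg]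
    · simp [Ctl.scanLeft, hi, sym]

variable {q : Q} {γ : Γ} {d : Dir}

theorem scanRight_none (hδ : M.δ C.state (C.tape C.head) = some (q, γ, d)) (hi : C.head < i)
    (ht : C.tape i = M.blank) : Ctl.scanRight M (arriving M .right C i) none =
      some (some (sym (StdTM.Cfg.cell ⟨q, C.head + sgn d, Function.update C.tape C.head γ⟩ i)),
        .fin .right) := by
  have h1 : i ≠ C.head := by omega
  have h2 : i ≠ C.head - 1 := by omega
  simp only [Ctl.scanRight, arriving, StdTM.Cfg.cell, sym, hδ]
  rcases d with _ | _
  · simp [h1, h2, ht, sgn, ← sub_eq_add_neg]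
  · by_cases h : i = C.head + 1 <;> simp [h1, ht, sgn, h]; simp_all

/-- A marked head is lifted from its cell and set down in the next one, which completes the move to
the right; every other head is copied. -/
theorem scanRight_some (hδ : M.δ C.state (C.tape C.head) = some (q, γ, d)) :
    Ctl.scanRight M (arriving M .right C i) (some (halfStep M C i)) =
      some (some (sym (StdTM.Cfg.cell ⟨q, C.head + sgn d, Function.update C.tape C.head γ⟩ i)),
        .scan .right (arriving M .right C (i + 1))) := by
  simp only [arriving, halfStep, StdTM.Cfg.cell, sym, hδ]
  rcases d with _ | _
  · by_cases h : i = C.head - 1 <;> simp [Ctl.scanRight, h, sgn, sym, ← sub_eq_add_neg]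
  · by_cases h : i = C.head
    · simp [Ctl.scanRight, h, sgn]
    · by_cases h' : i = C.head + 1 <;> simp [Ctl.scanRight, h, h', sgn, sym]

end Sweeps

theorem tableau_st_zero (w : List Γ) (i : ℤ) : (tableau M w).st 0 i = seedState M w i := rfl

theorem tableau_st_succ (w : List Γ) (r : ℕ) (i : ℤ) :
    (tableau M w).st (r + 1) i = rowState M w r i := rfl

theorem tableau_hi (w : List Γ) (r : ℕ) :
    (tableau M w).hi r = (w.length + 1 : ℕ) + (r : ℤ) / 2 := rfl

theorem rowState_cases (w : List Γ) (r : ℕ) (i : ℤ) :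
    rowState M w r i = .start (rowDir (r + 1)) ∨ (∃ κ, rowState M w r i = .scan (rowDir (r + 1)) κ) ∨
      rowState M w r i = .fin (rowDir (r + 1)) ∨ rowState M w r i = .turn (rowDir (r + 1)) := by
  unfold rowState
  split_ifs <;> simp

theorem seedState_cases (w : List Γ) (i : ℤ) : seedState M w i = .first ∨
    seedState M w i = .seedEnd ∨ seedState M w i = .turn .right ∨ ∃ c, seedState M w i = .seed c := by
  unfold seedState
  split_ifs <;> simp

theorem isSome_run_of_built {w : List Γ} {r : ℕ} (h : (tableau M w).Built r) : (M.run w (r / 2)).isSome := by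
  cases r with
  | zero => rfl
  | succ r => exact h r (by omega)

/-! ### The tableau is the one the automaton produces -/

section Steps

variable [Finite Q] [Finite Γ] {w : List Γ}

open Zigzag.Tableau (hi fin ini)

/-- Row `2 * n + 1` reads the configuration at time `n`. The sweep gets stuck only at the head, and
only if the machine halts there. -/
theorem stepAt_left {n : ℕ} (h : (M.run w n).isSome) {i : ℤ} (h1 : lo (2 * n + 1) ≤ i)
    (h2 : i ≤ (tableau M w).hi (2 * n + 1)) :
    (tableau M w).stepAt (zigzag M) (2 * n + 1) i =
      if i = (cfg M w n).head ∧
          M.δ (cfg M w n).state ((cfg M w n).tape (cfg M w n).head) = none then none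
      else some (rowContent M w (2 * n + 1) i, rowState M w (2 * n) (i - 1)) := by
  obtain ⟨b1, b2, b3⟩ := cfg_bounds h
  have hd : rowDir (2 * n + 1) = .left := by unfold rowDir; rw [if_neg (by omega)]
  have e1 : (2 * n + 1) / 2 = n := by omega
  have e2 : 2 * n / 2 = n := by omega
  simp only [hi, tableau, lo] at h1 h2
  push_cast at h1 h2
  simp only [Zigzag.Tableau.stepAt, tableau, zigzag, Nat.add_sub_cancel]
  have hst : ∀ j, rowState M w (2 * n) j =
      if -1 - (n : ℤ) ≤ j ∧ j ≤ w.length + 1 + n then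
        if j = w.length + 1 + n then .start .left
        else .scan .left (arriving M .left (cfg M w n) j)
      else if -2 - (n : ℤ) ≤ j ∧ j ≤ w.length + 1 + n then .fin .left else .turn .left := by
    intro j
    simp only [rowState, hd, e2, lo]
    push_cast
    rw [show (2 * (n : ℤ) + 1) / 2 = n by omega, show 2 * (n : ℤ) / 2 = n by omega,
      show (2 * (n : ℤ) + 1 + 1) / 2 = n + 1 by omega, if_pos (show 2 * n % 2 = 0 by omega),
      show -1 - ((n : ℤ) + 1) = -2 - n by ring]
  have hc0 : rowContent M w (2 * n) i = if i ≤ -1 - (n : ℤ) ∨ w.length + 1 + n ≤ i then none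
      else some (sym ((cfg M w n).cell i)) := by
    simp only [rowContent, e2, lo]
    push_cast
    rw [show (2 * (n : ℤ) + 1) / 2 = n by omega, show 2 * (n : ℤ) / 2 = n by omega]
    rw [if_pos (show (2 * n) % 2 = 0 by omega)]
  have hc1 : rowContent M w (2 * n + 1) i = if i ≤ -2 - (n : ℤ) ∨ w.length + 1 + n ≤ i then none
      else some (halfStep M (cfg M w n) i) := by
    simp only [rowContent, e1, lo]
    push_cast
    rw [show (2 * (n : ℤ) + 1) / 2 = n by omega, show (2 * (n : ℤ) + 1 + 1) / 2 = n + 1 by omega,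
      show -1 - ((n : ℤ) + 1) = -2 - n by ring, if_neg (show ¬ (2 * n + 1) % 2 = 0 by omega)]
  rw [hst i, hst (i - 1), hc0, hc1]
  clear hst hc0 hc1
  -- Five cases survive: the starting cell, the old left marker, the head of a halted machine, an
  -- ordinary cell, and the new left marker.
  split_ifs <;> first | omega | skip
  · rw [arriving_of_ne (by simp only [sgn]; omega)]; rfl
  · exact scanLeft_none (by omega) (b3 i (by omega))
  · have hh := ‹i = (cfg M w n).head ∧ _›
    rw [hh.1]
    exact scanLeft_halted hh.2 _
  · exact scanLeft_some (by assumption)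
  · rfl

/-- Row `2 * n + 2` turns the half-step into the configuration at time `n + 1`. The machine has
already been found to make this step, so the sweep is never stuck. -/
theorem stepAt_right {n : ℕ} (h : (M.run w (n + 1)).isSome) {i : ℤ} (h1 : lo (2 * n + 2) ≤ i)
    (h2 : i ≤ (tableau M w).hi (2 * n + 2)) :
    (tableau M w).stepAt (zigzag M) (2 * n + 2) i =
      some (rowContent M w (2 * n + 2) i, rowState M w (2 * n + 1) (i + 1)) := by
  have h' := isSome_run_of_succ h
  obtain ⟨b1, b2, b3⟩ := cfg_bounds h'
  obtain ⟨⟨q, γ, d⟩, hδ⟩ := Option.ne_none_iff_exists'.1 ((isSome_run_succ_iff h').1 h)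
  have hC := cfg_succ h' hδ
  have hd : rowDir (2 * n + 1 + 1) = .right := by unfold rowDir; rw [if_pos (by omega)]
  have e1 : (2 * n + 1) / 2 = n := by omega
  have e2 : (2 * n + 2) / 2 = n + 1 := by omega
  simp only [hi, tableau, lo] at h1 h2
  push_cast at h1 h2
  simp only [Zigzag.Tableau.stepAt, tableau, zigzag, show 2 * n + 2 - 1 = 2 * n + 1 from rfl]
  have hst : ∀ j, rowState M w (2 * n + 1) j =
      if -2 - (n : ℤ) ≤ j ∧ j ≤ w.length + 1 + n then
        if j = -2 - n then .start .right
        else .scan .right (arriving M .right (cfg M w n) j)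
      else if -2 - (n : ℤ) ≤ j ∧ j ≤ w.length + 2 + n then .fin .right else .turn .right := by
    intro j
    simp only [rowState, hd, e1, lo]
    push_cast
    rw [show (2 * (n : ℤ) + 1) / 2 = n by omega, show (2 * (n : ℤ) + 1 + 1 + 1) / 2 = n + 1 by omega,
      show (2 * (n : ℤ) + 1 + 1) / 2 = n + 1 by omega, if_neg (show ¬ (2 * n + 1) % 2 = 0 by omega),
      show -1 - ((n : ℤ) + 1) = -2 - n by ring,
      show (w.length : ℤ) + 1 + (n + 1) = w.length + 2 + n by ring]
  have hc0 : rowContent M w (2 * n + 1) i = if i ≤ -2 - (n : ℤ) ∨ w.length + 1 + n ≤ i then none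
      else some (halfStep M (cfg M w n) i) := by
    simp only [rowContent, e1, lo]
    push_cast
    rw [show (2 * (n : ℤ) + 1) / 2 = n by omega, show (2 * (n : ℤ) + 1 + 1) / 2 = n + 1 by omega,
      show -1 - ((n : ℤ) + 1) = -2 - n by ring, if_neg (show ¬ (2 * n + 1) % 2 = 0 by omega)]
  have hc1 : rowContent M w (2 * n + 2) i = if i ≤ -2 - (n : ℤ) ∨ w.length + 2 + n ≤ i then none
      else some (sym ((cfg M w (n + 1)).cell i)) := by
    simp only [rowContent, e2, lo]
    push_cast
    rw [show (2 * (n : ℤ) + 2 + 1) / 2 = n + 1 by omega, show (2 * (n : ℤ) + 2) / 2 = n + 1 by omega,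
      show -1 - ((n : ℤ) + 1) = -2 - n by ring, if_pos (show (2 * n + 2) % 2 = 0 by omega),
      show (w.length : ℤ) + 1 + (n + 1) = w.length + 2 + n by ring]
  rw [hst i, hst (i + 1), hc0, hc1, hC]
  clear hst hc0 hc1
  split_ifs <;> first | omega | skip
  · rw [arriving_of_ne (by simp only [sgn]; omega)]; rfl
  · exact scanRight_none hδ (by omega) (b3 i (by omega))
  · exact scanRight_some hδ
  · rfl

theorem stepAt_zero {i : ℤ} (h1 : -1 ≤ i) (h2 : i ≤ w.length + 1) :
    (tableau M w).stepAt (zigzag M) 0 i = some (rowContent M w 0 i,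
      if i = w.length + 1 then .turn .right else .seed (M.blank, none)) := by
  have hl : lo 0 = -1 := by simp [lo]
  simp only [Zigzag.Tableau.stepAt, tableau, zigzag, seedState, rowContent, hl]
  by_cases h3 : i = -1
  · subst h3
    simp [Ctl.op, show ¬ ((-1 : ℤ) = w.length + 1) by omega]
  · by_cases h4 : i = w.length + 1
    · subst h4
      simp [Ctl.op, h3]
    · rw [if_neg h3, if_neg h4, if_neg (show ¬ i = w.length + 2 by omega), if_neg h4,
        if_neg (by push_cast; omega)]
      rfl

/-- The tableau of a computation is the one that the automaton of the machine produces. -/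
theorem isValid_tableau (M : StdTM.Machine Q Γ) (w : List Γ) :
    (tableau M w).IsValid (zigzag M) where
  dir_st r i := by
    cases r with
    | zero =>
      rcases seedState_cases (M := M) w i with h | h | h | ⟨c, h⟩ <;>
        simp [tableau, zigzag, h, Ctl.dir, rowDir]
    | succ r =>
      rcases rowState_cases (M := M) w r i with h | ⟨κ, h⟩ | h | h <;>
        simp [tableau, zigzag, h, Ctl.dir]
  st_first := by simp [tableau, zigzag, seedState]
  st_ne_first r i hr := by
    obtain ⟨r, rfl⟩ := Nat.exists_eq_succ_of_ne_zero hr.ne'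
    rcases rowState_cases (M := M) w r i with h | ⟨κ, h⟩ | h | h <;>
      simp [tableau, zigzag, h]
  link_st r i s hr hs := by
    obtain ⟨r, rfl⟩ := Nat.exists_eq_succ_of_ne_zero hr.ne'
    rcases rowState_cases (M := M) w r i with h | ⟨κ, h⟩ | h | h <;>
      simp only [tableau, zigzag, h] at hs ⊢ <;> cases s <;> simp_all [Ctl.link]
  alive_of_succ r h := by
    simp only [tableau] at h ⊢
    rcases Nat.mod_two_eq_zero_or_one r with hr | hr
    · rw [show (r + 1 + 1) / 2 = (r + 1) / 2 + 1 by omega] at h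
      exact isSome_run_of_succ h
    · rwa [show (r + 1 + 1) / 2 = (r + 1) / 2 by omega] at h
  op_old r i _ h1 h2 := by
    simp only [hi, tableau] at h2
    simp only [tableau, rowState, zigzag]
    rw [if_pos ⟨h1, h2⟩]
    cases rowDir (r + 1) <;> split_ifs <;> exact ⟨_, rfl⟩
  op_new r i _ h1 h2 h3 := by
    simp only [hi, tableau] at h2 h3
    simp only [tableau, rowState, zigzag]
    rw [if_neg h3, if_pos ⟨h1, h2⟩]
    exact ⟨_, _, rfl⟩
  op_zero i h1 h2 := by
    simp only [hi, tableau] at h2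
    simp only [tableau, zigzag]
    unfold seedState
    push_cast at h2
    split_ifs
    · exact ⟨_, _, rfl⟩
    · exact ⟨_, _, rfl⟩
    · omega
    · exact ⟨_, _, rfl⟩
  op_fin r _ := by
    have h1 : (tableau M w).st r ((tableau M w).fin r) = .turn (rowDir r) := by
      cases r with
      | zero =>
        rw [tableau_st_zero, seedState, fin, if_pos rfl, tableau_hi, if_neg, if_neg, if_pos]
        · rfl
        all_goals push_cast; omega
      | succ r =>
        rw [tableau_st_succ]
        unfold rowState
        rcases (tableau M w).rowDir_cases (r + 1) with ⟨h, -, -, h1, -⟩ | ⟨h, -, -, h1, -⟩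
        · rw [h1, tableau_hi, if_neg, if_neg]
          · omega
          · push_cast; omega
        · rw [h1, if_neg, if_neg]
          · omega
          · simp only [lo]; push_cast; omega
    have h2 : (tableau M w).st (r + 1) ((tableau M w).ini (r + 1)) = .start (rowDir (r + 1)) := by
      rw [tableau_st_succ]
      unfold rowState
      rcases (tableau M w).rowDir_cases (r + 1) with ⟨h, -, h1, -, -⟩ | ⟨h, -, h1, -, -⟩
      · rw [h1, if_pos, if_pos]
        · rw [if_neg (by omega)]; simp only [lo]; push_cast; omega
        · simp only [lo]; push_cast; omega
      · rw [h1, tableau_hi, if_pos, if_pos]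
        · rw [if_pos (by omega)]; push_cast; omega
        · simp only [lo]; push_cast; omega
    rw [h1, h2, rowDir_succ]
    rfl
  step r i y s hr h1 h2 hs := by
    have hrun := isSome_run_of_built hr
    have hne : ∀ r i, rowState M w r i ≠ .first := fun r i h => by
      rcases rowState_cases (M := M) w r i with h' | ⟨κ, h'⟩ | h' | h' <;> simp [h'] at h
    have hdir : ∀ r i, (rowState M w r i).dir = rowDir (r + 1) := fun r i => by
      rcases rowState_cases (M := M) w r i with h' | ⟨κ, h'⟩ | h' | h' <;> simp [h', Ctl.dir]
    rcases Nat.mod_two_eq_zero_or_one r with hmod | hmod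
    · have hsgn : sgn (rowDir r) = 1 := by simp [rowDir, hmod, sgn]
      rw [hsgn]
      rcases r with _ | r
      · rw [tableau_hi] at h2
        have hl : lo 0 = -1 := by simp [lo]
        rw [hl] at h1
        push_cast at h2
        rw [stepAt_zero h1 (by omega)] at hs
        obtain ⟨rfl, rfl⟩ := Prod.mk.inj (Option.some.inj hs)
        -- In row 0 the next state written into the tiles is a fixed representative, so only the
        -- labels can agree with those of the actual states.
        refine ⟨rfl, ?_, by simp, by split <;> simp [zigzag], by split <;> rfl⟩
        rw [tableau_st_zero, seedState, if_neg (show ¬ i + 1 = -1 by omega)]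
        by_cases h3 : i = w.length + 1
        · rw [if_pos h3, if_neg (by omega), if_pos (by omega)]
        · rw [if_neg h3]
          by_cases h4 : i + 1 = w.length + 1
          · rw [if_pos h4]
            rfl
          · rw [if_neg h4, if_neg (by omega)]
            rfl
      · obtain ⟨n, rfl⟩ : ∃ n, r = 2 * n + 1 := ⟨r / 2, by omega⟩
        rw [show (2 * n + 1 + 1) / 2 = n + 1 by omega] at hrun
        rw [stepAt_right hrun h1 h2] at hs
        obtain ⟨rfl, rfl⟩ := Prod.mk.inj (Option.some.inj hs)
        exact ⟨rfl, rfl, fun _ => rfl, hne _ _, hdir _ _⟩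
    · have hsgn : sgn (rowDir r) = -1 := by simp [rowDir, hmod, sgn]
      rw [hsgn]
      obtain ⟨n, rfl⟩ : ∃ n, r = 2 * n + 1 := ⟨r / 2, by omega⟩
      rw [show (2 * n + 1) / 2 = n by omega] at hrun
      rw [stepAt_left hrun h1 h2] at hs
      split at hs
      · cases hs
      · obtain ⟨rfl, rfl⟩ := Prod.mk.inj (Option.some.inj hs)
        exact ⟨rfl, rfl, fun _ => rfl, hne _ _, hdir _ _⟩
  alive_iff r hr := by
    have hrun := isSome_run_of_built hr
    rcases Nat.mod_two_eq_zero_or_one r with hmod | hmod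
    · refine iff_of_true ?_ fun i h1 h2 => ?_
      · rwa [show r / 2 = (r + 1) / 2 by omega] at hrun
      · rcases r with _ | r
        · rw [tableau_hi] at h2
          push_cast at h2
          rw [stepAt_zero (by simpa [lo] using h1) (by omega)]
          simp
        · obtain ⟨n, rfl⟩ : ∃ n, r = 2 * n + 1 := ⟨r / 2, by omega⟩
          rw [show (2 * n + 1 + 1) / 2 = n + 1 by omega] at hrun
          rw [stepAt_right hrun h1 h2]
          simp
    · obtain ⟨n, rfl⟩ : ∃ n, r = 2 * n + 1 := ⟨r / 2, by omega⟩
      rw [show (2 * n + 1) / 2 = n by omega] at hrun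
      obtain ⟨b1, b2, -⟩ := cfg_bounds hrun
      have : (tableau M w).alive (2 * n + 1) ↔ (M.run w (n + 1)).isSome := by
        simp only [tableau, show (2 * n + 1 + 1) / 2 = n + 1 by omega]
      rw [this, isSome_run_succ_iff hrun]
      constructor
      · intro h i h1 h2
        rw [stepAt_left hrun h1 h2, if_neg (fun h' => h h'.2)]
        simp
      -- By `cfg_bounds` the head lies within the row, so the sweep does meet it and stops there.
      · intro h hδ
        have h1 : lo (2 * n + 1) ≤ (cfg M w n).head := by simp only [lo]; push_cast; omega
        have h2 : (cfg M w n).head ≤ (tableau M w).hi (2 * n + 1) := by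
          rw [tableau_hi]; push_cast; omega
        exact h _ h1 h2 (by rw [stepAt_left hrun h1 h2, if_pos ⟨rfl, hδ⟩])

end Steps

end TuringMachines

end PolyTAM

namespace PolyTAM

section Systems

open Turing (Dir)

/-! ### The tile set and the seeds -/

theorem Seg.finite_setOf_small {S Y : Type} [Finite S] [Finite Y] (K : ℕ) :
    {σ : Seg S Y | σ.Small K}.Finite := by
  have hp : {p : List Bool | p.length ≤ K}.Finite := List.finite_length_le Bool K
  have h1 := ((Set.finite_univ (α := S)).prod hp).image fun q => (Seg.fork q.1 q.2 : Seg S Y)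
  have h2 := ((Set.finite_univ (α := S × Bool)).prod hp).image
    fun q => (Seg.sense q.1.1 q.2 q.1.2 : Seg S Y)
  have h3 := ((Set.finite_univ (α := S)).prod (Set.finite_Iic K)).image
    fun q => (Seg.pass q.1 q.2 : Seg S Y)
  have h4 := ((Set.finite_univ (α := Dir × Y × S)).prod hp).image
    fun q => (Seg.write q.1.1 q.1.2.1 q.1.2.2 q.2 : Seg S Y)
  have h5 := (Set.finite_univ (α := S)).image fun s => (Seg.turn s : Seg S Y)
  refine ((((h1.union h2).union h3).union h4).union h5).subset ?_
  rintro (⟨s, p⟩ | ⟨s, p, b⟩ | ⟨s, n⟩ | ⟨d, y, s, p⟩ | s) h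
  · exact Or.inl (Or.inl (Or.inl (Or.inl ⟨(s, p), ⟨trivial, h⟩, rfl⟩)))
  · exact Or.inl (Or.inl (Or.inl (Or.inr ⟨((s, b), p), ⟨trivial, h⟩, rfl⟩)))
  · exact Or.inl (Or.inl (Or.inr ⟨(s, n), ⟨trivial, h⟩, rfl⟩))
  · exact Or.inl (Or.inr ⟨((d, y, s), p), ⟨trivial, h⟩, rfl⟩)
  · exact Or.inr ⟨s, trivial, rfl⟩

namespace Zigzag

variable {S Y : Type} (Z : Zigzag S Y)

/-- The tiles of a zigzag automaton. -/
def tiles : Set (PolyTile (Seg S Y × ℕ)) :=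
  {t | ∃ σ l, σ.Small Z.size ∧ l < (Z.piece σ).len ∧ t = Z.tile σ l}

theorem finite_tiles [Finite S] [Finite Y] : Z.tiles.Finite := by
  refine ((Seg.finite_setOf_small Z.size).biUnion fun σ _ =>
    (Set.finite_Iio (Z.piece σ).len).image (Z.tile σ)).subset ?_
  rintro t ⟨σ, l, hσ, hl, rfl⟩
  exact Set.mem_biUnion hσ ⟨l, hl, rfl⟩

theorem shape_of_mem_tiles {t : PolyTile (Seg S Y × ℕ)} (h : t ∈ Z.tiles) : t.shape = bar := by
  obtain ⟨σ, l, -, -, rfl⟩ := h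
  rfl

theorem glueLocations_tiles : glueLocations Z.tiles ⊆ ↑ports := by
  rintro e ⟨t, ⟨σ, l, -, -, rfl⟩, he⟩
  by_contra h
  exact he (if_neg h)

theorem isPositionLimited_tiles : IsPositionLimited 4 Z.tiles := by
  refine ⟨⟨bar, fun t => Z.shape_of_mem_tiles⟩, (Set.encard_le_encard Z.glueLocations_tiles).trans ?_⟩
  rw [Set.encard_coe_eq_coe_finsetCard, card_ports]

open scoped Classical in
/-- The tiles of placed segments. -/
noncomputable def assembly (l : List (Spot S Y)) : Finset (Placement (Seg S Y × ℕ)) :=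
  ((l.flatMap Z.barsOf).map Z.placed).toFinset

theorem mem_assembly {l : List (Spot S Y)} {p : Placement (Seg S Y × ℕ)} :
    p ∈ Z.assembly l ↔ ∃ x ∈ l, ∃ k < (Z.piece x.1).len, p = Z.placed (x, k) := by
  simp only [assembly, List.mem_toFinset, List.mem_map, List.mem_flatMap, mem_barsOf]
  constructor
  · rintro ⟨⟨x, k⟩, ⟨y, hy, rfl, hk⟩, rfl⟩
    exact ⟨_, hy, k, hk, rfl⟩
  · rintro ⟨x, hx, k, hk, rfl⟩
    exact ⟨(x, k), ⟨x, hx, rfl, hk⟩, rfl⟩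

/-- The segments of the first row in cell `i`. -/
def seedCell (i : ℤ) (s : S) (y : Y) (s' : S) : List (Spot S Y) :=
  Z.passes s 0 (Z.zone .right i) ++ Z.back 0 i y s'

/-- Translation of a placed segment by `i` cells. -/
def moved (i : ℤ) (x : Spot S Y) : Spot S Y := (x.1, x.2.1, x.2.2 + 2 * Z.size * i)

/-- A cell occupies `2 * size` zones, so blocks for equal contents are translates of one another;
this is why a seed can be composed of fixed blocks. -/
theorem map_moved_seedCell (i j : ℤ) {s : S} (hs : Z.dir s = .right) (y : Y) (s' : S) :
    (Z.seedCell j s y s').map (Z.moved i) = Z.seedCell (j + i) s y s' := by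
  simp only [seedCell, passes, back, writes, List.map_append, List.map_map, hs,
    show rowDir 0 = .right from rfl]
  congr 1 <;> refine List.map_congr_left fun k _ => ?_ <;>
    simp only [moved, Function.comp_apply, zone, Prod.mk.injEq, true_and] <;> ring

/-- The place of the cells of the space-time diagram. -/
def layout : Layout where
  origin := (13 * Z.size, 0)
  right := (26 * Z.size, 0)
  up := (0, 50)
  independent := by
    have := Z.size_pos
    simp only [mul_zero, sub_zero, ne_eq]
    omega

theorem layout_pos (n : ℕ) (i : ℤ) :
    Z.layout.pos n i = (13 * (2 * Z.size * i + Z.size), 50 * (n : ℤ)) := by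
  simp only [Layout.pos, layout, Prod.smul_mk, smul_eq_mul, Prod.mk_add_mk, Prod.mk.injEq]
  constructor <;> ring

theorem place_moved (i : ℤ) (x : Spot S Y) (k : ℕ) :
    Z.place (Z.moved i x, k) = Z.place (x, k) + i • Z.layout.right := by
  simp only [place, moved, Spot.origin, layout, Prod.smul_mk, smul_eq_mul, add_assoc,
    Prod.mk_add_mk]
  congr 2 <;> ring

open scoped Classical in
theorem image_translate_assembly (i : ℤ) (l : List (Spot S Y)) :
    (Z.assembly l).image (Placement.translate (i • Z.layout.right)) =
      Z.assembly (l.map (Z.moved i)) := by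
  ext p
  simp only [Finset.mem_image, mem_assembly, List.mem_map, exists_exists_and_eq_and]
  constructor
  · rintro ⟨_, ⟨x, hx, k, hk, rfl⟩, rfl⟩
    exact ⟨x, hx, k, hk, Prod.ext rfl (Z.place_moved i x k).symm⟩
  · rintro ⟨x, hx, k, hk, rfl⟩
    exact ⟨_, ⟨x, hx, k, hk, rfl⟩, Prod.ext rfl (Z.place_moved i x k).symm⟩

/-! ### The system seeded by the first row -/

namespace IsRoute

variable {Z} {X : ℕ → List (Spot S Y)}

/-- The system whose seed is the first part of a route. -/
noncomputable def system [Finite S] [Finite Y] (h : Z.IsRoute X)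
    (hsmall : ∀ x ∈ X 0, x.1.Small Z.size) : TileAssemblySystem (Seg S Y × ℕ) where
  tiles := Z.tiles
  tiles_finite := Z.finite_tiles
  strength _ := 1
  temperature := 1
  temperature_pos := Nat.one_pos
  seed := Z.assembly (X 0)
  seed_nonempty := by
    obtain ⟨x, t, hx, -⟩ := h.head
    exact ⟨Z.placed (x, 0), Z.mem_assembly.2 ⟨x, by simp [hx], 0, Piece.len_pos _, rfl⟩⟩
  seed_tiles p hp := by
    obtain ⟨x, hx, k, hk, rfl⟩ := Z.mem_assembly.1 hp
    exact ⟨x.1, k, hsmall x hx, hk, rfl⟩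
  seed_nonOverlapping p hp q hq hpq := by
    obtain ⟨x, hx, k, hk, rfl⟩ := Z.mem_assembly.1 hp
    obtain ⟨y, hy, m, hm, rfl⟩ := Z.mem_assembly.1 hq
    have : Std.Symm fun a b : Spot S Y × ℕ => Piece.Apart (Z.place a) (Z.place b) :=
      ⟨fun _ _ => Piece.Apart.symm⟩
    exact Z.disjoint_cells_iff.2 ((h.pairwise_bars 0).forall (mem_bars.2 ⟨hx, hk⟩)
      (mem_bars.2 ⟨hy, hm⟩) fun h => hpq (by rw [h]))
  seed_stable := by
    refine isStable_of_isChain (l := (bars Z X 0).map Z.placed) (fun p => ?_) ?_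
    · simp only [assembly, List.mem_toFinset, bars, List.flatMap]
    · rw [List.isChain_map]
      exact (h.isChain_bars 0).imp fun _ _ hab => hab.1.bond

theorem isTrack_system [Finite S] [Finite Y] (h : Z.IsRoute X)
    (hsmall : ∀ n, ∀ x ∈ X n, x.1.Small Z.size) :
    IsTrack (h.system (hsmall 0)) fun n => (bars Z X n).map Z.placed := by
  refine h.isTrack rfl rfl (fun p => ?_) ?_ fun n a ha => ?_
  · simp only [system, assembly, List.mem_toFinset, bars, List.flatMap]
  · rintro t ⟨σ, l, -, -, rfl⟩
    exact ⟨σ, l, rfl⟩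
  · obtain ⟨h1, h2⟩ := mem_bars.1 ha
    exact ⟨a.1.1, a.2, hsmall n _ h1, h2, rfl⟩

end IsRoute

/-- The parameters of all segments that occur are bounded, so one finite tile set serves for all
inputs and all times. -/
theorem Tableau.IsValid.small {T : Tableau S Y} {Z : Zigzag S Y} (hV : T.IsValid Z) {n : ℕ}
    {x : Spot S Y} (hx : x ∈ T.route Z n) : x.1.Small Z.size := by
  obtain ⟨r, -, hr, hx⟩ := hV.exists_mem_row hx
  exact (hV.within hr hx).2.1

theorem Tableau.IsValid.route_eq {T : Tableau S Y} {Z : Zigzag S Y} (hV : T.IsValid Z) {n m : ℕ}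
    (h : ¬ T.alive n) (hm : n ≤ m) : T.route Z m = T.route Z n := by
  have key : ¬ T.alive m ∧ T.route Z m = T.route Z n := by
    induction hm with
    | refl => exact ⟨h, rfl⟩
    | step _ ih =>
      exact ⟨fun h' => ih.1 (hV.alive_of_succ _ h'), (route_succ_of_not_alive ih.1).trans ih.2⟩
  exact key.2

end Zigzag

/-! ### The simulation -/

theorem fst_sym {Q Γ : Type} (c : Γ × Option Q) : ((sym c).1, (sym c).2.map Prod.fst) = c := by
  obtain ⟨γ, _ | q⟩ := c <;> rfl

theorem rowContent_even {Q Γ : Type} {M : StdTM.Machine Q Γ} {w : List Γ} {n : ℕ}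
    {C : StdTM.Cfg Q Γ} (h : M.run w n = some C) (i : ℤ) :
    rowContent M w (2 * n) i = if -1 - (n : ℤ) < i ∧ i < w.length + 1 + n
      then some (sym (C.cell i)) else none := by
  have hC : cfg M w n = C := by rw [cfg, h]; rfl
  rw [rowContent, if_pos (show 2 * n % 2 = 0 by omega), show 2 * n / 2 = n by omega, hC]
  have hlo : Zigzag.Tableau.lo (2 * n) = -1 - n := by
    simp only [Zigzag.Tableau.lo]; push_cast; omega
  rw [hlo]
  by_cases h1 : -1 - (n : ℤ) < i ∧ i < w.length + 1 + n
  · rw [if_pos h1, if_neg (by push_cast; omega)]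
  · rw [if_neg h1, if_pos (by push_cast; omega)]

variable {Q Γ : Type} [Finite Q] [Finite Γ] (M : StdTM.Machine Q Γ)

/-- The glues of the simulation. -/
abbrev SimGlue (Q Γ : Type) := Seg (Ctl Q Γ) (Sym Q Γ) × ℕ

/-- What a tile displays: the tiles with which a sweep to the right begins to write a symbol
display this symbol. -/
noncomputable def readTile (t : PolyTile (SimGlue Q Γ)) : Option (Γ × Option Q) :=
  match t.glue ((0, 0), .west) with
  | some (.write .right (some c) _ p, 0) =>
    if p.length = (zigzag M).size then some (c.1, c.2.map Prod.fst) else none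
  | _ => none

/-- The left end of the seeds. -/
noncomputable def leftEnd : Finset (Placement (SimGlue Q Γ)) :=
  (zigzag M).assembly ((zigzag M).seedCell (-1) .first none (.seed (M.blank, none)))

/-- The part of the seeds for a cell with the given content. -/
noncomputable def seedBlock (c : Γ × Option Q) : Finset (Placement (SimGlue Q Γ)) :=
  (zigzag M).assembly ((zigzag M).seedCell 0 (.seed c) (some (sym c)) (.seed (M.blank, none)))

/-- The right end of the seeds. -/
noncomputable def rightEnd : Finset (Placement (SimGlue Q Γ)) :=
  (zigzag M).assembly ((zigzag M).seedCell 0 .seedEnd none (.turn .right) ++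
    [(.turn (.turn .right), 0, (zigzag M).zone .right 1)])

variable {M} {w : List Γ}

theorem front_zero {i : ℤ} (h1 : -1 ≤ i) (h2 : i ≤ w.length + 1) :
    (tableau M w).front (zigzag M) 0 i =
      (zigzag M).passes (seedState M w i) 0 ((zigzag M).zone .right i) := by
  obtain ⟨y, s, h⟩ := (isValid_tableau M w).op_zero i (by simpa [Zigzag.Tableau.lo] using h1)
    (by rw [tableau_hi]; push_cast; omega)
  simp only [Zigzag.Tableau.front, h]
  rfl

/-- Row 0 falls into pieces that depend on one cell each. The input enters through the contents of
the cells and through the position of the right end. -/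
theorem mem_row_zero {x : Spot (Ctl Q Γ) (Sym Q Γ)} : x ∈ (tableau M w).row (zigzag M) 0 ↔
    x ∈ (zigzag M).seedCell (-1) .first none (.seed (M.blank, none)) ∨
    (∃ i : ℕ, i ≤ w.length ∧ x ∈ (zigzag M).seedCell i (.seed ((M.init w).cell i))
      (some (sym ((M.init w).cell i))) (.seed (M.blank, none))) ∨
    x ∈ (zigzag M).seedCell (w.length + 1) .seedEnd none (.turn .right) ∨
    x = (.turn (.turn .right), 0, (zigzag M).zone .right (w.length + 2)) := by
  have hV := isValid_tableau M w
  have hhi : (tableau M w).hi 0 = w.length + 1 := by rw [tableau_hi]; simp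
  have hlo : Zigzag.Tableau.lo 0 = -1 := by simp [Zigzag.Tableau.lo]
  have hfin : (tableau M w).fin 0 = w.length + 2 := by
    rw [Zigzag.Tableau.fin, if_pos rfl, hhi]; ring
  have hst : (tableau M w).st 0 (w.length + 2) = .turn .right := by
    rw [tableau_st_zero, seedState, if_neg (by omega), if_neg (by omega), if_pos rfl]
  have hcell : ∀ i, -1 ≤ i → i ≤ (w.length : ℤ) + 1 →
      ((x ∈ (tableau M w).front (zigzag M) 0 i ∨ ∃ s, (tableau M w).stepAt (zigzag M) 0 i =
        some ((tableau M w).cont 0 i, s) ∧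
          x ∈ (zigzag M).back 0 i ((tableau M w).cont 0 i) s) ↔
        x ∈ (zigzag M).seedCell i (seedState M w i) (rowContent M w 0 i)
          (if i = w.length + 1 then .turn .right else .seed (M.blank, none))) := by
    intro i h1 h2
    rw [front_zero h1 h2, stepAt_zero h1 h2, Zigzag.seedCell, List.mem_append]
    refine or_congr Iff.rfl ⟨?_, fun h => ⟨_, rfl, h⟩⟩
    rintro ⟨s, hs, hx⟩
    obtain ⟨-, rfl⟩ := Prod.mk.inj (Option.some.inj hs)
    exact hx
  have hcont := rowContent_even (M := M) (w := w) (n := 0) rfl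
  simp only [mul_zero, Nat.cast_zero, sub_zero, add_zero] at hcont
  have ha : (tableau M w).alive 0 := rfl
  rw [hV.mem_row_of_alive (fun n hn => by omega) ha, hfin, hst, hhi, hlo, ← or_assoc, ← or_assoc]
  refine or_congr ?_ Iff.rfl
  have hl : (zigzag M).seedCell (-1) (seedState M w (-1)) (rowContent M w 0 (-1))
      (if (-1 : ℤ) = w.length + 1 then .turn .right else .seed (M.blank, none)) =
      (zigzag M).seedCell (-1) .first none (.seed (M.blank, none)) := by
    rw [hcont, if_neg (by omega), if_neg (by omega), seedState, if_pos rfl]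
  have hr : (zigzag M).seedCell (w.length + 1) (seedState M w (w.length + 1))
      (rowContent M w 0 (w.length + 1))
      (if (w.length : ℤ) + 1 = w.length + 1 then .turn .right else .seed (M.blank, none)) =
      (zigzag M).seedCell (w.length + 1) .seedEnd none (.turn .right) := by
    rw [hcont, if_neg (by omega), if_pos rfl, seedState, if_neg (by omega), if_pos rfl]
  have hm : ∀ i : ℕ, i ≤ w.length → (zigzag M).seedCell i (seedState M w i) (rowContent M w 0 i)
      (if (i : ℤ) = w.length + 1 then .turn .right else .seed (M.blank, none)) =
      (zigzag M).seedCell i (.seed ((M.init w).cell i)) (some (sym ((M.init w).cell i)))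
        (.seed (M.blank, none)) := by
    intro i hi
    rw [hcont, if_pos (by omega), if_neg (by omega), seedState, if_neg (by omega),
      if_neg (by omega), if_neg (by omega)]
  constructor
  · rintro ⟨i, h1, h2, hx⟩
    rw [hcell i h1 h2] at hx
    rcases eq_or_lt_of_le h1 with rfl | h1
    · exact Or.inl (Or.inl (hl ▸ hx))
    rcases eq_or_lt_of_le h2 with rfl | h2
    · exact Or.inr (hr ▸ hx)
    obtain ⟨k, rfl⟩ := Int.eq_ofNat_of_zero_le (show 0 ≤ i by omega)
    exact Or.inl (Or.inr ⟨k, by omega, hm k (by omega) ▸ hx⟩)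
  · rintro ((hx | ⟨k, hk, hx⟩) | hx)
    · exact ⟨-1, le_rfl, by omega, (hcell _ le_rfl (by omega)).2 (hl ▸ hx)⟩
    · exact ⟨k, by omega, by omega, (hcell _ (by omega) (by omega)).2 (hm k hk ▸ hx)⟩
    · exact ⟨w.length + 1, by omega, le_rfl, (hcell _ (by omega) le_rfl).2 (hr ▸ hx)⟩

/-- The blocks fit together for every input because each hands on the same glue, the common label of
`.seed` and `.seedEnd`; the last block ends with the turn. -/
theorem assembly_route_zero : (zigzag M).assembly ((tableau M w).route (zigzag M) 0) =
    inputSeed (zigzag M).layout (leftEnd M) (rightEnd M) (seedBlock M) M w := by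
  classical
  ext p
  have hturn : (zigzag M).moved ((w.length : ℤ) + 1)
      (.turn (.turn .right), 0, (zigzag M).zone .right 1) =
      (.turn (.turn .right), 0, (zigzag M).zone .right (w.length + 2)) := by
    simp only [Zigzag.moved, Zigzag.zone, Prod.mk.injEq, true_and]
    ring
  have hblock : ∀ i : ℤ, (seedBlock M ((M.init w).cell i)).image
      (Placement.translate (i • (zigzag M).layout.right)) =
      (zigzag M).assembly ((zigzag M).seedCell i (.seed ((M.init w).cell i))
        (some (sym ((M.init w).cell i))) (.seed (M.blank, none))) := by
    intro i
    rw [seedBlock, Zigzag.image_translate_assembly, Zigzag.map_moved_seedCell _ _ _ rfl, zero_add]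
  have hright : (rightEnd M).image
      (Placement.translate (((w.length : ℤ) + 1) • (zigzag M).layout.right)) =
      (zigzag M).assembly ((zigzag M).seedCell (w.length + 1) .seedEnd none (.turn .right) ++
        [(.turn (.turn .right), 0, (zigzag M).zone .right (w.length + 2))]) := by
    rw [rightEnd, Zigzag.image_translate_assembly, List.map_append,
      Zigzag.map_moved_seedCell _ _ _ rfl, zero_add, List.map_singleton, hturn]
  have hseed : p ∈ inputSeed (zigzag M).layout (leftEnd M) (rightEnd M) (seedBlock M) M w ↔
      p ∈ leftEnd M ∨ (∃ i < w.length + 1, p ∈ (zigzag M).assembly ((zigzag M).seedCell (i : ℕ)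
        (.seed ((M.init w).cell i)) (some (sym ((M.init w).cell i))) (.seed (M.blank, none)))) ∨
      p ∈ (zigzag M).assembly ((zigzag M).seedCell (w.length + 1) .seedEnd none (.turn .right) ++
        [(.turn (.turn .right), 0, (zigzag M).zone .right (w.length + 2))]) := by
    rw [← hright]
    simp only [inputSeed, ← hblock, Finset.mem_union, Finset.mem_biUnion, Finset.mem_range,
      or_assoc]
  rw [hseed, leftEnd]
  simp only [Zigzag.mem_assembly, Zigzag.Tableau.route, mem_row_zero, List.mem_append,
    List.mem_singleton]
  constructor
  · rintro ⟨x, hx | ⟨i, hi, hx⟩ | hx, k, hk, rfl⟩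
    · exact Or.inl ⟨x, hx, k, hk, rfl⟩
    · exact Or.inr (Or.inl ⟨i, by omega, x, hx, k, hk, rfl⟩)
    · exact Or.inr (Or.inr ⟨x, hx, k, hk, rfl⟩)
  · rintro (⟨x, hx, k, hk, rfl⟩ | ⟨i, hi, x, hx, k, hk, rfl⟩ | ⟨x, hx, k, hk, rfl⟩)
    · exact ⟨x, Or.inl hx, k, hk, rfl⟩
    · exact ⟨x, Or.inr (Or.inl ⟨i, by omega, hx⟩), k, hk, rfl⟩
    · exact ⟨x, Or.inr (Or.inr hx), k, hk, rfl⟩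

/-! ### Displayed cells and the correctness of the simulation -/

theorem entry_write_right (b : Bool) : (Piece.write .right b).entry 0 = ((0, 0), .west) := by
  cases b <;> rfl

theorem pos_write_right (b : Bool) : (Piece.write .right b).pos 0 = (0, 0) := by
  cases b <;> rfl

/-- The condition on `p` singles out the first bit of a symbol, and index 0 its first bar, so each
symbol is displayed exactly at the start of its written half. -/
theorem readTile_eq_some {σ : Seg (Ctl Q Γ) (Sym Q Γ)} {l : ℕ} {c : Γ × Option Q}
    (h : readTile M ((zigzag M).tile σ l) = some c) : l = 0 ∧ ∃ c' s p,
      σ = .write .right (some c') s p ∧ p.length = (zigzag M).size ∧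
        c = (c'.1, c'.2.map Prod.fst) := by
  unfold readTile at h
  split at h
  · rename_i c' s p hg
    split_ifs at h with hp
    rcases (zigzag M).tile_glue_cases hg with ⟨-, h1⟩ | h1
    · unfold Zigzag.glueIn at h1
      split_ifs at h1 with hl
      · refine ⟨hl, c', s, p, ?_, hp, (Option.some.inj h).symm⟩
        rcases σ with _ | _ | ⟨s, _ | n⟩ | _ | _ <;> simp_all [Zigzag.label]
      · exact absurd (Prod.mk.inj h1).2.symm hl
    -- The last bar before a written symbol carries the same glue, but as an outgoing one and
    -- therefore on its eastern side.
    · have := (zigzag M).glueOut_side h1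
      simp [Zigzag.inSide, Zigzag.piece, entry_write_right, Side.opp] at this
  · cases h

theorem readTile_write (c : Γ × Option Q) (s : Ctl Q Γ) :
    readTile M ((zigzag M).tile
      (.write .right (some (sym c)) s ((zigzag M).bits .right (some (sym c)))) 0) = some c := by
  have : ((zigzag M).tile (.write .right (some (sym c)) s
      ((zigzag M).bits .right (some (sym c)))) 0).glue ((0, 0), .west) =
      some (.write .right (some (sym c)) s ((zigzag M).bits .right (some (sym c))), 0) := by
    simp [Zigzag.tile, Zigzag.piece, entry_write_right, ports, Zigzag.glueIn, Zigzag.label]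
  rw [readTile, this]
  simp only [Zigzag.length_bits, if_true, fst_sym]

theorem built_of_run {n : ℕ} (h : (M.run w n).isSome) :
    (tableau M w).Built (2 * n) ∧ (tableau M w).alive (2 * n) := by
  have ha : (tableau M w).alive (2 * n) := by
    simpa only [tableau, show (2 * n + 1) / 2 = n by omega] using h
  exact ⟨((isValid_tableau M w).built_succ ha).of_succ, ha⟩

/-- Displaying tiles occur only in sweeps to the right, that is in even rows, and row `2 * n`
contains the configuration at time `n`. The track property carries this over to all assembly
sequences. -/
theorem simulates (𝒯 : TileAssemblySystem (SimGlue Q Γ))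
    (h : IsTrack 𝒯 fun n =>
      (Zigzag.IsRoute.bars (zigzag M) ((tableau M w).route (zigzag M)) n).map (zigzag M).placed) :
    Simulates 𝒯 (zigzag M).layout (readTile M) M w where
  sound A hA t p c hp hc := by
    have hV := isValid_tableau M w
    obtain ⟨m, hm⟩ := h.mem_of_producible hA hp
    obtain ⟨⟨x, l⟩, ha, hx⟩ := List.mem_map.1 hm
    obtain ⟨rfl, rfl⟩ := Prod.mk.inj hx
    obtain ⟨rfl, c', s, q, hσ, hq, rfl⟩ := readTile_eq_some hc
    obtain ⟨r, -, hr, hxr⟩ := hV.exists_mem_row (Zigzag.IsRoute.mem_bars.1 ha).1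
    dsimp only at hσ hxr
    obtain ⟨hx1, -, hx2⟩ := hV.within hr hxr
    rw [hσ] at hx2
    rcases hx2 with ⟨_, _, -, -, -, -, h' | h' | h'⟩ | ⟨i, j, s', -, -, hj, hz, h'⟩ | ⟨h', -⟩
    · simp [Zigzag.piece] at h'
    · simp [Zigzag.piece] at h'
    · simp [Zigzag.piece] at h'
    · rw [Seg.write.injEq] at h'
      obtain ⟨hd, hcont, -, hbits⟩ := h'
      have hev : r % 2 = 0 := by
        by_contra hodd
        rw [rowDir, if_neg hodd] at hd
        cases hd
      obtain ⟨n, rfl⟩ : ∃ n, r = 2 * n := ⟨r / 2, by omega⟩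
      have hj0 : j = 0 := by
        rw [hbits, List.length_drop, Zigzag.length_bits] at hq
        omega
      have hrun := isSome_run_of_built hr
      rw [show 2 * n / 2 = n by omega] at hrun
      have hrun' := run_eq_cfg hrun
      refine ⟨n, i, _, hrun', ?_, ?_⟩
      · rw [Zigzag.layout_pos, Zigzag.place, hσ, Zigzag.piece, pos_write_right, Spot.origin, hx1, hz,
          ← hd, hj0]
        simp only [Zigzag.writeOffset, Prod.mk_add_mk, Prod.mk.injEq]
        push_cast
        constructor <;> ring
      · have hcont' : some c' = rowContent M w (2 * n) i := hcont
        rw [rowContent_even hrun'] at hcont'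
        split_ifs at hcont'
        rw [Option.some.inj hcont', fst_sym]
    · simp [Zigzag.piece] at h'
  complete A hA n C hC := by
    have hV := isValid_tableau M w
    have hrun : (M.run w n).isSome := by rw [hC]; rfl
    obtain ⟨hb, ha⟩ := built_of_run hrun
    obtain ⟨B, hB, hmem⟩ := h.exists_grows hA (2 * n)
    refine ⟨B, hB, fun i hi => ?_⟩
    have hCn : cfg M w n = C := by rw [cfg, hC]; rfl
    obtain ⟨b1, b2, b3⟩ := cfg_bounds hrun
    rw [hCn] at b1 b2 b3
    -- Beyond the markers the cells are blank and without a head, so nothing has to be displayed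
    -- there.
    have hin : -1 - (n : ℤ) < i ∧ i < w.length + 1 + n := by
      by_contra hout
      refine hi (Prod.ext (b3 i (by omega)) (if_neg ?_))
      omega
    have hc : (tableau M w).cont (2 * n) i = some (sym (C.cell i)) := by
      have := rowContent_even hC i
      rwa [if_pos hin] at this
    have hlo : Zigzag.Tableau.lo (2 * n) ≤ i := by
      simp only [Zigzag.Tableau.lo]; push_cast; omega
    have hhi : i ≤ (tableau M w).hi (2 * n) := by
      rw [tableau_hi]; push_cast; omega
    have hd : rowDir (2 * n) = .right := by rw [rowDir, if_pos (by omega)]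
    obtain ⟨⟨y, s⟩, hs⟩ := Option.ne_none_iff_exists'.1 ((hV.alive_iff _ hb).1 ha i hlo hhi)
    obtain rfl := (hV.step _ i y s hb hlo hhi hs).1
    refine ⟨_, ?_, readTile_write (C.cell i) s⟩
    have hx := (hV.mem_row_of_alive hb ha).2 (Or.inl ⟨i, hlo, hhi, Or.inr ⟨s, hs,
      Zigzag.Tableau.mem_back.2 ⟨0, (zigzag M).size_pos, rfl⟩⟩⟩)
    have := hmem _ (List.mem_map_of_mem (f := (zigzag M).placed) (Zigzag.IsRoute.mem_bars.2
      (And.intro (a := (_, 0).1 ∈ _) (Zigzag.Tableau.mem_route_of_built hb hx) (Piece.len_pos _))))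
    rw [hc, hd, List.drop_zero] at this
    have hpos : (zigzag M).layout.pos n i = (zigzag M).place ((.write .right (some (sym (C.cell i))) s
        ((zigzag M).bits .right (some (sym (C.cell i)))), 2 * n,
          2 * (zigzag M).size * i + (zigzag M).writeOffset .right 0), 0) := by
      rw [Zigzag.layout_pos, Zigzag.place, Zigzag.piece, pos_write_right, Spot.origin]
      simp only [Zigzag.writeOffset, Prod.mk_add_mk, Prod.mk.injEq]
      push_cast
      constructor <;> ring
    rw [hpos]
    exact this
  finite_of_halts := by
    rintro ⟨n, hn⟩ A hA
    have hV := isValid_tableau M w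
    -- Once the run has ended the route is stationary, so all assemblies lie in one finite list of
    -- tiles.
    have ha : ¬ (tableau M w).alive (2 * n) := by
      simp only [tableau, show (2 * n + 1) / 2 = n by omega, hn]
      simp
    refine ((Zigzag.IsRoute.bars (zigzag M) ((tableau M w).route (zigzag M)) (2 * n)).map
      (zigzag M).placed).finite_toSet.subset fun x hx => ?_
    obtain ⟨m, hm⟩ := h.mem_of_producible hA hx
    rcases le_total m (2 * n) with hmn | hmn
    · exact (h.prefix_of_le hmn).subset hm
    · simp only [Zigzag.IsRoute.bars, hV.route_eq ha hmn] at hm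
      exact hm

end Systems

end PolyTAM

theorem mainTheorem6 :
    ∃ S : Finset PolyTAM.Edge, S ⊆ PolyTAM.edges PolyTAM.bar ∧ S.card = 4 ∧
      ∀ (Q Γ : Type) [Finite Q] [Finite Γ] (M : StdTM.Machine Q Γ),
        ∃ (G : Type) (T : Set (PolyTAM.PolyTile G)) (strength : G → ℤ)
          (L : PolyTAM.Layout) (read : PolyTAM.PolyTile G → Option (Γ × Option Q))
          (leftEnd rightEnd : Finset (PolyTAM.Placement G))
          (block : Γ × Option Q → Finset (PolyTAM.Placement G)),
          T.Finite ∧ (∀ t ∈ T, t.shape = PolyTAM.bar) ∧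
          PolyTAM.glueLocations T ⊆ ↑S ∧ PolyTAM.IsPositionLimited 4 T ∧
          ∀ w : List Γ, ∃ 𝒯 : PolyTAM.TileAssemblySystem G,
            𝒯.tiles = T ∧ 𝒯.strength = strength ∧ 𝒯.temperature = 1 ∧
            𝒯.seed = PolyTAM.inputSeed L leftEnd rightEnd block M w ∧
            PolyTAM.Simulates 𝒯 L read M w := by
  refine ⟨PolyTAM.ports, PolyTAM.ports_subset, PolyTAM.card_ports, fun Q Γ _ _ M =>
    ⟨PolyTAM.SimGlue Q Γ, (PolyTAM.zigzag M).tiles, fun _ => 1, (PolyTAM.zigzag M).layout,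
      PolyTAM.readTile M, PolyTAM.leftEnd M, PolyTAM.rightEnd M, PolyTAM.seedBlock M,
      (PolyTAM.zigzag M).finite_tiles, fun t => (PolyTAM.zigzag M).shape_of_mem_tiles,
      (PolyTAM.zigzag M).glueLocations_tiles, (PolyTAM.zigzag M).isPositionLimited_tiles,
      fun w => ?_⟩⟩
  have hV := PolyTAM.isValid_tableau M w
  exact ⟨hV.isRoute.system fun x => hV.small, rfl, rfl, rfl, PolyTAM.assembly_route_zero,
    PolyTAM.simulates _ (hV.isRoute.isTrack_system fun n x => hV.small)⟩
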